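/- **Setting.** Let $n=n(p)$ with $p=o(n^{2/3})$ as $p\to\infty$, and let $\sigma>0$ be known. Let $X\in\mathbb R^{n\times p}$ have i.i.d. entries with the law of $Z/\sqrt n$, where $Z\sim P$ for a fixed distribution $P$ with mean zero, variance one and $\mathbb E e^{tZ}\le e^{K^2t^2/2}$ for all $t\in\mathbb R$ and some finite $K$. Let $\Theta\subset\mathbb R^k$ be compact and $\theta_0\in\operatorname{int}\Theta$. For $\theta\in\Theta$ let $\mu_\theta$ be a probability measure on $\mathbb R$ with density $e^{\ell(\theta;b)}$ with respect to a base measure $\nu$ on $S$ (and no mass off $S$), where $S=\operatorname{supp}\mu_\theta$ is bounded and does not depend on $\theta$. Assume that $\ell$ is continuous on $\Theta\times S$, that for every $b\in S$ the map $\theta\mapsto\ell(\theta;b)$ is differentiable on $\operatorname{int}\Theta$, and that $\sup_{\theta\in\operatorname{int}\Theta,\,b\in S}\|\nabla_\theta\ell(\theta;b)\|<\infty$. For $y\in\mathbb R^n$ let $\mathbb P_\theta$ be the posterior of $\beta$, $$d\mathbb P_\theta(\beta)\ \propto\ \exp\Big(-\frac{\|y-X\beta\|^2}{2\sigma^2}\Big)\prod_{i=1}^p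 d\mu_\theta(\beta_i),$$ and let $\mathbb Q_\theta$ be its mean-field approximation, that is, the minimizer of $\mathrm{D_{KL}}(\mathbb Q\mid\mathbb P_\theta)$ over product probability measures $\mathbb Q=\prod_{i=1}^pQ_i$ in which every $Q_i$ has the same support as $\mu_\theta$. Let $\hat\theta_p=\hat\theta_p(y,X)\in\Theta$ be any estimator. Thus $\mathbb P_{\theta_0}$ is the oracle posterior, $\mathbb P_{\hat\theta_p}$ the EB posterior, and $\mathbb Q_{\theta_0},\mathbb Q_{\hat\theta_p}$ are their variational approximations. Write $\mathbb P(\beta_i)$ for the law of the $i$-th coordinate under $\mathbb P$, and $\mathrm{D_{TV}}(P,Q)=\sup_E|P(E)-Q(E)|$, the supremum being over Borel sets $E\subseteq\mathbb R$. A bound $O_{P,X}(r)$ refers to the randomness of $X$ only, uniformly in the data $y$, the estimator and the coordinate: for every $\varepsilon>0$ there are $C$ and $p_0$ such that, for all $p\ge p_0$ and every estimator $\hat\theta_p$, with probability at least $1-\varepsilon$ over $X$ the quantity is at most $C\,r$ simultaneously for all $y\in\mathbb R^n$ and all $i\le p$. **Theorem.** With probability tending to one over $X$, the minimizers $\mathbb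 Q_{\theta_0}$ and $\mathbb Q_{\hat\theta_p}$ exist and are unique for all $y$, and the following holds. (a) $$\mathrm{D_{TV}}\big(\mathbb P_{\theta_0}(\beta_i),\mathbb Q_{\theta_0}(\beta_i)\big)=O_{P,X}\Big(\sqrt{\tfrac pn}\Big),\qquad \mathrm{D_{TV}}\big(\mathbb P_{\hat\theta_p}(\beta_i),\mathbb Q_{\hat\theta_p}(\beta_i)\big)=O_{P,X}\Big(\sqrt{\tfrac pn}\Big),$$ and likewise $$\big|\mathbb E_{\mathbb P_{\theta}}[\beta_i]-\mathbb E_{\mathbb Q_{\theta}}[\beta_i]\big|=O_{P,X}\Big(\sqrt{\tfrac pn}\Big),\qquad \big|\operatorname{Var}_{\mathbb P_{\theta}}[\beta_i]-\operatorname{Var}_{\mathbb Q_{\theta}}[\beta_i]\big|=O_{P,X}\Big(\sqrt{\tfrac pn}\Big)$$ for $\theta=\theta_0$ and for $\theta=\hat\theta_p$. (b) With $r_p:=\sqrt{\tfrac pn}+\big(\tfrac p{\sqrt n}+1\big)\|\hat\theta_p-\theta_0\|$, $$\mathrm{D_{TV}}\big(\mathbb P_{\theta_0}(\beta_i),\mathbb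 Q_{\hat\theta_p}(\beta_i)\big)=O_{P,X}(r_p),$$ $$\big|\mathbb E_{\mathbb P_{\theta_0}}[\beta_i]-\mathbb E_{\mathbb Q_{\hat\theta_p}}[\beta_i]\big|=O_{P,X}(r_p),\qquad \big|\operatorname{Var}_{\mathbb P_{\theta_0}}[\beta_i]-\operatorname{Var}_{\mathbb Q_{\hat\theta_p}}[\beta_i]\big|=O_{P,X}(r_p).$$ -/

import Mathlib

open MeasureTheory ProbabilityTheory Filter Asymptotics
open scoped Topology ENNReal NNReal Matrix

namespace VEB

noncomputable section

/-- The law of an `n × p` random design whose entries are i.i.d. with law `n ^ (-1/2) P`, that is,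
the law of `Z / √n` for `Z ∼ P`. -/
def designLaw (P : Measure ℝ) (n p : ℕ) : Measure (Fin n → Fin p → ℝ) :=
  Measure.pi fun _ => Measure.pi fun _ => P.map fun z => z / Real.sqrt n

/-- The prior `μ_θ` on `ℝ`: it has density `exp (ℓ θ b)` with respect to the base measure `ν` on the
set `S`, and no mass outside `S` (values of `ℓ` off `S` play no role). -/
def prior {k : ℕ} (ν : Measure ℝ) (S : Set ℝ) (ℓ : EuclideanSpace ℝ (Fin k) → ℝ → ℝ)
    (θ : EuclideanSpace ℝ (Fin k)) : Measure ℝ :=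
  (ν.restrict S).withDensity fun b => ENNReal.ofReal (Real.exp (ℓ θ b))

/-- The posterior of `β` given `(y, X)` in the model `y ∣ X, β ∼ N(X β, σ² I)` with i.i.d. prior `m`
on the coordinates of `β`: it is proportional to `exp (-‖y - X β‖² / (2 σ²)) ∏ᵢ dm(βᵢ)`. -/
def posterior (σ : ℝ) (m : Measure ℝ) {n p : ℕ} (X : Fin n → Fin p → ℝ) (y : Fin n → ℝ) :
    Measure (Fin p → ℝ) :=
  (Measure.pi fun _ => m).tilted fun β =>
    -(∑ a, (y a - (Matrix.of X *ᵥ β) a) ^ 2) / (2 * σ ^ 2)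

/-- Product probability measures on `ℝ^p` all of whose factors have the same support as `m`. -/
def productFamily (m : Measure ℝ) (p : ℕ) : Set (Measure (Fin p → ℝ)) :=
  {Q | ∃ q : Fin p → Measure ℝ, (∀ i, IsProbabilityMeasure (q i)) ∧
    (∀ i, (q i).support = m.support) ∧ Q = Measure.pi q}

/-- `Q` is a mean-field variational posterior: it minimizes `Q' ↦ KL(Q' ∣ posterior)` over the
product measures whose factors have the same support as the prior `m`. -/
def IsVariationalPosterior (σ : ℝ) (m : Measure ℝ) {n p : ℕ} (X : Fin n → Fin p → ℝ)
    (y : Fin n → ℝ) (Q : Measure (Fin p → ℝ)) : Prop :=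
  Q ∈ productFamily m p ∧
    ∀ Q' ∈ productFamily m p,
      InformationTheory.klDiv Q (posterior σ m X y) ≤
        InformationTheory.klDiv Q' (posterior σ m X y)

/-- Total variation distance `sup_E |P E - Q E|` over Borel sets `E ⊆ ℝ`. -/
def tvDist (P Q : Measure ℝ) : ℝ :=
  ⨆ E : {E : Set ℝ // MeasurableSet E}, |P.real E - Q.real E|

/-- The law of the `i`-th coordinate. -/
def marginal {p : ℕ} (P : Measure (Fin p → ℝ)) (i : Fin p) : Measure ℝ :=
  P.map fun β => β i

/-- The `i`-th marginals of `P` and `Q` are within `r` of each other in total variation distance,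
and so are their means and their variances. -/
def MarginalsClose {p : ℕ} (P Q : Measure (Fin p → ℝ)) (i : Fin p) (r : ℝ) : Prop :=
  tvDist (marginal P i) (marginal Q i) ≤ r ∧
    |(∫ β, β i ∂P) - ∫ β, β i ∂Q| ≤ r ∧
    |Var[fun β => β i; P] - Var[fun β => β i; Q]| ≤ r

end

end VEB

namespace VEB

/-! Expanding the square writes the posterior as a Gibbs measure: a product of one-site tilts of the
prior (`siteExponent`), tilted by `-β ⬝ᵥ J β / 2`, where `J` is the off-diagonal Gram matrix divided
by `σ ^ 2`. The data `y` enter only the one-site factors. All probability over the design is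
therefore in a single event, on which `J` has operator norm at most `η`, of order `√(p/n)`. This
event comes from `designLaw_gram_concentration`, whose proof averages over a ball in place of a net.
On it every estimate is deterministic, hence uniform in `y`, the estimator and the coordinate.

The main estimate is `gibbs_variance_le`: linear statistics of a Gibbs measure with small `J` have
variance `O(‖v‖²)`, although the priors need not be log-concave. Up to a one-site correction, the
interaction is a sum of squares. Hubbard–Stratonovich turns each square into a Gaussian integral,
and Prékopa–Leindler propagates a bound on `F(h + v) F(h - v) / F(h)²` through each integration
(`partition_mul_le`), starting from Hoeffding's lemma for product measures.

The conditional law of `β i` is an exponential tilt by the local field `-(J β) i`, whose variance is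
`O(η²)`. In a Taylor expansion of the tilted mean at the average field, the linear term integrates
to zero. The posterior mean thus solves the mean-field equations up to `O(η²)` per coordinate.
Contraction in `ℓ²` puts it within `O(√p η²)` of their solution, and this is `O(1)` because `p³ ≤
n²`. One more application of `J` makes the fields agree up to `O(η)`, hence also the marginals
(`gibbs_meanField_close`).

The mean-field solution gives the unique variational minimizer: about it, the divergence of a
product measure is an entropy plus a quadratic form in the displacement of the means, which the
transport-entropy inequality makes smaller than the entropy (`meanField_isMinimizer`). For part (b),
changing `θ` tilts the prior by a function of size `O(‖θ - θ₀‖)`. The solution moves by `O(√p ‖θ -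
θ₀‖)` in `ℓ²`, and applying `J` produces the factor `η √p`, of order `p / √n`
(`meanField_stability`). -/

/-! ### Bounded supports, product measures and exponential tilts -/

theorem integrable_of_ae_mem_compact {α : Type*} [TopologicalSpace α] [MeasurableSpace α]
    [OpensMeasurableSpace α] {μ : Measure α} [IsFiniteMeasure μ] {K : Set α} (hK : IsCompact K)
    (h : ∀ᵐ x ∂μ, x ∈ K) {f : α → ℝ} (hf : Continuous f) : Integrable f μ := by
  obtain ⟨C, hC⟩ := hK.exists_bound_of_continuousOn hf.continuousOn
  exact Integrable.of_bound hf.measurable.aestronglyMeasurable C (h.mono fun x hx => hC x hx)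

theorem integrable_of_ae_box {ι : Type*} [Fintype ι] {P : Measure (ι → ℝ)} [IsFiniteMeasure P]
    {M : ℝ} (h : ∀ᵐ β ∂P, ∀ i, |β i| ≤ M) {f : (ι → ℝ) → ℝ} (hf : Continuous f) :
    Integrable f P := by
  refine integrable_of_ae_mem_compact (isCompact_Icc (a := fun _ => -M) (b := fun _ => M)) ?_ hf
  filter_upwards [h] with β hβ
  exact ⟨fun i => (abs_le.1 (hβ i)).1, fun i => (abs_le.1 (hβ i)).2⟩

theorem integrable_of_ae_interval {μ : Measure ℝ} [IsFiniteMeasure μ]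
    {M : ℝ} (h : ∀ᵐ b ∂μ, |b| ≤ M) {f : ℝ → ℝ} (hf : Continuous f) :
    Integrable f μ := by
  refine integrable_of_ae_mem_compact (isCompact_Icc (a := -M) (b := M)) ?_ hf
  filter_upwards [h] with β hβ
  exact ⟨(abs_le.1 hβ).1, (abs_le.1 hβ).2⟩

theorem ae_pi_box {ι : Type*} [Fintype ι] {μ : ι → Measure ℝ} [∀ i, IsProbabilityMeasure (μ i)]
    {M : ℝ} (h : ∀ i, ∀ᵐ b ∂μ i, |b| ≤ M) : ∀ᵐ β ∂Measure.pi μ, ∀ i, |β i| ≤ M := by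
  rw [ae_all_iff]
  intro i
  exact (measurePreserving_eval μ i).quasiMeasurePreserving.ae (h i)

theorem pi_tilted {ι : Type*} [Fintype ι] (μ : ι → Measure ℝ) [∀ i, IsProbabilityMeasure (μ i)]
    (g : ι → ℝ → ℝ) (hg : ∀ i, Integrable (fun b => Real.exp (g i b)) (μ i)) :
    Measure.pi (fun i => (μ i).tilted (g i)) =
      (Measure.pi μ).tilted fun β => ∑ i, g i (β i) := by
  have hpr : ∀ i, IsProbabilityMeasure ((μ i).tilted (g i)) := fun i =>
    isProbabilityMeasure_tilted (hg i)
  have hpos : ∀ i, 0 < ∫ x, Real.exp (g i x) ∂μ i := fun i => integral_exp_pos (hg i)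
  refine Measure.pi_eq fun s hs => ?_
  rw [tilted_apply_eq_ofReal_integral' _ (MeasurableSet.univ_pi hs), Measure.restrict_pi_pi]
  simp_rw [tilted_apply_eq_ofReal_integral' _ (hs _)]
  rw [← ENNReal.ofReal_prod_of_nonneg]
  · congr 1
    simp_rw [integral_div, Real.exp_sum]
    rw [integral_fintype_prod_eq_prod (f := fun i x => Real.exp (g i x)),
      integral_fintype_prod_eq_prod (f := fun i x => Real.exp (g i x)), Finset.prod_div_distrib]
  · intro i _
    exact integral_nonneg fun x => by have := (hpos i).le; positivity

theorem ae_tilted {α : Type*} [MeasurableSpace α] {μ : Measure α} {f : α → ℝ} {p : α → Prop}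
    (h : ∀ᵐ x ∂μ, p x) : ∀ᵐ x ∂μ.tilted f, p x :=
  (tilted_absolutelyContinuous μ f).ae_le h

theorem tilted_add_const {α : Type*} [MeasurableSpace α] (μ : Measure α) [IsProbabilityMeasure μ]
    (f : α → ℝ) (hf : Integrable (fun x => Real.exp (f x)) μ) (c : ℝ) :
    μ.tilted (fun x => f x + c) = μ.tilted f := by
  have := isProbabilityMeasure_tilted hf
  have h := tilted_tilted hf (fun _ => c)
  rw [tilted_const] at h
  exact h.symm

/-! ### One-dimensional Brunn–Minkowski and Prékopa–Leindler inequalities -/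

/-- One-dimensional Brunn–Minkowski inequality, in midpoint form. -/
theorem volume_add_volume_le_of_midpoint {A B W : Set ℝ} (hA : IsCompact A) (hB : IsCompact B)
    (hA0 : A.Nonempty) (hB0 : B.Nonempty)
    (h : ∀ a ∈ A, ∀ b ∈ B, (a + b) / 2 ∈ W) : volume A + volume B ≤ 2 * volume W := by
  obtain ⟨a, ha, ha'⟩ := hA.exists_isGreatest hA0
  obtain ⟨b, hb, hb'⟩ := hB.exists_isLeast hB0
  -- With `a` the maximum of `A` and `b` the minimum of `B`, the half-scale copies `(A + b) / 2` and
  -- `(a + B) / 2` lie in `W` on opposite sides of `w`, sharing at most the point `w`.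
  set w := (a + b) / 2 with hw
  have key : ∀ (c : ℝ) (s : Set ℝ), volume ((fun x => (x + c) / 2) ⁻¹' s) = 2 * volume s := by
    intro c s
    have : (fun x => (x + c) / 2) ⁻¹' s = (fun x => x + c) ⁻¹' ((fun x => (1 / 2 : ℝ) * x) ⁻¹' s) := by
      ext x; simp only [Set.mem_preimage]; rw [div_eq_inv_mul]; norm_num
    rw [this, measure_preimage_add_right, Real.volume_preimage_mul_left (by norm_num)]
    norm_num
  have h1 : volume A ≤ 2 * volume (W ∩ Set.Iic w) := by
    rw [← key b]
    refine measure_mono fun x hx => ⟨h x hx b hb, ?_⟩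
    have := ha' hx
    simp only [Set.mem_Iic, hw]; linarith
  have h2 : volume B ≤ 2 * volume (W \ Set.Iic w) := by
    rw [← key a, ← measure_sdiff_null (measure_singleton b)]
    refine measure_mono fun x hx => ⟨by simpa [add_comm] using h a ha x hx.1, ?_⟩
    have h3 := hb' hx.1
    have h4 : b < x := lt_of_le_of_ne h3 fun e => hx.2 e.symm
    simp only [Set.mem_Iic, hw, not_le]; linarith
  calc _ ≤ 2 * volume (W ∩ Set.Iic w) + 2 * volume (W \ Set.Iic w) := add_le_add h1 h2
    _ = 2 * volume W := by rw [← mul_add, measure_inter_add_sdiff _ measurableSet_Iic]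

theorem isCompact_superlevel {f : ℝ → ℝ} (hf : Continuous f) (hlim : Tendsto f (cocompact ℝ) (𝓝 0))
    {t : ℝ} (ht : 0 < t) : IsCompact {x | t ≤ f x} := by
  have h := hlim.eventually (gt_mem_nhds ht)
  obtain ⟨K, hK, hKs⟩ := mem_cocompact.1 h
  refine hK.of_isClosed_subset (isClosed_le continuous_const hf) fun x hx => ?_
  by_contra hxK
  exact absurd (show f x < t from hKs hxK) (not_lt.2 hx)

/-- Layer-cake: midpoints of `{t ≤ f}` and `{t ≤ g}` lie in `{t ≤ H}`, so Brunn–Minkowski applies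
level by level. Since both maxima equal one, the two superlevel sets are nonempty for exactly the
same levels `t ≤ 1`. -/
theorem integral_add_le_of_midpoint {f g H : ℝ → ℝ} (hf : Continuous f) (hg : Continuous g)
    (hH : Continuous H) (f0 : ∀ x, 0 ≤ f x) (g0 : ∀ x, 0 ≤ g x) (H0 : ∀ x, 0 ≤ H x)
    (hfl : Tendsto f (cocompact ℝ) (𝓝 0)) (hgl : Tendsto g (cocompact ℝ) (𝓝 0))
    (hfi : Integrable f) (hgi : Integrable g) (hHi : Integrable H)
    (hf1 : ∃ x, f x = 1) (hg1 : ∃ x, g x = 1) (hfle : ∀ x, f x ≤ 1) (hgle : ∀ x, g x ≤ 1)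
    (h : ∀ x y, f x * g y ≤ H ((x + y) / 2) ^ 2) :
    (∫ x, f x) + ∫ x, g x ≤ 2 * ∫ x, H x := by
  have key : (∫⁻ x, ENNReal.ofReal (f x)) + ∫⁻ x, ENNReal.ofReal (g x) ≤
      2 * ∫⁻ x, ENNReal.ofReal (H x) := by
    rw [lintegral_eq_lintegral_meas_le _ (ae_of_all _ f0) hf.aemeasurable,
      lintegral_eq_lintegral_meas_le _ (ae_of_all _ g0) hg.aemeasurable,
      lintegral_eq_lintegral_meas_le _ (ae_of_all _ H0) hH.aemeasurable]
    have anti : ∀ k : ℝ → ℝ, Measurable fun t => volume {x | t ≤ k x} := fun k =>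
      Antitone.measurable fun s t hst => measure_mono fun x hx => le_trans hst hx
    rw [← lintegral_add_left (anti f), ← lintegral_const_mul _ (anti H)]
    refine setLIntegral_mono' measurableSet_Ioi fun t ht => ?_
    rcases le_or_gt t 1 with h1 | h1
    · refine volume_add_volume_le_of_midpoint (isCompact_superlevel hf hfl ht)
        (isCompact_superlevel hg hgl ht) ?_ ?_ ?_
      · obtain ⟨x, hx⟩ := hf1; exact ⟨x, by simpa [hx] using h1⟩
      · obtain ⟨x, hx⟩ := hg1; exact ⟨x, by simpa [hx] using h1⟩
      · intro a ha b hb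
        simp only [Set.mem_ofPred_eq, Set.mem_Ioi] at *
        have := h a b
        nlinarith [mul_le_mul ha hb ht.le (f0 a), H0 ((a + b) / 2)]
    · have e1 : {x | t ≤ f x} = ∅ := by
        ext x; simp only [Set.mem_ofPred_eq, Set.mem_empty_iff_false, iff_false, not_le]
        exact (hfle x).trans_lt h1
      have e2 : {x | t ≤ g x} = ∅ := by
        ext x; simp only [Set.mem_ofPred_eq, Set.mem_empty_iff_false, iff_false, not_le]
        exact (hgle x).trans_lt h1
      simp [e1, e2]
  rw [← ofReal_integral_eq_lintegral_ofReal hfi (ae_of_all _ f0),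
    ← ofReal_integral_eq_lintegral_ofReal hgi (ae_of_all _ g0),
    ← ofReal_integral_eq_lintegral_ofReal hHi (ae_of_all _ H0),
    ← ENNReal.ofReal_add (integral_nonneg f0) (integral_nonneg g0)] at key
  rw [← ENNReal.ofReal_le_ofReal_iff (mul_nonneg (by norm_num) (integral_nonneg fun x => H0 x)),
    ENNReal.ofReal_mul (by norm_num)]
  simpa using key

/-- One-dimensional Prékopa–Leindler inequality, for midpoints. -/
theorem integral_mul_integral_le_sq_of_midpoint {f g H : ℝ → ℝ} (hf : Continuous f)
    (hg : Continuous g) (hH : Continuous H) (f0 : ∀ x, 0 < f x) (g0 : ∀ x, 0 < g x)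
    (H0 : ∀ x, 0 ≤ H x)
    (hfl : Tendsto f (cocompact ℝ) (𝓝 0)) (hgl : Tendsto g (cocompact ℝ) (𝓝 0))
    (hfi : Integrable f) (hgi : Integrable g) (hHi : Integrable H)
    (h : ∀ x y, f x * g y ≤ H ((x + y) / 2) ^ 2) :
    (∫ x, f x) * ∫ x, g x ≤ (∫ x, H x) ^ 2 := by
  obtain ⟨a, ha⟩ := hf.exists_forall_ge' 0
    ((hfl.eventually (gt_mem_nhds (f0 0))).mono fun x hx => le_of_lt hx)
  obtain ⟨b, hb⟩ := hg.exists_forall_ge' 0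
    ((hgl.eventually (gt_mem_nhds (g0 0))).mono fun x hx => le_of_lt hx)
  have hs : 0 < Real.sqrt (f a * g b) := Real.sqrt_pos.2 (mul_pos (f0 a) (g0 b))
  have hss : Real.sqrt (f a * g b) ^ 2 = f a * g b := Real.sq_sqrt (mul_pos (f0 a) (g0 b)).le
  have fa := f0 a
  have gb := g0 b
  -- Dividing by the maxima makes the additive inequality applicable; the arithmetic-geometric mean
  -- inequality then gives the product form.
  have key := integral_add_le_of_midpoint (f := fun x => f x / f a) (g := fun x => g x / g b)
    (H := fun x => H x / Real.sqrt (f a * g b)) (hf.div_const _) (hg.div_const _) (hH.div_const _)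
    (fun x => by have := f0 x; positivity) (fun x => by have := g0 x; positivity)
    (fun x => by have := H0 x; positivity)
    (by simpa using hfl.div_const (f a)) (by simpa using hgl.div_const (g b))
    (hfi.div_const _) (hgi.div_const _) (hHi.div_const _)
    ⟨a, div_self fa.ne'⟩ ⟨b, div_self gb.ne'⟩ (fun x => (div_le_one fa).2 (ha x))
    (fun x => (div_le_one gb).2 (hb x)) (fun x y => by
      rw [div_pow, hss, div_mul_div_comm]
      gcongr
      exact h x y)
  rw [integral_div, integral_div, integral_div] at key
  set I := ∫ x, f x
  set J := ∫ x, g x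
  set S := ∫ x, H x
  have hI : 0 ≤ I / f a := div_nonneg (integral_nonneg fun x => (f0 x).le) fa.le
  have hJ : 0 ≤ J / g b := div_nonneg (integral_nonneg fun x => (g0 x).le) gb.le
  have h4 : 4 * ((I / f a) * (J / g b)) ≤ (2 * (S / Real.sqrt (f a * g b))) ^ 2 := by
    nlinarith [sq_nonneg (I / f a - J / g b)]
  rw [mul_pow, div_pow, hss, div_mul_div_comm] at h4
  have h5 : I * J / (f a * g b) ≤ S ^ 2 / (f a * g b) := by linarith
  exact (div_le_div_iff_of_pos_right (mul_pos fa gb)).1 h5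

/-! ### Laplace transforms of bounded variables -/

/-- Hoeffding's lemma on a symmetric interval. -/
theorem integral_exp_mul_sub_mean_le {μ : Measure ℝ} [IsProbabilityMeasure μ] {M : ℝ} (hM : 0 ≤ M)
    (h : ∀ᵐ b ∂μ, |b| ≤ M) (s : ℝ) :
    ∫ b, Real.exp (s * (b - ∫ x, x ∂μ)) ∂μ ≤ Real.exp (M ^ 2 * s ^ 2 / 2) := by
  have h1 := hasSubgaussianMGF_of_mem_Icc (X := fun b : ℝ => b) (μ := μ) (a := -M) (b := M)
    aemeasurable_id (h.mono fun b hb => ⟨(abs_le.1 hb).1, (abs_le.1 hb).2⟩)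
  have h2 := h1.mgf_le s
  simp only [mgf] at h2
  refine h2.trans (le_of_eq ?_)
  congr 1
  have : (((‖M - -M‖₊ / 2) ^ 2 : ℝ≥0) : ℝ) = M ^ 2 := by
    push_cast
    rw [Real.norm_eq_abs, sub_neg_eq_add, abs_of_nonneg (by linarith)]
    ring
  rw [this]

/-- After tilting by `x * b`, both factors become Laplace transforms of one law at `s` and `-s`. The
contributions of its mean cancel in the product, and Hoeffding's lemma bounds each centred factor.
-/
theorem laplace_mul_le {μ : Measure ℝ} [IsProbabilityMeasure μ] {M : ℝ} (hM : 0 ≤ M)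
    (h : ∀ᵐ b ∂μ, |b| ≤ M) (x s : ℝ) :
    (∫ b, Real.exp ((x + s) * b) ∂μ) * ∫ b, Real.exp ((x - s) * b) ∂μ ≤
      (∫ b, Real.exp (x * b) ∂μ) ^ 2 * Real.exp (M ^ 2 * s ^ 2) := by
  have hi : Integrable (fun b => Real.exp (x * b)) μ :=
    integrable_of_ae_interval h (by fun_prop)
  have hpos := integral_exp_pos hi
  have hpr := isProbabilityMeasure_tilted hi
  set τ := μ.tilted fun b => x * b with hτ
  have hb : ∀ᵐ b ∂τ, |b| ≤ M := ae_tilted h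
  set c := ∫ b, b ∂τ
  have key : ∀ u : ℝ, ∫ b, Real.exp ((x + u) * b) ∂μ =
      (∫ b, Real.exp (x * b) ∂μ) * (Real.exp (u * c) * ∫ b, Real.exp (u * (b - c)) ∂τ) := by
    intro u
    rw [← integral_const_mul]
    have : ∀ b : ℝ, Real.exp (u * c) * Real.exp (u * (b - c)) = Real.exp (u * b) := fun b => by
      rw [← Real.exp_add]; ring_nf
    simp_rw [this]
    rw [hτ, integral_exp_tilted, mul_div_cancel₀ _ hpos.ne']
    simp only [Pi.add_apply, add_mul]
  have e2 := key (-s)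
  rw [← sub_eq_add_neg] at e2
  rw [key s, e2]
  have b1 := integral_exp_mul_sub_mean_le hM hb s
  have b2 := integral_exp_mul_sub_mean_le hM hb (-s)
  have n1 : 0 ≤ ∫ b, Real.exp (s * (b - c)) ∂τ := integral_nonneg fun b => (Real.exp_pos _).le
  have n2 : 0 ≤ ∫ b, Real.exp (-s * (b - c)) ∂τ := integral_nonneg fun b => (Real.exp_pos _).le
  have e3 : Real.exp (s * c) * Real.exp (-s * c) = 1 := by
    rw [← Real.exp_add]; simp
  have e4 : Real.exp (M ^ 2 * s ^ 2) =
      Real.exp (M ^ 2 * s ^ 2 / 2) * Real.exp (M ^ 2 * (-s) ^ 2 / 2) := by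
    rw [← Real.exp_add]; ring_nf
  rw [e4]
  set Z := ∫ b, Real.exp (x * b) ∂μ
  calc _ = Z ^ 2 * ((Real.exp (s * c) * Real.exp (-s * c)) *
        ((∫ b, Real.exp (s * (b - c)) ∂τ) * ∫ b, Real.exp (-s * (b - c)) ∂τ)) := by ring
    _ ≤ _ := by
      rw [e3, one_mul]
      gcongr

/-! ### Partition functions and Gaussian linearization -/

theorem integral_exp_gaussian_linear (x : ℝ) :
    ∫ z : ℝ, Real.exp (-z ^ 2 / 2 + z * x) = Real.sqrt (2 * Real.pi) * Real.exp (x ^ 2 / 2) := by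
  have h1 : ∀ z : ℝ, Real.exp (-z ^ 2 / 2 + z * x) =
      Real.exp (-(1 / 2) * (z - x) ^ 2) * Real.exp (x ^ 2 / 2) := fun z => by
    rw [← Real.exp_add]; ring_nf
  simp_rw [h1]
  rw [integral_mul_const, integral_sub_right_eq_self (fun z : ℝ => Real.exp (-(1 / 2) * z ^ 2)) x,
    integral_gaussian]
  congr 2
  ring

theorem exp_gaussian_linear_le (z C : ℝ) :
    Real.exp (-z ^ 2 / 2 + C * |z|) ≤ Real.exp (C ^ 2) * Real.exp (-(1 / 4) * z ^ 2) := by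
  rw [← Real.exp_add]
  apply Real.exp_le_exp.2
  nlinarith [sq_nonneg (|z| / 2 - C), sq_abs z]

theorem tendsto_exp_neg_sq_cocompact :
    Tendsto (fun z : ℝ => Real.exp (-(1 / 4) * z ^ 2)) (cocompact ℝ) (𝓝 0) := by
  have := tendsto_rpow_abs_mul_exp_neg_mul_sq_cocompact (a := 1 / 4) (by norm_num) 0
  simpa using this

section Partition

variable {ι κ : Type*} [Fintype ι]

/-- The partition function with external field `h` and ferromagnetic rank-one interactions
`(c l ⬝ᵥ β) ^ 2 / 2`. -/
noncomputable def partition (π : Measure (ι → ℝ)) (c : κ → ι → ℝ) (s : Finset κ) (h : ι → ℝ) : ℝ :=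
  ∫ β, Real.exp (h ⬝ᵥ β + (∑ l ∈ s, (c l ⬝ᵥ β) ^ 2) / 2) ∂π

variable {π : Measure (ι → ℝ)} {M : ℝ}

theorem partition_pos [IsProbabilityMeasure π] (hπ : ∀ᵐ β ∂π, ∀ i, |β i| ≤ M)
    (c : κ → ι → ℝ) (s : Finset κ) (h : ι → ℝ) : 0 < partition π c s h :=
  integral_exp_pos (integrable_of_ae_box hπ (by fun_prop))

theorem continuous_partition_line [IsProbabilityMeasure π] (hπ : ∀ᵐ β ∂π, ∀ i, |β i| ≤ M)
    (c : κ → ι → ℝ) (s : Finset κ) (h a : ι → ℝ) :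
    Continuous fun z : ℝ => partition π c s (h + z • a) := by
  have hK : IsCompact (Set.Icc (fun _ : ι => -M) (fun _ : ι => M)) := isCompact_Icc
  have hr : π.restrict (Set.Icc (fun _ : ι => -M) (fun _ : ι => M)) = π := by
    rw [Measure.restrict_eq_self_of_ae_mem]
    filter_upwards [hπ] with β hβ
    exact ⟨fun i => (abs_le.1 (hβ i)).1, fun i => (abs_le.1 (hβ i)).2⟩
  have := continuous_parametric_integral_of_continuous (μ := π)
    (f := fun (z : ℝ) (β : ι → ℝ) =>
      Real.exp ((h + z • a) ⬝ᵥ β + (∑ l ∈ s, (c l ⬝ᵥ β) ^ 2) / 2)) (by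
        simp only [Function.uncurry_def, add_dotProduct, smul_dotProduct]
        fun_prop) hK
  rw [hr] at this
  exact this

theorem exists_exponent_bound (hπ : ∀ᵐ β ∂π, ∀ i, |β i| ≤ M)
    (c : κ → ι → ℝ) (s : Finset κ) (h a : ι → ℝ) : ∃ C₁ C₂ : ℝ, ∀ᵐ β ∂π, ∀ z : ℝ,
    (h + z • a) ⬝ᵥ β + (∑ l ∈ s, (c l ⬝ᵥ β) ^ 2) / 2 ≤ C₁ + C₂ * |z| := by
  have hK : IsCompact (Set.Icc (fun _ : ι => -M) (fun _ : ι => M)) := isCompact_Icc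
  obtain ⟨C₁, h₁⟩ := hK.exists_bound_of_continuousOn
    (f := fun β : ι → ℝ => h ⬝ᵥ β + (∑ l ∈ s, (c l ⬝ᵥ β) ^ 2) / 2) (by fun_prop)
  obtain ⟨C₂, h₂⟩ := hK.exists_bound_of_continuousOn
    (f := fun β : ι → ℝ => a ⬝ᵥ β) (by fun_prop)
  refine ⟨C₁, C₂, ?_⟩
  filter_upwards [hπ] with β hβ z
  have hm : β ∈ Set.Icc (fun _ : ι => -M) (fun _ : ι => M) :=
    ⟨fun i => (abs_le.1 (hβ i)).1, fun i => (abs_le.1 (hβ i)).2⟩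
  have e1 := (le_abs_self _).trans (h₁ β hm)
  have e2 : |a ⬝ᵥ β| ≤ C₂ := h₂ β hm
  rw [add_dotProduct, smul_dotProduct, smul_eq_mul]
  have e3 : z * (a ⬝ᵥ β) ≤ C₂ * |z| := by
    calc _ ≤ |z * (a ⬝ᵥ β)| := le_abs_self _
      _ = |z| * |a ⬝ᵥ β| := abs_mul _ _
      _ ≤ |z| * C₂ := by gcongr
      _ = _ := mul_comm _ _
  linarith

/-- With bounded coordinates `partition` grows at most exponentially along a line, so the Gaussian
weight dominates. This yields the integrability and the decay at infinity required by
Prékopa–Leindler. -/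
theorem exists_partition_gaussian_bound [IsProbabilityMeasure π] (hπ : ∀ᵐ β ∂π, ∀ i, |β i| ≤ M)
    (c : κ → ι → ℝ) (s : Finset κ) (h a : ι → ℝ) : ∃ C : ℝ, ∀ z : ℝ,
    Real.exp (-z ^ 2 / 2) * partition π c s (h + z • a) ≤ C * Real.exp (-(1 / 4) * z ^ 2) := by
  obtain ⟨C₁, C₂, hC⟩ := exists_exponent_bound hπ c s h a
  refine ⟨Real.exp C₁ * Real.exp (C₂ ^ 2), fun z => ?_⟩
  have h1 : partition π c s (h + z • a) ≤ Real.exp (C₁ + C₂ * |z|) := by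
    have : partition π c s (h + z • a) ≤ ∫ _, Real.exp (C₁ + C₂ * |z|) ∂π := by
      refine integral_mono_ae (integrable_of_ae_box hπ (by fun_prop)) (integrable_const _) ?_
      filter_upwards [hC] with β hβ
      exact Real.exp_le_exp.2 (hβ z)
    simpa using this
  calc _ ≤ Real.exp (-z ^ 2 / 2) * Real.exp (C₁ + C₂ * |z|) := by gcongr
    _ = Real.exp C₁ * Real.exp (-z ^ 2 / 2 + C₂ * |z|) := by
      rw [← Real.exp_add, ← Real.exp_add]; ring_nf
    _ ≤ Real.exp C₁ * (Real.exp (C₂ ^ 2) * Real.exp (-(1 / 4) * z ^ 2)) := by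
      gcongr; exact exp_gaussian_linear_le z C₂
    _ = _ := by ring

theorem integrable_partition_gaussian [IsProbabilityMeasure π] (hπ : ∀ᵐ β ∂π, ∀ i, |β i| ≤ M)
    (c : κ → ι → ℝ) (s : Finset κ) (h a : ι → ℝ) :
    Integrable fun z : ℝ => Real.exp (-z ^ 2 / 2) * partition π c s (h + z • a) := by
  obtain ⟨C, hC⟩ := exists_partition_gaussian_bound hπ c s h a
  refine Integrable.mono' ((integrable_exp_neg_mul_sq (b := 1 / 4) (by norm_num)).const_mul C)
    ?_ (ae_of_all _ fun z => ?_)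
  · have := continuous_partition_line hπ c s h a
    exact (Continuous.mul (by fun_prop) this).aestronglyMeasurable
  · have := partition_pos hπ c s (h + z • a)
    rw [Real.norm_eq_abs, abs_of_pos (by positivity)]
    exact hC z

theorem tendsto_partition_gaussian [IsProbabilityMeasure π] (hπ : ∀ᵐ β ∂π, ∀ i, |β i| ≤ M)
    (c : κ → ι → ℝ) (s : Finset κ) (h a : ι → ℝ) :
    Tendsto (fun z : ℝ => Real.exp (-z ^ 2 / 2) * partition π c s (h + z • a))
      (cocompact ℝ) (𝓝 0) := by
  obtain ⟨C, hC⟩ := exists_partition_gaussian_bound hπ c s h a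
  refine squeeze_zero (fun z => ?_) hC (by simpa using tendsto_exp_neg_sq_cocompact.const_mul C)
  have := partition_pos hπ c s (h + z • a)
  positivity

/-- Hubbard–Stratonovich linearization of one rank-one interaction. -/
theorem integral_partition_gaussian [IsProbabilityMeasure π] (hπ : ∀ᵐ β ∂π, ∀ i, |β i| ≤ M)
    (c : κ → ι → ℝ) (s : Finset κ) [DecidableEq κ] {a : κ} (ha : a ∉ s) (h : ι → ℝ) :
    ∫ z : ℝ, Real.exp (-z ^ 2 / 2) * partition π c s (h + z • c a) =
      Real.sqrt (2 * Real.pi) * partition π c (insert a s) h := by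
  unfold partition
  simp_rw [← integral_const_mul, ← Real.exp_add]
  rw [integral_integral_swap]
  · refine integral_congr_ae (ae_of_all _ fun β => ?_)
    have h1 : ∀ z : ℝ, Real.exp (-z ^ 2 / 2 +
        ((h + z • c a) ⬝ᵥ β + (∑ l ∈ s, (c l ⬝ᵥ β) ^ 2) / 2)) =
        Real.exp (-z ^ 2 / 2 + z * (c a ⬝ᵥ β)) *
          Real.exp (h ⬝ᵥ β + (∑ l ∈ s, (c l ⬝ᵥ β) ^ 2) / 2) := fun z => by
      rw [← Real.exp_add, add_dotProduct, smul_dotProduct, smul_eq_mul]; ring_nf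
    simp only [h1]
    rw [integral_mul_const, integral_exp_gaussian_linear, Finset.sum_insert ha, mul_assoc,
      ← Real.exp_add]
    ring_nf
  · obtain ⟨C₁, C₂, hC⟩ := exists_exponent_bound hπ c s h (c a)
    have hint : Integrable (fun w : ℝ × (ι → ℝ) =>
        (Real.exp C₁ * Real.exp (C₂ ^ 2) * Real.exp (-(1 / 4) * w.1 ^ 2)) * 1)
        (volume.prod π) :=
      Integrable.mul_prod
        ((integrable_exp_neg_mul_sq (b := 1 / 4) (by norm_num)).const_mul _) (integrable_const _)
    refine hint.mono' ?_ ?_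
    · have : Continuous (Function.uncurry fun (z : ℝ) (β : ι → ℝ) => Real.exp (-z ^ 2 / 2 +
        ((h + z • c a) ⬝ᵥ β + (∑ l ∈ s, (c l ⬝ᵥ β) ^ 2) / 2))) := by
        simp only [Function.uncurry_def, add_dotProduct, smul_dotProduct]
        fun_prop
      exact this.aestronglyMeasurable
    · have := (Measure.quasiMeasurePreserving_snd (μ := (volume : Measure ℝ)) (ν := π)).ae hC
      filter_upwards [this] with w hw
      rw [Function.uncurry_def, Real.norm_eq_abs, abs_of_pos (Real.exp_pos _), mul_one, mul_assoc]
      calc _ ≤ Real.exp (-w.1 ^ 2 / 2 + (C₁ + C₂ * |w.1|)) := by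
            exact Real.exp_le_exp.2 (add_le_add_right (hw w.1) _)
        _ = Real.exp C₁ * Real.exp (-w.1 ^ 2 / 2 + C₂ * |w.1|) := by
          rw [← Real.exp_add]; ring_nf
        _ ≤ _ := by
          gcongr; exact exp_gaussian_linear_le _ _

end Partition

/-! ### Second differences of the log-partition function -/

theorem partition_empty_mul_le {ι κ : Type*} [Fintype ι] {μ : ι → Measure ℝ}
    [∀ i, IsProbabilityMeasure (μ i)] {M : ℝ} (hM : 0 ≤ M) (hμ : ∀ i, ∀ᵐ b ∂μ i, |b| ≤ M)
    (c : κ → ι → ℝ) (h v : ι → ℝ) :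
    partition (Measure.pi μ) c ∅ (h + v) * partition (Measure.pi μ) c ∅ (h - v) ≤
      partition (Measure.pi μ) c ∅ h ^ 2 * Real.exp (M ^ 2 * (v ⬝ᵥ v)) := by
  have key : ∀ u : ι → ℝ, partition (Measure.pi μ) c ∅ u =
      ∏ i, ∫ b, Real.exp (u i * b) ∂μ i := by
    intro u
    rw [partition, ← integral_fintype_prod_eq_prod (f := fun i b => Real.exp (u i * b))]
    simp [dotProduct, Real.exp_sum]
  simp_rw [key]
  rw [← Finset.prod_mul_distrib, ← Finset.prod_pow, dotProduct, Finset.mul_sum, Real.exp_sum,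
    ← Finset.prod_mul_distrib]
  refine Finset.prod_le_prod (fun i _ => mul_nonneg ?_ ?_) fun i _ => ?_
  · exact integral_nonneg fun b => (Real.exp_pos _).le
  · exact integral_nonneg fun b => (Real.exp_pos _).le
  · have := laplace_mul_le hM (hμ i) (h i) (v i)
    simpa [sq] using this

/-- Induction on the number of rank-one interactions. Each new square is linearized by a Gaussian
variable `z`, and Prékopa–Leindler in `z` transfers the bound to the integral. The condition on `R`
is a supremum over `t` because half-differences of the auxiliary variables shift `v` along the `c
l`, at Gaussian cost `t l ^ 2`. -/
theorem partition_mul_le {ι κ : Type*} [Fintype ι] [DecidableEq κ] {μ : ι → Measure ℝ}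
    [∀ i, IsProbabilityMeasure (μ i)] {M : ℝ} (hM : 0 ≤ M) (hμ : ∀ i, ∀ᵐ b ∂μ i, |b| ≤ M)
    (c : κ → ι → ℝ) (s : Finset κ) : ∀ (h v : ι → ℝ) (R : ℝ),
    (∀ t : κ → ℝ, M ^ 2 * ((v + ∑ l ∈ s, t l • c l) ⬝ᵥ (v + ∑ l ∈ s, t l • c l)) -
      ∑ l ∈ s, t l ^ 2 ≤ R) →
    partition (Measure.pi μ) c s (h + v) * partition (Measure.pi μ) c s (h - v) ≤
      partition (Measure.pi μ) c s h ^ 2 * Real.exp R := by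
  have hπ := ae_pi_box hμ
  induction s using Finset.induction_on with
  | empty =>
    intro h v R hR
    refine (partition_empty_mul_le hM hμ c h v).trans ?_
    gcongr
    simpa using hR 0
  | insert a s ha ih =>
    intro h v R hR
    have hps : 0 < Real.sqrt (2 * Real.pi) := Real.sqrt_pos.2 (by positivity)
    have PL := integral_mul_integral_le_sq_of_midpoint
      (f := fun z : ℝ => Real.exp (-z ^ 2 / 2) * partition (Measure.pi μ) c s ((h + v) + z • c a))
      (g := fun z : ℝ => Real.exp (-z ^ 2 / 2) * partition (Measure.pi μ) c s ((h - v) + z • c a))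
      (H := fun z : ℝ => (Real.exp (-z ^ 2 / 2) * partition (Measure.pi μ) c s (h + z • c a)) *
        Real.exp (R / 2))
      (Continuous.mul (by fun_prop) (continuous_partition_line hπ c s _ _))
      (Continuous.mul (by fun_prop) (continuous_partition_line hπ c s _ _))
      ((Continuous.mul (by fun_prop) (continuous_partition_line hπ c s _ _)).mul continuous_const)
      (fun z => mul_pos (Real.exp_pos _) (partition_pos hπ c s _))
      (fun z => mul_pos (Real.exp_pos _) (partition_pos hπ c s _))
      (fun z => (mul_pos (mul_pos (Real.exp_pos _) (partition_pos hπ c s _)) (Real.exp_pos _)).le)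
      (tendsto_partition_gaussian hπ c s _ _) (tendsto_partition_gaussian hπ c s _ _)
      (integrable_partition_gaussian hπ c s _ _) (integrable_partition_gaussian hπ c s _ _)
      ((integrable_partition_gaussian hπ c s _ _).mul_const _) (fun x y => by
        -- The fields `h + v + x • c a` and `h - v + y • c a` have midpoint shifted by `(x + y) / 2`
        -- and half-difference shifted by `(x - y) / 2`. The extra `((x - y) / 2) ^ 2` is exactly
        -- the loss in `x²/2 + y²/2 = ((x + y)/2)² + ((x - y)/2)²`.
        have h1 := ih (h + ((x + y) / 2) • c a) (v + ((x - y) / 2) • c a) (R + ((x - y) / 2) ^ 2)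
          (fun t => by
            have h2 := hR (Function.update t a ((x - y) / 2))
            have h3 : ∑ l ∈ s, Function.update t a ((x - y) / 2) l • c l = ∑ l ∈ s, t l • c l :=
              Finset.sum_congr rfl fun l hl => by
                rw [Function.update_of_ne (ne_of_mem_of_not_mem hl ha)]
            have h4 : ∑ l ∈ s, Function.update t a ((x - y) / 2) l ^ 2 = ∑ l ∈ s, t l ^ 2 :=
              Finset.sum_congr rfl fun l hl => by
                rw [Function.update_of_ne (ne_of_mem_of_not_mem hl ha)]
            rw [Finset.sum_insert ha, Finset.sum_insert ha, h3, h4, Function.update_self,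
              ← add_assoc] at h2
            linarith)
        have e1 : (h + ((x + y) / 2) • c a) + (v + ((x - y) / 2) • c a) = (h + v) + x • c a := by
          ext i; simp only [Pi.add_apply, Pi.smul_apply, smul_eq_mul]; ring
        have e2 : (h + ((x + y) / 2) • c a) - (v + ((x - y) / 2) • c a) = (h - v) + y • c a := by
          ext i; simp only [Pi.add_apply, Pi.sub_apply, Pi.smul_apply, smul_eq_mul]; ring
        rw [e1, e2] at h1
        have e3 : Real.exp (-x ^ 2 / 2) * Real.exp (-y ^ 2 / 2) * Real.exp (R + ((x - y) / 2) ^ 2) =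
            Real.exp (-((x + y) / 2) ^ 2 / 2) ^ 2 * Real.exp (R / 2) ^ 2 := by
          simp only [sq (Real.exp _), ← Real.exp_add]; ring_nf
        have e4 : 0 ≤ Real.exp (-x ^ 2 / 2) * Real.exp (-y ^ 2 / 2) := by positivity
        have := mul_le_mul_of_nonneg_left h1 e4
        calc _ = _ := mul_mul_mul_comm _ _ _ _
          _ ≤ _ := this
          _ = partition (Measure.pi μ) c s (h + ((x + y) / 2) • c a) ^ 2 * (Real.exp (-x ^ 2 / 2) *
              Real.exp (-y ^ 2 / 2) * Real.exp (R + ((x - y) / 2) ^ 2)) := by ring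
          _ = _ := by rw [e3]; ring)
    rw [integral_mul_const, integral_partition_gaussian hπ c s ha,
      integral_partition_gaussian hπ c s ha, integral_partition_gaussian hπ c s ha] at PL
    have e5 : Real.exp (R / 2) ^ 2 = Real.exp R := by rw [sq, ← Real.exp_add]; ring_nf
    rw [mul_pow, mul_pow, e5, mul_mul_mul_comm, ← sq, mul_assoc] at PL
    exact le_of_mul_le_mul_left PL (by positivity)

/-! ### Variance bounds for Gibbs measures -/

theorem two_add_sq_le_exp_add_exp_neg (d : ℝ) : 2 + d ^ 2 ≤ Real.exp d + Real.exp (-d) := by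
  have h1 : Real.exp d + Real.exp (-d) = 2 * Real.cosh d := by rw [Real.cosh_eq]; ring
  have h2 : Real.cosh d = 1 + 2 * Real.sinh (d / 2) ^ 2 := by
    have := Real.cosh_two_mul (d / 2)
    rw [mul_div_cancel₀ _ (two_ne_zero)] at this
    rw [this, Real.cosh_sq]; ring
  have h3 : (d / 2) ^ 2 ≤ Real.sinh (d / 2) ^ 2 := by
    rw [sq_le_sq]
    rcases le_total 0 (d / 2) with h | h
    · rw [abs_of_nonneg h, abs_of_nonneg (Real.sinh_nonneg_iff.2 h)]
      exact Real.self_le_sinh_iff.2 h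
    · rw [abs_of_nonpos h, abs_of_nonpos (Real.sinh_nonpos_iff.2 h)]
      exact neg_le_neg (Real.sinh_le_self_iff.2 h)
  rw [h1, h2]; nlinarith

theorem integrable_quadratic {α : Type*} [MeasurableSpace α] {P : Measure α}
    [IsProbabilityMeasure P] {X : α → ℝ} (h1 : Integrable X P)
    (h2 : Integrable (fun a => X a ^ 2) P) (a b c : ℝ) :
    Integrable (fun x => a + b * X x + c * X x ^ 2) P :=
  ((integrable_const a).add (h1.const_mul b)).add (h2.const_mul c)

theorem integral_quadratic {α : Type*} [MeasurableSpace α] {P : Measure α}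
    [IsProbabilityMeasure P] {X : α → ℝ} (h1 : Integrable X P)
    (h2 : Integrable (fun a => X a ^ 2) P) (a b c : ℝ) :
    ∫ x, (a + b * X x + c * X x ^ 2) ∂P = a + b * (∫ x, X x ∂P) + c * ∫ x, X x ^ 2 ∂P := by
  have e : Integrable (fun x => a + b * X x) P := (integrable_const a).add (h1.const_mul b)
  rw [integral_add e (h2.const_mul c), integral_add (integrable_const a) (h1.const_mul b),
    integral_const_mul, integral_const_mul]
  simp

/-- The variance is controlled by the symmetrized Laplace transform. -/
theorem one_add_variance_le {α : Type*} [MeasurableSpace α] {P : Measure α} [IsProbabilityMeasure P]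
    {X : α → ℝ} (h1 : Integrable X P) (h2 : Integrable (fun a => X a ^ 2) P)
    (h3 : Integrable (fun a => Real.exp (X a)) P) (h4 : Integrable (fun a => Real.exp (-X a)) P) :
    1 + ∫ a, (X a - ∫ b, X b ∂P) ^ 2 ∂P ≤
      (∫ a, Real.exp (X a) ∂P) * ∫ a, Real.exp (-X a) ∂P := by
  set m := ∫ b, X b ∂P with hm
  have e1 : ∫ a, (X a - m) ^ 2 ∂P = (∫ a, X a ^ 2 ∂P) - m ^ 2 := by
    have : ∀ a, (X a - m) ^ 2 = m ^ 2 + (-(2 * m)) * X a + 1 * X a ^ 2 := fun a => by ring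
    simp_rw [this]
    rw [integral_quadratic h1 h2, ← hm]
    ring
  set S := ∫ a, X a ^ 2 ∂P with hS
  -- Symmetrization with an independent copy: integrate `2 + d² ≤ exp d + exp (-d)` at `d = X x - X
  -- y` over both variables. The left side integrates to twice one plus the variance.
  have ex : ∀ x y, Real.exp (X x - X y) + Real.exp (-(X x - X y)) =
      Real.exp (X x) * Real.exp (-X y) + Real.exp (-X x) * Real.exp (X y) := fun x y => by
    rw [← Real.exp_add, ← Real.exp_add]; ring_nf
  have qx : ∀ x y, 2 + (X x - X y) ^ 2 = (2 + X x ^ 2) + (-(2 * X x)) * X y + 1 * X y ^ 2 :=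
    fun x y => by ring
  have hx : ∀ x, (2 + S) + (-(2 * m)) * X x + 1 * X x ^ 2 ≤
      Real.exp (X x) * (∫ a, Real.exp (-X a) ∂P) + Real.exp (-X x) * ∫ a, Real.exp (X a) ∂P := by
    intro x
    have := integral_mono (μ := P) (f := fun y => 2 + (X x - X y) ^ 2)
      (g := fun y => Real.exp (X x - X y) + Real.exp (-(X x - X y)))
      (by simp_rw [qx]; exact integrable_quadratic h1 h2 _ _ _)
      (by simp_rw [ex]; exact (h4.const_mul _).add (h3.const_mul _))
      (fun y => two_add_sq_le_exp_add_exp_neg _)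
    simp_rw [ex, qx] at this
    rw [integral_quadratic h1 h2, integral_add (h4.const_mul _) (h3.const_mul _),
      integral_const_mul, integral_const_mul, ← hS, ← hm] at this
    linarith
  have hfin := integral_mono (μ := P) (integrable_quadratic h1 h2 _ _ _)
    ((h3.mul_const _).add (h4.mul_const _)) hx
  rw [integral_quadratic h1 h2] at hfin
  simp only [Pi.add_apply] at hfin
  rw [integral_add (h3.mul_const _) (h4.mul_const _), integral_mul_const, integral_mul_const,
    ← hS, ← hm] at hfin
  rw [e1]
  nlinarith [mul_comm (∫ a, Real.exp (X a) ∂P) (∫ a, Real.exp (-X a) ∂P)]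

theorem exp_sub_one_le_two {x : ℝ} (h : x ≤ 1) : Real.exp x ≤ 3 := by
  have := Real.exp_one_lt_d9
  linarith [Real.exp_le_exp.2 h]

/-- The estimate `‖v + w‖² ≤ 2‖v‖² + 2‖w‖²` lets the Gaussian cost absorb the whole `w` term under
`hc`, leaving a supremum over `t` that depends on `v` only. -/
theorem rankOne_laplace_le {ι κ : Type*} [Fintype ι] [Fintype κ] {μ : ι → Measure ℝ}
    [∀ i, IsProbabilityMeasure (μ i)] {M : ℝ} (hM : 0 ≤ M) (hμ : ∀ i, ∀ᵐ b ∂μ i, |b| ≤ M)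
    (c : κ → ι → ℝ)
    (hc : ∀ t : κ → ℝ, 2 * M ^ 2 * ((∑ l, t l • c l) ⬝ᵥ (∑ l, t l • c l)) ≤ ∑ l, t l ^ 2)
    (v : ι → ℝ) :
    partition (Measure.pi μ) c Finset.univ v * partition (Measure.pi μ) c Finset.univ (-v) ≤
      partition (Measure.pi μ) c Finset.univ 0 ^ 2 * Real.exp (2 * M ^ 2 * (v ⬝ᵥ v)) := by
  classical
  have := partition_mul_le hM hμ c Finset.univ 0 v (2 * M ^ 2 * (v ⬝ᵥ v)) fun t => by
    have h1 := hc t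
    set w := ∑ l, t l • c l
    have h2 : (v + w) ⬝ᵥ (v + w) ≤ 2 * (v ⬝ᵥ v) + 2 * (w ⬝ᵥ w) := by
      simp only [dotProduct, Finset.mul_sum, ← Finset.sum_add_distrib]
      refine Finset.sum_le_sum fun i _ => ?_
      simp only [Pi.add_apply]
      nlinarith [sq_nonneg (v i - w i)]
    nlinarith [mul_le_mul_of_nonneg_left h2 (sq_nonneg M)]
  simpa using this

/-- Variance bound for linear statistics of a high-temperature ferromagnetic model. -/
theorem rankOne_variance_le {ι κ : Type*} [Fintype ι] [Fintype κ] {μ : ι → Measure ℝ}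
    [∀ i, IsProbabilityMeasure (μ i)] {M : ℝ} (hM : 0 < M) (hμ : ∀ i, ∀ᵐ b ∂μ i, |b| ≤ M)
    (c : κ → ι → ℝ)
    (hc : ∀ t : κ → ℝ, 2 * M ^ 2 * ((∑ l, t l • c l) ⬝ᵥ (∑ l, t l • c l)) ≤ ∑ l, t l ^ 2)
    (v : ι → ℝ) {P : Measure (ι → ℝ)}
    (hP : P = (Measure.pi μ).tilted fun β => (∑ l, (c l ⬝ᵥ β) ^ 2) / 2) :
    ∫ β, (v ⬝ᵥ β - ∫ β', v ⬝ᵥ β' ∂P) ^ 2 ∂P ≤ 4 * M ^ 2 * (v ⬝ᵥ v) := by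
  have hπ := ae_pi_box hμ
  have hPp : IsProbabilityMeasure P := by
    rw [hP]; exact isProbabilityMeasure_tilted (integrable_of_ae_box hπ (by fun_prop))
  have hPb : ∀ᵐ β ∂P, ∀ i, |β i| ≤ M := by rw [hP]; exact ae_tilted hπ
  have hvv : 0 ≤ v ⬝ᵥ v := Finset.sum_nonneg fun i _ => mul_self_nonneg _
  rcases hvv.eq_or_lt with h0 | h0
  · have : v = 0 := dotProduct_self_eq_zero.1 h0.symm
    simp [this]
  -- This scale makes the exponent `2 * M ^ 2 * ‖s • v‖²` equal to one; then `exp 1 - 1 ≤ 2` bounds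
  -- the rescaled variance.
  set s : ℝ := Real.sqrt (1 / (2 * M ^ 2 * (v ⬝ᵥ v))) with hs
  have hs2 : s ^ 2 = 1 / (2 * M ^ 2 * (v ⬝ᵥ v)) := Real.sq_sqrt (by positivity)
  have key : ∀ u : ι → ℝ, ∫ β, Real.exp (u ⬝ᵥ β) ∂P =
      partition (Measure.pi μ) c Finset.univ u / partition (Measure.pi μ) c Finset.univ 0 := by
    intro u
    rw [hP, integral_exp_tilted, partition, partition]
    simp only [Pi.add_apply, zero_dotProduct, zero_add, add_comm]
  have h1 := one_add_variance_le (P := P) (X := fun β => (s • v) ⬝ᵥ β)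
    (integrable_of_ae_box hPb (by fun_prop)) (integrable_of_ae_box hPb (by fun_prop))
    (integrable_of_ae_box hPb (by fun_prop)) (integrable_of_ae_box hPb (by fun_prop))
  have h2 : ∀ β : ι → ℝ, -((s • v) ⬝ᵥ β) = (-(s • v)) ⬝ᵥ β := fun β => (neg_dotProduct _ _).symm
  simp_rw [h2] at h1
  rw [key, key] at h1
  have h3 := rankOne_laplace_le hM.le hμ c hc (s • v)
  have hz := partition_pos hπ c Finset.univ 0
  have h4 : partition (Measure.pi μ) c Finset.univ (s • v) /
      partition (Measure.pi μ) c Finset.univ 0 * (partition (Measure.pi μ) c Finset.univ (-(s • v)) /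
      partition (Measure.pi μ) c Finset.univ 0) ≤ Real.exp 1 := by
    rw [div_mul_div_comm, div_le_iff₀ (by positivity)]
    refine h3.trans (le_of_eq ?_)
    have : 2 * M ^ 2 * ((s • v) ⬝ᵥ (s • v)) = 1 := by
      rw [smul_dotProduct, dotProduct_smul, smul_eq_mul, smul_eq_mul]
      calc _ = s ^ 2 * (2 * M ^ 2 * (v ⬝ᵥ v)) := by ring
        _ = 1 := by rw [hs2]; field_simp
    rw [this]; ring
  have h5 : ∫ β, ((s • v) ⬝ᵥ β - ∫ β', (s • v) ⬝ᵥ β' ∂P) ^ 2 ∂P =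
      s ^ 2 * ∫ β, (v ⬝ᵥ β - ∫ β', v ⬝ᵥ β' ∂P) ^ 2 ∂P := by
    simp only [smul_dotProduct, smul_eq_mul, integral_const_mul, ← mul_sub, mul_pow]
  rw [h5] at h1
  have h6 : s ^ 2 * ∫ β, (v ⬝ᵥ β - ∫ β', v ⬝ᵥ β' ∂P) ^ 2 ∂P ≤ 2 := by
    linarith [exp_sub_one_le_two (le_refl 1)]
  rw [hs2, one_div_mul_eq_div, div_le_iff₀ (by positivity)] at h6
  linarith

theorem dotProduct_sq_le {κ : Type*} [Fintype κ] (x y : κ → ℝ) :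
    (x ⬝ᵥ y) ^ 2 ≤ (∑ i, x i ^ 2) * ∑ i, y i ^ 2 :=
  Finset.sum_mul_sq_le_sq_mul_sq _ _ _

theorem dotProduct_mulVec_sq_le {ι : Type*} [Fintype ι] {J : Matrix ι ι ℝ} {η : ℝ}
    (hη : ∀ v : ι → ℝ, ∑ i, (J *ᵥ v) i ^ 2 ≤ η ^ 2 * ∑ i, v i ^ 2) (v : ι → ℝ) :
    (v ⬝ᵥ (J *ᵥ v)) ^ 2 ≤ (η * ∑ i, v i ^ 2) ^ 2 := by
  have h0 : 0 ≤ ∑ i, v i ^ 2 := Finset.sum_nonneg fun _ _ => sq_nonneg _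
  calc _ ≤ _ := dotProduct_sq_le _ _
    _ ≤ (∑ i, v i ^ 2) * (η ^ 2 * ∑ i, v i ^ 2) := by gcongr; exact hη v
    _ = _ := by ring

theorem abs_dotProduct_mulVec_le {ι : Type*} [Fintype ι] {J : Matrix ι ι ℝ} {η : ℝ} (hη0 : 0 ≤ η)
    (hη : ∀ v : ι → ℝ, ∑ i, (J *ᵥ v) i ^ 2 ≤ η ^ 2 * ∑ i, v i ^ 2) (v : ι → ℝ) :
    |v ⬝ᵥ (J *ᵥ v)| ≤ η * ∑ i, v i ^ 2 :=
  abs_le_of_sq_le_sq (dotProduct_mulVec_sq_le hη v)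
    (mul_nonneg hη0 (Finset.sum_nonneg fun _ _ => sq_nonneg _))

/-- Variance bound for linear statistics of a Gibbs measure with quadratic interaction of small
operator norm. -/
theorem gibbs_variance_le {ι : Type*} [Fintype ι] [DecidableEq ι] {μ : ι → Measure ℝ}
    [∀ i, IsProbabilityMeasure (μ i)] {M : ℝ} (hM : 0 < M) (hμ : ∀ i, ∀ᵐ b ∂μ i, |b| ≤ M)
    {J : Matrix ι ι ℝ} (hJ : J.IsSymm) {η : ℝ} (hη0 : 0 ≤ η) (hη1 : 4 * M ^ 2 * η ≤ 1)
    (hη : ∀ v : ι → ℝ, ∑ i, (J *ᵥ v) i ^ 2 ≤ η ^ 2 * ∑ i, v i ^ 2)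
    {P : Measure (ι → ℝ)}
    (hP : P = (Measure.pi μ).tilted fun β => -(β ⬝ᵥ (J *ᵥ β)) / 2) (v : ι → ℝ) :
    ∫ β, (v ⬝ᵥ β - ∫ β', v ⬝ᵥ β' ∂P) ^ 2 ∂P ≤ 4 * M ^ 2 * (v ⬝ᵥ v) := by
  -- Shifting by `η` makes the interaction ferromagnetic: `B` is positive semidefinite, hence a sum
  -- of rank-one squares. The compensating term `-η ‖β‖² / 2` is a sum over sites and goes into the
  -- product measure.
  set B : Matrix ι ι ℝ := η • (1 : Matrix ι ι ℝ) - J with hB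
  have hquad : ∀ w : ι → ℝ, w ⬝ᵥ (B *ᵥ w) = η * (w ⬝ᵥ w) - w ⬝ᵥ (J *ᵥ w) := fun w => by
    rw [hB, Matrix.sub_mulVec, Matrix.smul_mulVec, Matrix.one_mulVec, dotProduct_sub,
      dotProduct_smul, smul_eq_mul]
  have hww : ∀ w : ι → ℝ, w ⬝ᵥ w = ∑ i, w i ^ 2 := fun w => by simp [dotProduct, sq]
  have hpsd : B.PosSemidef := by
    refine Matrix.PosSemidef.of_dotProduct_mulVec_nonneg ?_ fun w => ?_
    · rw [Matrix.IsHermitian, Matrix.conjTranspose_eq_transpose_of_trivial, hB,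
        Matrix.transpose_sub, hJ.eq]
      simp
    · rw [star_trivial, hquad, hww]
      linarith [(abs_le.1 (abs_dotProduct_mulVec_le hη0 hη w)).2]
  obtain ⟨m, c, hc⟩ := Matrix.posSemidef_iff_eq_sum_vecMulVec.1 hpsd
  have hBc : ∀ w : ι → ℝ, w ⬝ᵥ (B *ᵥ w) = ∑ l, (c l ⬝ᵥ w) ^ 2 := fun w => by
    rw [hc, Matrix.sum_mulVec, dotProduct_sum]
    refine Finset.sum_congr rfl fun l _ => ?_
    rw [star_trivial, Matrix.vecMulVec_mulVec]
    simp [dotProduct_comm, sq]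
  have hi : ∀ i, Integrable (fun b => Real.exp (-(η / 2) * b ^ 2)) (μ i) := fun i =>
    integrable_of_ae_interval (hμ i) (by fun_prop)
  have hpr : ∀ i, IsProbabilityMeasure ((μ i).tilted fun b => -(η / 2) * b ^ 2) := fun i =>
    isProbabilityMeasure_tilted (hi i)
  refine rankOne_variance_le (μ := fun i => (μ i).tilted fun b => -(η / 2) * b ^ 2) hM
    (fun i => ae_tilted (hμ i)) c (fun t => ?_) v ?_
  · set w := ∑ l, t l • c l with hw
    have h1 : w ⬝ᵥ w = t ⬝ᵥ fun l => c l ⬝ᵥ w := by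
      conv_lhs => rw [hw, sum_dotProduct]
      simp only [smul_dotProduct, smul_eq_mul]
      rfl
    -- Cauchy–Schwarz applied to `‖w‖² = ∑ t l (c l ⬝ᵥ w)`, where `∑ (c l ⬝ᵥ w)² = w ⬝ᵥ B w ≤ 2 η
    -- ‖w‖²`. Dividing by `‖w‖²` gives the high-temperature condition.
    have h2 : (w ⬝ᵥ w) ^ 2 ≤ (∑ l, t l ^ 2) * (2 * η * (w ⬝ᵥ w)) := by
      conv_lhs => rw [h1]
      refine (dotProduct_sq_le _ _).trans ?_
      have h3 : 0 ≤ ∑ l, t l ^ 2 := Finset.sum_nonneg fun i _ => sq_nonneg _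
      gcongr
      rw [← hBc, hquad]
      have := (abs_le.1 (abs_dotProduct_mulVec_le hη0 hη w)).1
      rw [← hww] at this
      linarith
    have hw0 : 0 ≤ w ⬝ᵥ w := Finset.sum_nonneg fun i _ => mul_self_nonneg _
    have h3 : 0 ≤ ∑ l, t l ^ 2 := Finset.sum_nonneg fun i _ => sq_nonneg _
    rcases hw0.eq_or_lt with h0 | h0
    · rw [← h0]; simpa using h3
    · have h4 : w ⬝ᵥ w ≤ (∑ l, t l ^ 2) * (2 * η) := by
        rw [sq, ← mul_assoc] at h2
        exact le_of_mul_le_mul_right h2 h0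
      calc _ ≤ 2 * M ^ 2 * ((∑ l, t l ^ 2) * (2 * η)) := by gcongr
        _ = (4 * M ^ 2 * η) * ∑ l, t l ^ 2 := by ring
        _ ≤ 1 * ∑ l, t l ^ 2 := by gcongr
        _ = _ := one_mul _
  · rw [hP, pi_tilted μ _ hi, tilted_tilted]
    · congr 1
      ext β
      rw [Pi.add_apply, ← hBc, hquad, ← Finset.mul_sum, ← hww]
      ring
    · exact integrable_of_ae_box (ae_pi_box hμ) (by fun_prop)

/-! ### Perturbation of exponential tilts -/

section Tilt

variable {α : Type*} [MeasurableSpace α]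

theorem abs_integral_le_of_ae {P : Measure α} [IsProbabilityMeasure P] {f : α → ℝ} {F : ℝ}
    (hf : ∀ᵐ x ∂P, |f x| ≤ F) : |∫ x, f x ∂P| ≤ F := by
  have := norm_integral_le_of_norm_le_const (μ := P) (f := f) (C := F) hf
  simpa using this

/-- Changing the exponent of a tilted measure by at most `δ` changes integrals of functions bounded
by `F` by at most `4 F δ`. -/
theorem abs_integral_tilted_sub_le {τ : Measure α} [IsProbabilityMeasure τ] {u f : α → ℝ}
    {δ F : ℝ} (hu : AEMeasurable u τ) (hub : ∀ᵐ x ∂τ, |u x| ≤ δ) (hf : AEStronglyMeasurable f τ)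
    (hfb : ∀ᵐ x ∂τ, |f x| ≤ F) :
    |(∫ x, f x ∂τ.tilted u) - ∫ x, f x ∂τ| ≤ 4 * F * δ := by
  have hF : 0 ≤ F := by
    obtain ⟨x, hx⟩ := hfb.exists
    exact (abs_nonneg _).trans hx
  have hei : Integrable (fun x => Real.exp (u x)) τ := by
    refine Integrable.of_bound hu.exp.aestronglyMeasurable (Real.exp δ) ?_
    filter_upwards [hub] with x hx
    rw [Real.norm_eq_abs, abs_of_pos (Real.exp_pos _)]
    exact Real.exp_le_exp.2 ((le_abs_self _).trans hx)
  have hpr := isProbabilityMeasure_tilted hei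
  have hfi : Integrable f τ := Integrable.of_bound hf F hfb
  -- For small `δ` the normalized density lies between `exp (-2δ)` and `exp (2δ)`; otherwise the
  -- trivial bound `2 F` is already below `4 F δ`.
  rcases le_or_gt (2 * δ) 1 with h | h
  · have hZ := integral_exp_pos hei
    set Z := ∫ x, Real.exp (u x) ∂τ
    have hδ : 0 ≤ δ := by
      obtain ⟨x, hx⟩ := hub.exists
      exact (abs_nonneg _).trans hx
    have hZ1 : Z ≤ Real.exp δ := by
      have : Z ≤ ∫ _, Real.exp δ ∂τ := integral_mono_ae hei (integrable_const _) (by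
        filter_upwards [hub] with x hx
        exact Real.exp_le_exp.2 ((le_abs_self _).trans hx))
      simpa using this
    have hZ2 : Real.exp (-δ) ≤ Z := by
      have : ∫ _, Real.exp (-δ) ∂τ ≤ Z := integral_mono_ae (integrable_const _) hei (by
        filter_upwards [hub] with x hx
        exact Real.exp_le_exp.2 (abs_le.1 hx).1)
      simpa using this
    have hden : ∀ᵐ x ∂τ, |Real.exp (u x) / Z - 1| ≤ 4 * δ := by
      filter_upwards [hub] with x hx
      have h1 : Real.exp (u x) / Z ≤ Real.exp (2 * δ) := by
        rw [div_le_iff₀ hZ]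
        calc _ ≤ Real.exp δ := Real.exp_le_exp.2 (abs_le.1 hx).2
          _ = Real.exp (2 * δ) * Real.exp (-δ) := by rw [← Real.exp_add]; ring_nf
          _ ≤ _ := by gcongr
      have h2 : Real.exp (-(2 * δ)) ≤ Real.exp (u x) / Z := by
        rw [le_div_iff₀ hZ]
        calc _ ≤ Real.exp (-(2 * δ)) * Real.exp δ := by gcongr
          _ = Real.exp (-δ) := by rw [← Real.exp_add]; ring_nf
          _ ≤ _ := Real.exp_le_exp.2 (abs_le.1 hx).1
      have h3 := Real.abs_exp_sub_one_le (x := 2 * δ) (by rwa [abs_of_nonneg (by linarith)])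
      have h4 := Real.abs_exp_sub_one_le (x := -(2 * δ))
        (by rwa [abs_neg, abs_of_nonneg (by linarith)])
      rw [abs_neg] at h4
      rw [abs_of_nonneg (by linarith : 0 ≤ 2 * δ)] at h3 h4
      rw [abs_le]
      constructor
      · linarith [(abs_le.1 h4).1]
      · linarith [(abs_le.1 h3).2]
    have e1 : (∫ x, f x ∂τ.tilted u) - ∫ x, f x ∂τ =
        ∫ x, (Real.exp (u x) / Z - 1) * f x ∂τ := by
      rw [integral_tilted, ← integral_sub _ hfi]
      · refine integral_congr_ae (ae_of_all _ fun x => ?_)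
        simp only [smul_eq_mul]; ring
      · simp only [smul_eq_mul]
        exact (hei.div_const Z).mul_bdd (c := F) hf hfb
    rw [e1]
    refine abs_integral_le_of_ae ?_
    filter_upwards [hden, hfb] with x h1 h2
    rw [abs_mul]
    calc _ ≤ (4 * δ) * F := by gcongr
      _ = _ := by ring
  · have h1 : |∫ x, f x ∂τ.tilted u| ≤ F := abs_integral_le_of_ae (ae_tilted hfb)
    have h2 : |∫ x, f x ∂τ| ≤ F := abs_integral_le_of_ae hfb
    calc _ ≤ |∫ x, f x ∂τ.tilted u| + |∫ x, f x ∂τ| := abs_sub _ _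
      _ ≤ 2 * F := by linarith
      _ ≤ _ := by nlinarith

end Tilt

variable {M F : ℝ}

theorem integrable_exp_mul_of_ae_interval {μ : Measure ℝ} [IsFiniteMeasure μ]
    (hμ : ∀ᵐ b ∂μ, |b| ≤ M) (s : ℝ) : Integrable (fun b => Real.exp (s * b)) μ :=
  integrable_of_ae_interval hμ (by fun_prop)

theorem isProbabilityMeasure_tilted_mul {μ : Measure ℝ} [IsProbabilityMeasure μ]
    (hμ : ∀ᵐ b ∂μ, |b| ≤ M) (s : ℝ) : IsProbabilityMeasure (μ.tilted fun b => s * b) :=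
  isProbabilityMeasure_tilted (integrable_exp_mul_of_ae_interval hμ s)

theorem abs_integral_tilted_mul_sub_le {μ : Measure ℝ} [IsProbabilityMeasure μ]
    (hμ : ∀ᵐ b ∂μ, |b| ≤ M) {f : ℝ → ℝ} (hf : Measurable f) (hfb : ∀ b, |b| ≤ M → |f b| ≤ F)
    (s t : ℝ) :
    |(∫ b, f b ∂μ.tilted fun b => s * b) - ∫ b, f b ∂μ.tilted fun b => t * b| ≤
      4 * F * M * |s - t| := by
  have hpr := isProbabilityMeasure_tilted_mul hμ t
  have e : (μ.tilted fun b => t * b).tilted (fun b => (s - t) * b) = μ.tilted fun b => s * b := by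
    rw [tilted_tilted (integrable_exp_mul_of_ae_interval hμ t)]
    congr 1; ext b; simp only [Pi.add_apply]; ring
  have hb : ∀ᵐ b ∂(μ.tilted fun b => t * b), |b| ≤ M := ae_tilted hμ
  rw [← e]
  refine (abs_integral_tilted_sub_le (δ := M * |s - t|) (F := F) (by fun_prop) ?_
    hf.aestronglyMeasurable (hb.mono hfb)).trans (le_of_eq (by ring))
  filter_upwards [hb] with b hb
  rw [abs_mul, mul_comm]
  gcongr

theorem continuous_integral_tilted_mul {μ : Measure ℝ} [IsProbabilityMeasure μ]
    (hμ : ∀ᵐ b ∂μ, |b| ≤ M) {f : ℝ → ℝ} (hf : Measurable f) (hfb : ∀ b, |b| ≤ M → |f b| ≤ F) :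
    Continuous fun s : ℝ => ∫ b, f b ∂μ.tilted fun b => s * b := by
  refine (LipschitzWith.of_dist_le_mul (K := (4 * F * M).toNNReal) fun s t => ?_).continuous
  rw [Real.dist_eq, Real.dist_eq]
  refine (abs_integral_tilted_mul_sub_le hμ hf hfb s t).trans ?_
  gcongr
  exact Real.le_coe_toNNReal _

/-- Second-order expansion of the mean of a bounded random variable under exponential tilting. -/
theorem abs_mean_tilted_sub_linear_le {τ : Measure ℝ} [IsProbabilityMeasure τ] (hM : 0 < M)
    (hτ : ∀ᵐ b ∂τ, |b| ≤ M) (u : ℝ) :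
    |(∫ b, b ∂τ.tilted fun b => u * b) - (∫ b, b ∂τ) -
      u * ∫ b, (b - ∫ x, x ∂τ) ^ 2 ∂τ| ≤ 16 * M ^ 3 * u ^ 2 := by
  have hpr := isProbabilityMeasure_tilted_mul hτ u
  set c := ∫ b, b ∂τ with hc
  set V := ∫ b, (b - c) ^ 2 ∂τ with hV
  have hcM : |c| ≤ M := abs_integral_le_of_ae hτ
  have hζ : ∀ᵐ b ∂τ, |b - c| ≤ 2 * M := by
    filter_upwards [hτ] with b hb
    linarith [abs_sub b c]
  have hi : ∀ {f : ℝ → ℝ}, Continuous f → Integrable f τ := fun hf =>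
    integrable_of_ae_interval hτ hf
  have hV1 : |V| ≤ 4 * M ^ 2 := by
    refine abs_integral_le_of_ae ?_
    filter_upwards [hζ] with b hb
    rw [abs_pow]
    calc _ ≤ (2 * M) ^ 2 := by gcongr
      _ = _ := by ring
  rcases le_or_gt (2 * M * |u|) 1 with h | h
  · have e0 : τ.tilted (fun b => u * b) = τ.tilted fun b => u * (b - c) := by
      rw [← tilted_add_const τ (fun b => u * b) (hi (by fun_prop)) (-(u * c))]
      congr 1; ext b; ring
    have hzero : ∫ b, (b - c) ∂τ = 0 := by
      rw [integral_sub (hi continuous_id') (integrable_const _)]; simp [hc]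
    set D := ∫ b, Real.exp (u * (b - c)) ∂τ with hD
    have hx : ∀ᵐ b ∂τ, |Real.exp (u * (b - c)) - 1 - u * (b - c)| ≤ 4 * M ^ 2 * u ^ 2 := by
      filter_upwards [hζ] with b hb
      have h1 : |u * (b - c)| ≤ 1 := by
        rw [abs_mul]
        calc _ ≤ |u| * (2 * M) := by gcongr
          _ ≤ 1 := by linarith
      refine (Real.abs_exp_sub_one_sub_id_le h1).trans ?_
      rw [mul_pow, ← sq_abs (b - c)]
      calc _ ≤ u ^ 2 * (2 * M) ^ 2 := by gcongr
        _ = _ := by ring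
    have hD1 : D - 1 = ∫ b, (Real.exp (u * (b - c)) - 1 - u * (b - c)) ∂τ := by
      rw [integral_sub (hi (by fun_prop)) (hi (by fun_prop)), integral_sub (hi (by fun_prop))
        (integrable_const _), integral_const_mul, hzero]
      simp [hD]
    have hD2 : 1 ≤ D := by
      have : 0 ≤ D - 1 := by
        rw [hD1]
        exact integral_nonneg fun b => by
          simp only [Pi.zero_apply]
          linarith [Real.add_one_le_exp (u * (b - c))]
      linarith
    have hD3 : |D - 1| ≤ 4 * M ^ 2 * u ^ 2 := by rw [hD1]; exact abs_integral_le_of_ae hx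
    set N := ∫ b, (b - c) * Real.exp (u * (b - c)) ∂τ with hN
    have hN1 : |N - u * V| ≤ 8 * M ^ 3 * u ^ 2 := by
      have : N - u * V = ∫ b, (b - c) * (Real.exp (u * (b - c)) - 1 - u * (b - c)) ∂τ := by
        have e : ∀ b, (b - c) * (Real.exp (u * (b - c)) - 1 - u * (b - c)) =
            (b - c) * Real.exp (u * (b - c)) - (b - c) - u * (b - c) ^ 2 := fun b => by ring
        simp_rw [e]
        rw [integral_sub (hi (by fun_prop)) (hi (by fun_prop)), integral_sub (hi (by fun_prop))
          (hi (by fun_prop)), integral_const_mul, hzero]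
        simp [hN, hV]
      rw [this]
      refine abs_integral_le_of_ae ?_
      filter_upwards [hζ, hx] with b h1 h2
      rw [abs_mul]
      calc _ ≤ (2 * M) * (4 * M ^ 2 * u ^ 2) := by gcongr
        _ = _ := by ring
    have e1 : (∫ b, b ∂τ.tilted fun b => u * b) - c = N / D := by
      have hb : ∀ᵐ b ∂(τ.tilted fun b => u * b), |b| ≤ M := ae_tilted hτ
      have : (∫ b, b ∂τ.tilted fun b => u * b) - c = ∫ b, (b - c) ∂τ.tilted fun b => u * b := by
        rw [integral_sub (integrable_of_ae_interval hb continuous_id') (integrable_const _)]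
        simp
      rw [this, e0, integral_tilted, hN, ← integral_div]
      refine integral_congr_ae (ae_of_all _ fun b => ?_)
      simp only [smul_eq_mul]; ring
    have hDp : 0 < D := by linarith
    have e2 : N / D - u * V = ((N - u * V) - u * V * (D - 1)) / D := by field_simp; ring
    rw [e1, e2, abs_div, abs_of_pos hDp]
    refine (div_le_self (abs_nonneg _) hD2).trans ?_
    have h3 : |u * V * (D - 1)| ≤ 8 * M ^ 3 * u ^ 2 := by
      rw [abs_mul, abs_mul]
      calc _ ≤ |u| * (4 * M ^ 2) * (4 * M ^ 2 * u ^ 2) := by gcongr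
        _ = (2 * M * |u|) * (8 * M ^ 3 * u ^ 2) := by ring
        _ ≤ 1 * (8 * M ^ 3 * u ^ 2) := by gcongr
        _ = _ := one_mul _
    linarith [abs_sub (N - u * V) (u * V * (D - 1))]
  · have h1 : |∫ b, b ∂τ.tilted fun b => u * b| ≤ M := abs_integral_le_of_ae (ae_tilted hτ)
    have h2 : |u * V| ≤ |u| * (4 * M ^ 2) := by rw [abs_mul]; gcongr
    have h3 : 1 ≤ 4 * M ^ 2 * u ^ 2 := by
      have : 1 ≤ (2 * M * |u|) ^ 2 := one_le_pow₀ h.le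
      rw [mul_pow, sq_abs] at this
      linarith
    have h4 : |u| ≤ 2 * M * u ^ 2 := by
      rw [← sq_abs u]; nlinarith [abs_nonneg u]
    have h5 := abs_sub ((∫ b, b ∂τ.tilted fun b => u * b) - c) (u * V)
    have h6 := abs_sub (∫ b, b ∂τ.tilted fun b => u * b) c
    have h7 : M ≤ 4 * M ^ 3 * u ^ 2 := by nlinarith
    have h8 : |u| * (4 * M ^ 2) ≤ (2 * M * u ^ 2) * (4 * M ^ 2) := by gcongr
    linarith

/-! ### Resampling a coordinate and conditional laws -/

section Resampling

variable {ι : Type*} [Fintype ι] [DecidableEq ι] (μ : ι → Measure ℝ)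
  [∀ i, IsProbabilityMeasure (μ i)]

/-- Resampling one coordinate preserves a product measure. -/
theorem measurePreserving_update (i : ι) :
    MeasurePreserving (fun w : (ι → ℝ) × ℝ => Function.update w.1 i w.2)
      ((Measure.pi μ).prod (μ i)) (Measure.pi μ) := by
  have hmeas : Measurable fun w : (ι → ℝ) × ℝ => Function.update w.1 i w.2 :=
    measurable_pi_iff.2 fun j => by
      by_cases h : j = i
      · subst h; simpa using measurable_snd
      · simp only [Function.update_of_ne h]
        exact (measurable_pi_apply j).comp measurable_fst
  refine ⟨hmeas, (Measure.pi_eq fun s hs => ?_).symm⟩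
  rw [Measure.map_apply hmeas (MeasurableSet.univ_pi hs)]
  have e : (fun w : (ι → ℝ) × ℝ => Function.update w.1 i w.2) ⁻¹' Set.univ.pi s =
      (Set.univ.pi (Function.update s i Set.univ)) ×ˢ s i := by
    ext w
    simp only [Set.mem_preimage, Set.mem_pi, Set.mem_univ, forall_true_left, Set.mem_prod]
    constructor
    · intro h
      refine ⟨fun j => ?_, by simpa using h i⟩
      by_cases hj : j = i
      · subst hj; simp
      · simpa [Function.update_of_ne hj] using h j
    · rintro ⟨h1, h2⟩ j
      by_cases hj : j = i
      · subst hj; simpa using h2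
      · simpa [Function.update_of_ne hj] using h1 j
  rw [e, Measure.prod_prod, Measure.pi_pi, ← Finset.mul_prod_erase _ _ (Finset.mem_univ i),
    ← Finset.mul_prod_erase (a := i) _ (fun j => μ j (s j)) (Finset.mem_univ i)]
  rw [Function.update_self, measure_univ, one_mul, mul_comm]
  congr 1
  exact Finset.prod_congr rfl fun j hj => by rw [Function.update_of_ne (Finset.ne_of_mem_erase hj)]

theorem integral_pi_eq_integral_update (i : ι) {G : (ι → ℝ) → ℝ}
    (hG : Integrable G (Measure.pi μ)) :
    ∫ β, G β ∂Measure.pi μ =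
      ∫ β, (∫ b, G (Function.update β i b) ∂μ i) ∂Measure.pi μ := by
  have hmp := measurePreserving_update μ i
  have h1 := integral_map (f := G) hmp.measurable.aemeasurable
    (by rw [hmp.map_eq]; exact hG.aestronglyMeasurable)
  rw [hmp.map_eq] at h1
  rw [h1, integral_prod]
  exact hmp.integrable_comp_of_integrable hG

end Resampling

section Gibbs

variable {ι : Type*} [Fintype ι] {μ : ι → Measure ℝ}
  [∀ i, IsProbabilityMeasure (μ i)] {M F η : ℝ} {J : Matrix ι ι ℝ}

theorem update_eq_add_single {ι : Type*} [DecidableEq ι] (β : ι → ℝ) (i : ι) (b : ℝ) :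
    Function.update β i b = Function.update β i 0 + b • Pi.single i (1 : ℝ) := by
  ext j
  by_cases hj : j = i
  · subst hj; simp
  · simp [hj]

theorem mulVec_update_self [DecidableEq ι] (hd : ∀ i, J i i = 0) (β : ι → ℝ) (i : ι) (b : ℝ) :
    (J *ᵥ Function.update β i b) i = (J *ᵥ β) i := by
  simp only [Matrix.mulVec, dotProduct]
  refine Finset.sum_congr rfl fun j _ => ?_
  by_cases hj : j = i
  · subst hj; simp [hd]
  · rw [Function.update_of_ne hj]

/-- The zero diagonal leaves no `b ^ 2` term, so the exponent is affine in each single coordinate;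
this is why conditional laws are exponential tilts by the local field. -/
theorem quadratic_update [DecidableEq ι] (hJ : J.IsSymm) (hd : ∀ i, J i i = 0) (β : ι → ℝ) (i : ι) (b : ℝ) :
    Function.update β i b ⬝ᵥ (J *ᵥ Function.update β i b) =
      Function.update β i 0 ⬝ᵥ (J *ᵥ Function.update β i 0) + 2 * b * (J *ᵥ β) i := by
  have h0 := mulVec_update_self hd β i 0
  have h1 : Function.update β i 0 ⬝ᵥ (J *ᵥ Pi.single i (1 : ℝ)) =
      (J *ᵥ Function.update β i 0) i := by
    rw [Matrix.dotProduct_mulVec, ← Matrix.mulVec_transpose, hJ.eq, dotProduct_comm,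
      single_one_dotProduct]
  have h2 : (Pi.single i (1 : ℝ)) ⬝ᵥ (J *ᵥ Pi.single i (1 : ℝ)) = 0 := by
    rw [single_one_dotProduct, Matrix.mulVec_single_one, Matrix.col_apply, hd]
  rw [update_eq_add_single β i b, Matrix.mulVec_add, Matrix.mulVec_smul, add_dotProduct,
    dotProduct_add, dotProduct_add, smul_dotProduct, smul_dotProduct, dotProduct_smul,
    dotProduct_smul, h1, h2, single_one_dotProduct, h0]
  simp only [smul_eq_mul]
  ring

/-- In a Gibbs measure, the conditional law of a coordinate given the others is an exponential tilt
of its base measure by the local field. -/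
theorem integral_coordinate_gibbs [DecidableEq ι] (hμ : ∀ i, ∀ᵐ b ∂μ i, |b| ≤ M) (hJ : J.IsSymm)
    (hd : ∀ i, J i i = 0) {P : Measure (ι → ℝ)}
    (hP : P = (Measure.pi μ).tilted fun β => -(β ⬝ᵥ (J *ᵥ β)) / 2) (i : ι)
    {f : ℝ → ℝ} (hf : Measurable f) (hfb : ∀ b, |b| ≤ M → |f b| ≤ F) :
    ∫ β, f (β i) ∂P = ∫ β, (∫ b, f b ∂(μ i).tilted fun b => -(J *ᵥ β) i * b) ∂P := by
  have hπ := ae_pi_box hμ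
  set D : (ι → ℝ) → ℝ := fun β => Real.exp (-(β ⬝ᵥ (J *ᵥ β)) / 2) with hD
  have hDi : Integrable D (Measure.pi μ) := integrable_of_ae_box hπ (by fun_prop)
  set K : ℝ → ℝ := fun s => ∫ b, f b ∂(μ i).tilted fun b => s * b with hK
  have hKc : Continuous K := continuous_integral_tilted_mul (hμ i) hf hfb
  have hupd : ∀ (β : ι → ℝ) (b : ℝ), D (Function.update β i b) =
      D (Function.update β i 0) * Real.exp (-(J *ᵥ β) i * b) := fun β b => by
    simp only [hD]
    rw [quadratic_update hJ hd β i b, ← Real.exp_add]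
    ring_nf
  have h1 : ∫ β, D β * f (β i) ∂Measure.pi μ = ∫ β, D β * K (-(J *ᵥ β) i) ∂Measure.pi μ := by
    rw [integral_pi_eq_integral_update μ i (G := fun β => D β * f (β i)),
      integral_pi_eq_integral_update μ i (G := fun β => D β * K (-(J *ᵥ β) i))]
    · refine integral_congr_ae (ae_of_all _ fun β => ?_)
      have hL : ∀ b, D (Function.update β i b) * f (Function.update β i b i) =
          D (Function.update β i 0) * (Real.exp (-(J *ᵥ β) i * b) * f b) := fun b => by
        rw [hupd β b, Function.update_self, mul_assoc]
      have hR : ∀ b, D (Function.update β i b) * K (-(J *ᵥ Function.update β i b) i) =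
          D (Function.update β i 0) * (Real.exp (-(J *ᵥ β) i * b) * K (-(J *ᵥ β) i)) :=
        fun b => by rw [hupd β b, mulVec_update_self hd, mul_assoc]
      simp only [hL, hR]
      rw [integral_const_mul, integral_const_mul, integral_mul_const]
      congr 1
      simp only [hK]
      rw [integral_tilted, ← integral_const_mul]
      have hpos := integral_exp_pos (integrable_exp_mul_of_ae_interval (hμ i) (-(J *ᵥ β) i))
      refine integral_congr_ae (ae_of_all _ fun b => ?_)
      simp only [smul_eq_mul]
      rw [← mul_assoc, mul_div_cancel₀ _ hpos.ne']
    · exact integrable_of_ae_box hπ (Continuous.mul (by fun_prop) (hKc.comp (by fun_prop)))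
    · refine hDi.mul_bdd (c := F) (hf.comp (measurable_pi_apply i)).aestronglyMeasurable ?_
      filter_upwards [hπ] with β hβ
      exact hfb _ (hβ i)
  rw [hP, integral_tilted, integral_tilted]
  have e : ∀ (x z : ℝ) (β : ι → ℝ), (D β / z) • x = (D β * x) / z := fun x z β => by
    rw [smul_eq_mul]; ring
  simp only [hD] at h1 e
  simp_rw [e, integral_div]
  rw [h1]

theorem isProbabilityMeasure_gibbs (hμ : ∀ i, ∀ᵐ b ∂μ i, |b| ≤ M) {P : Measure (ι → ℝ)}
    (hP : P = (Measure.pi μ).tilted fun β => -(β ⬝ᵥ (J *ᵥ β)) / 2) : IsProbabilityMeasure P := by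
  rw [hP]; exact isProbabilityMeasure_tilted (integrable_of_ae_box (ae_pi_box hμ) (by fun_prop))

theorem row_sq_le [DecidableEq ι] (hJ : J.IsSymm)
    (hη : ∀ v : ι → ℝ, ∑ i, (J *ᵥ v) i ^ 2 ≤ η ^ 2 * ∑ i, v i ^ 2) (i : ι) :
    ∑ j, J i j ^ 2 ≤ η ^ 2 := by
  have := hη (Pi.single i 1)
  rw [Matrix.mulVec_single_one] at this
  have e : ∑ j, (Pi.single i (1 : ℝ) : ι → ℝ) j ^ 2 = 1 := by
    rw [Finset.sum_eq_single i] <;> simp +contextual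
  rw [e, mul_one] at this
  refine le_trans (le_of_eq (Finset.sum_congr rfl fun j _ => ?_)) this
  rw [Matrix.col_apply, hJ.apply]

theorem mulVec_apply_abs_le (hη0 : 0 ≤ η)
    (hη : ∀ v : ι → ℝ, ∑ i, (J *ᵥ v) i ^ 2 ≤ η ^ 2 * ∑ i, v i ^ 2) {v : ι → ℝ} {R : ℝ}
    (hR0 : 0 ≤ R) (hR : ∑ i, v i ^ 2 ≤ R ^ 2) (i : ι) : |(J *ᵥ v) i| ≤ η * R := by
  refine abs_le_of_sq_le_sq ?_ (mul_nonneg hη0 hR0)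
  calc _ ≤ ∑ j, (J *ᵥ v) j ^ 2 :=
        Finset.single_le_sum (f := fun j => (J *ᵥ v) j ^ 2) (fun j _ => sq_nonneg _)
          (Finset.mem_univ i)
    _ ≤ _ := hη v
    _ ≤ η ^ 2 * R ^ 2 := by gcongr
    _ = _ := by ring

/-! ### Mean-field equations: accuracy and stability -/

/-- A perturbed fixed-point inequality for a matrix of small operator norm is stable in `ℓ²`. -/
theorem sum_sq_le_of_fixedPoint_perturbation (hM : 0 < M) (hη1 : 64 * M ^ 4 * η ^ 2 ≤ 1)
    (hη : ∀ v : ι → ℝ, ∑ i, (J *ᵥ v) i ^ 2 ≤ η ^ 2 * ∑ i, v i ^ 2) {δ : ι → ℝ} {A : ℝ}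
    (h : ∀ i, |δ i| ≤ A + 4 * M ^ 2 * |(J *ᵥ δ) i|) :
    ∑ i, δ i ^ 2 ≤ 4 * Fintype.card ι * A ^ 2 := by
  have h1 : ∀ i, δ i ^ 2 ≤ 2 * A ^ 2 + 32 * M ^ 4 * (J *ᵥ δ) i ^ 2 := fun i => by
    have h2 : |δ i| ^ 2 ≤ (A + 4 * M ^ 2 * |(J *ᵥ δ) i|) ^ 2 := by gcongr; exact h i
    rw [sq_abs] at h2
    rw [← sq_abs ((J *ᵥ δ) i)]
    nlinarith [sq_nonneg (A - 4 * M ^ 2 * |(J *ᵥ δ) i|)]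
  have h3 := Finset.sum_le_sum fun i (_ : i ∈ Finset.univ) => h1 i
  rw [Finset.sum_add_distrib, Finset.sum_const, Finset.card_univ, nsmul_eq_mul,
    ← Finset.mul_sum] at h3
  have hS : 0 ≤ ∑ i, δ i ^ 2 := Finset.sum_nonneg fun _ _ => sq_nonneg _
  have h4 : 32 * M ^ 4 * ∑ i, (J *ᵥ δ) i ^ 2 ≤ (1 / 2) * ∑ i, δ i ^ 2 := by
    calc _ ≤ 32 * M ^ 4 * (η ^ 2 * ∑ i, δ i ^ 2) := by gcongr; exact hη δ
      _ = (64 * M ^ 4 * η ^ 2) * ((1 / 2) * ∑ i, δ i ^ 2) := by ring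
      _ ≤ 1 * ((1 / 2) * ∑ i, δ i ^ 2) := by gcongr
      _ = _ := one_mul _
  linarith

/-- `m` solves the mean-field equations for the Gibbs measure with base measures `μ` and
interaction `J`. -/
def IsMeanFieldSolution (μ : ι → Measure ℝ) (J : Matrix ι ι ℝ) (m : ι → ℝ) : Prop :=
  ∀ i, m i = ∫ b, b ∂(μ i).tilted fun b => -(J *ᵥ m) i * b

/-- The marginals of a Gibbs measure at high temperature are close to those of the solution of the
mean-field equations. -/
theorem gibbs_meanField_close [DecidableEq ι] (hM : 0 < M) (hμ : ∀ i, ∀ᵐ b ∂μ i, |b| ≤ M)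
    (hJ : J.IsSymm) (hd : ∀ i, J i i = 0) (hη0 : 0 ≤ η) (hη1 : 4 * M ^ 2 * η ≤ 1)
    (hη2 : 64 * M ^ 4 * η ^ 2 ≤ 1)
    (hη : ∀ v : ι → ℝ, ∑ i, (J *ᵥ v) i ^ 2 ≤ η ^ 2 * ∑ i, v i ^ 2)
    {G : ℝ} (hG0 : 0 ≤ G) (hG : Fintype.card ι * η ^ 4 ≤ G ^ 2)
    {P : Measure (ι → ℝ)}
    (hP : P = (Measure.pi μ).tilted fun β => -(β ⬝ᵥ (J *ᵥ β)) / 2) {m : ι → ℝ}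
    (hm : IsMeanFieldSolution μ J m) (i : ι)
    {f : ℝ → ℝ} (hf : Measurable f) (hF : 0 ≤ F) (hfb : ∀ b, |b| ≤ M → |f b| ≤ F) :
    |(∫ β, f (β i) ∂P) - ∫ b, f b ∂(μ i).tilted fun b => -(J *ᵥ m) i * b| ≤
      4 * F * M * (2 * M + 128 * M ^ 5 * G) * η := by
  have hPp := isProbabilityMeasure_gibbs hμ hP
  have hPb : ∀ᵐ β ∂P, ∀ i, |β i| ≤ M := by rw [hP]; exact ae_tilted (ae_pi_box hμ)
  have hPi : ∀ {g : (ι → ℝ) → ℝ}, Continuous g → Integrable g P := fun hg =>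
    integrable_of_ae_box hPb hg
  set e : ι → ℝ := fun j => ∫ β, β j ∂P with he
  set δ : ι → ℝ := e - m with hδ
  have hmean : ∀ j, ∫ β, (J *ᵥ β) j ∂P = (J *ᵥ e) j := fun j => by
    simp only [Matrix.mulVec, dotProduct]
    rw [integral_finsetSum _ fun k _ => hPi (by fun_prop)]
    simp_rw [integral_const_mul]
    rfl
  have hvar : ∀ j, ∫ β, ((J *ᵥ β) j - (J *ᵥ e) j) ^ 2 ∂P ≤ 4 * M ^ 2 * η ^ 2 := fun j => by
    have h1 := gibbs_variance_le hM hμ hJ hη0 hη1 hη hP (J j)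
    have h2 : J j ⬝ᵥ J j = ∑ k, J j k ^ 2 := by simp [dotProduct, sq]
    rw [h2] at h1
    rw [← hmean j]
    refine h1.trans ?_
    gcongr
    exact row_sq_le hJ hη j
  have hδ1 : ∀ j, |δ j| ≤ 64 * M ^ 5 * η ^ 2 + 4 * M ^ 2 * |(J *ᵥ δ) j| := fun j => by
    set φ : ℝ → ℝ := fun s => ∫ b, b ∂(μ j).tilted fun b => s * b with hφ
    have hφc : Continuous φ :=
      continuous_integral_tilted_mul (hμ j) measurable_id' (F := M) fun b hb => hb
    set a := -(J *ᵥ e) j with ha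
    have e1 : e j = ∫ β, φ (-(J *ᵥ β) j) ∂P :=
      integral_coordinate_gibbs hμ hJ hd hP j measurable_id' (F := M) fun b hb => hb
    set τ := (μ j).tilted fun b => a * b with hτ
    have hτp : IsProbabilityMeasure τ := isProbabilityMeasure_tilted_mul (hμ j) a
    set V := ∫ b, (b - ∫ x, x ∂τ) ^ 2 ∂τ with hV
    -- Taylor expansion of the tilted mean at the average field `a`; the slope `V` is the variance
    -- under the tilt at `a`.
    have hT : ∀ s, |φ s - φ a - (s - a) * V| ≤ 16 * M ^ 3 * (s - a) ^ 2 := fun s => by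
      have h1 := abs_mean_tilted_sub_linear_le hM (ae_tilted (hμ j) : ∀ᵐ b ∂τ, |b| ≤ M) (s - a)
      have h2 : τ.tilted (fun b => (s - a) * b) = (μ j).tilted fun b => s * b := by
        rw [hτ, tilted_tilted (integrable_exp_mul_of_ae_interval (hμ j) a)]
        congr 1; ext b; simp only [Pi.add_apply]; ring
      rw [h2] at h1
      exact h1
    -- The linear term averages to zero since `a` is the mean of the field. The error is therefore
    -- governed by the variance of the field, of order `η²`, and not by its standard deviation.
    have hlin : ∫ β, (φ (-(J *ᵥ β) j) - φ a - (-(J *ᵥ β) j - a) * V) ∂P = e j - φ a := by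
      have hc1 : Continuous fun β : ι → ℝ => φ (-(J *ᵥ β) j) := hφc.comp (by fun_prop)
      have hc2 : Continuous fun β : ι → ℝ => φ (-(J *ᵥ β) j) - φ a := hc1.sub continuous_const
      have hc3 : Continuous fun β : ι → ℝ => (-(J *ᵥ β) j - a) * V := by fun_prop
      rw [integral_sub (hPi hc2) (hPi hc3), integral_sub (hPi hc1) (integrable_const _), integral_mul_const,
        integral_sub (hPi (by fun_prop)) (integrable_const _), integral_neg, hmean j, ← e1]
      simp [ha]
    have hA : |e j - φ a| ≤ 64 * M ^ 5 * η ^ 2 := by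
      rw [← hlin]
      have hc1 : Continuous fun β : ι → ℝ => φ (-(J *ᵥ β) j) := hφc.comp (by fun_prop)
      calc _ ≤ ∫ β, |φ (-(J *ᵥ β) j) - φ a - (-(J *ᵥ β) j - a) * V| ∂P := abs_integral_le_integral_abs
        _ ≤ ∫ β, 16 * M ^ 3 * ((J *ᵥ β) j - (J *ᵥ e) j) ^ 2 ∂P := by
          refine integral_mono (hPi (by fun_prop)) (hPi (by fun_prop)) fun β => ?_
          refine (hT _).trans (le_of_eq ?_)
          simp only [ha]; ring
        _ = 16 * M ^ 3 * ∫ β, ((J *ᵥ β) j - (J *ᵥ e) j) ^ 2 ∂P := integral_const_mul _ _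
        _ ≤ 16 * M ^ 3 * (4 * M ^ 2 * η ^ 2) := by gcongr; exact hvar j
        _ = _ := by ring
    have hB : |φ a - m j| ≤ 4 * M ^ 2 * |(J *ᵥ δ) j| := by
      rw [hm j]
      refine (abs_integral_tilted_mul_sub_le (hμ j) measurable_id' (F := M) (fun b hb => hb)
        _ _).trans (le_of_eq ?_)
      rw [hδ, Matrix.mulVec_sub, Pi.sub_apply, ← abs_neg ((J *ᵥ e) j - _), ha]
      ring_nf
    calc |δ j| = |(e j - φ a) + (φ a - m j)| := by rw [hδ, Pi.sub_apply]; ring_nf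
      _ ≤ _ := abs_add_le _ _
      _ ≤ _ := add_le_add hA hB
  have hS := sum_sq_le_of_fixedPoint_perturbation hM hη2 hη hδ1
  -- Here the bound on `card ι * η ^ 4` is used: per-coordinate errors of order `η²` add up to an
  -- `ℓ²` error bounded by a multiple of `G`.
  have hS2 : ∑ i, δ i ^ 2 ≤ (128 * M ^ 5 * G) ^ 2 := by
    calc _ ≤ _ := hS
      _ = 4 * (64 * M ^ 5) ^ 2 * (Fintype.card ι * η ^ 4) := by ring
      _ ≤ 4 * (64 * M ^ 5) ^ 2 * G ^ 2 := by gcongr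
      _ = _ := by ring
  have hJδ := mulVec_apply_abs_le hη0 hη (by positivity) hS2 i
  set K : ℝ → ℝ := fun s => ∫ b, f b ∂(μ i).tilted fun b => s * b with hK
  have hKc : Continuous K := continuous_integral_tilted_mul (hμ i) hf hfb
  have hKc' : Continuous fun β : ι → ℝ => K (-(J *ᵥ β) i) := hKc.comp (by fun_prop)
  rw [integral_coordinate_gibbs hμ hJ hd hP i hf hfb]
  have e2 : (∫ β, K (-(J *ᵥ β) i) ∂P) - K (-(J *ᵥ m) i) =
      ∫ β, (K (-(J *ᵥ β) i) - K (-(J *ᵥ m) i)) ∂P := by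
    rw [integral_sub (hPi hKc') (integrable_const _)]; simp
  change |(∫ β, K (-(J *ᵥ β) i) ∂P) - K (-(J *ᵥ m) i)| ≤ _
  rw [e2]
  -- Jensen's inequality: the mean absolute fluctuation of the field is at most its standard
  -- deviation.
  have hL1 : ∫ β, |(J *ᵥ β) i - (J *ᵥ e) i| ∂P ≤ 2 * M * η := by
    have h1 : (∫ β, |(J *ᵥ β) i - (J *ᵥ e) i| ∂P) ^ 2 ≤
        ∫ β, ((J *ᵥ β) i - (J *ᵥ e) i) ^ 2 ∂P := by
      set x := ∫ β, |(J *ᵥ β) i - (J *ᵥ e) i| ∂P with hx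
      have h2 : 0 ≤ ∫ β, (|(J *ᵥ β) i - (J *ᵥ e) i| - x) ^ 2 ∂P :=
        integral_nonneg fun β => sq_nonneg _
      have h3 : ∀ β : ι → ℝ, (|(J *ᵥ β) i - (J *ᵥ e) i| - x) ^ 2 =
          x ^ 2 + (-(2 * x)) * |(J *ᵥ β) i - (J *ᵥ e) i| +
            1 * |(J *ᵥ β) i - (J *ᵥ e) i| ^ 2 := fun β => by ring
      simp_rw [h3] at h2
      rw [integral_quadratic (hPi (by fun_prop)) (hPi (by fun_prop)), ← hx] at h2
      simp_rw [sq_abs] at h2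
      linarith
    refine le_of_sq_le_sq ?_ (by positivity)
    calc _ ≤ _ := h1
      _ ≤ _ := hvar i
      _ = _ := by ring
  calc _ ≤ ∫ β, |K (-(J *ᵥ β) i) - K (-(J *ᵥ m) i)| ∂P := abs_integral_le_integral_abs
    _ ≤ ∫ β, 4 * F * M * (|(J *ᵥ β) i - (J *ᵥ e) i| + |(J *ᵥ δ) i|) ∂P := by
      refine integral_mono (hPi (by fun_prop)) (hPi (by fun_prop)) fun β => ?_
      refine (abs_integral_tilted_mul_sub_le (hμ i) hf hfb _ _).trans ?_
      gcongr
      rw [hδ, Matrix.mulVec_sub, Pi.sub_apply]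
      calc _ = |((J *ᵥ β) i - (J *ᵥ e) i) + ((J *ᵥ e) i - (J *ᵥ m) i)| := by
            rw [← abs_neg]; ring_nf
        _ ≤ _ := abs_add_le _ _
    _ = 4 * F * M * ((∫ β, |(J *ᵥ β) i - (J *ᵥ e) i| ∂P) + |(J *ᵥ δ) i|) := by
      rw [integral_const_mul, integral_add (hPi (by fun_prop)) (integrable_const _)]; simp
    _ ≤ 4 * F * M * (2 * M * η + η * (128 * M ^ 5 * G)) := by gcongr
    _ = _ := by ring

/-- Stability of the solution of the mean-field equations under a change of base measures. -/
theorem meanField_stability (hM : 0 < M) (hμ : ∀ i, ∀ᵐ b ∂μ i, |b| ≤ M)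
    (hη0 : 0 ≤ η) (hη2 : 64 * M ^ 4 * η ^ 2 ≤ 1)
    (hη : ∀ v : ι → ℝ, ∑ i, (J *ᵥ v) i ^ 2 ≤ η ^ 2 * ∑ i, v i ^ 2)
    {u : ℝ → ℝ} {Δ : ℝ} (hΔ : 0 ≤ Δ) (hu : ∀ i, AEMeasurable u (μ i))
    (hub : ∀ i, ∀ᵐ b ∂μ i, |u b| ≤ Δ) {μ' : ι → Measure ℝ}
    (hμ' : ∀ i, μ' i = (μ i).tilted u) {m m' : ι → ℝ}
    (hm : IsMeanFieldSolution μ J m) (hm' : IsMeanFieldSolution μ' J m') (i : ι)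
    {f : ℝ → ℝ} (hf : Measurable f) (hF : 0 ≤ F) (hfb : ∀ b, |b| ≤ M → |f b| ≤ F) :
    |(∫ b, f b ∂(μ' i).tilted fun b => -(J *ᵥ m') i * b) -
        ∫ b, f b ∂(μ i).tilted fun b => -(J *ᵥ m) i * b| ≤
      4 * F * (8 * M ^ 2 * η * Real.sqrt (Fintype.card ι) + 1) * Δ := by
  have key : ∀ (j : ι) {F : ℝ} {f : ℝ → ℝ} (_ : Measurable f) (_ : ∀ b, |b| ≤ M → |f b| ≤ F),
      |(∫ b, f b ∂(μ' j).tilted fun b => -(J *ᵥ m') j * b) -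
        ∫ b, f b ∂(μ j).tilted fun b => -(J *ᵥ m) j * b| ≤
      4 * F * (M * |(J *ᵥ (m' - m)) j| + Δ) := by
    intro j F f hf hfb
    have hei : Integrable (fun x => Real.exp (u x)) (μ j) := by
      refine Integrable.of_bound (hu j).exp.aestronglyMeasurable (Real.exp Δ) ?_
      filter_upwards [hub j] with x hx
      rw [Real.norm_eq_abs, abs_of_pos (Real.exp_pos _)]
      exact Real.exp_le_exp.2 ((le_abs_self _).trans hx)
    have hpr := isProbabilityMeasure_tilted_mul (hμ j) (-(J *ᵥ m) j)
    -- The change of base measure and the change of local field combine into one bounded tilt of the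
    -- unperturbed one-site law.
    have h1 : (μ' j).tilted (fun b => -(J *ᵥ m') j * b) =
        ((μ j).tilted fun b => -(J *ᵥ m) j * b).tilted
          fun b => u b + (-(J *ᵥ (m' - m)) j) * b := by
      rw [hμ', tilted_tilted hei, tilted_tilted (integrable_exp_mul_of_ae_interval (hμ j) _)]
      congr 1; ext b
      simp only [Pi.add_apply, Matrix.mulVec_sub, Pi.sub_apply]; ring
    rw [h1]
    have hac := tilted_absolutelyContinuous (μ j) fun b => -(J *ᵥ m) j * b
    have hb : ∀ᵐ b ∂((μ j).tilted fun b => -(J *ᵥ m) j * b), |b| ≤ M := ae_tilted (hμ j)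
    refine abs_integral_tilted_sub_le (((hu j).mono_ac hac).add (by fun_prop)) ?_
      hf.aestronglyMeasurable (hb.mono hfb)
    filter_upwards [hb, hac.ae_le (hub j)] with b hb1 hb2
    refine (abs_add_le _ _).trans ?_
    rw [abs_mul, abs_neg]
    have : |(J *ᵥ (m' - m)) j| * |b| ≤ |(J *ᵥ (m' - m)) j| * M := by gcongr
    linarith
  have hδ : ∀ j, |(m' - m) j| ≤ 4 * M * Δ + 4 * M ^ 2 * |(J *ᵥ (m' - m)) j| := fun j => by
    have := key j measurable_id' (F := M) fun b hb => hb
    rw [← hm j, ← hm' j] at this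
    refine this.trans (le_of_eq (by ring))
  have hS := sum_sq_le_of_fixedPoint_perturbation hM hη2 hη hδ
  have hS2 : ∑ i, (m' - m) i ^ 2 ≤ (8 * M * Real.sqrt (Fintype.card ι) * Δ) ^ 2 := by
    have hs : Real.sqrt (Fintype.card ι) ^ 2 = Fintype.card ι := Real.sq_sqrt (Nat.cast_nonneg _)
    refine hS.trans (le_of_eq ?_)
    linear_combination (-(64 * M ^ 2 * Δ ^ 2)) * hs
  have hJδ := mulVec_apply_abs_le hη0 hη (by positivity) hS2 i
  refine (key i hf hfb).trans ?_
  calc _ ≤ 4 * F * (M * (η * (8 * M * Real.sqrt (Fintype.card ι) * Δ)) + Δ) := by gcongr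
    _ = _ := by ring

end Gibbs

open InformationTheory

/-! ### Entropy and the variational problem -/

section KL

variable {α : Type*} [MeasurableSpace α] {Q ν : Measure α} [IsProbabilityMeasure Q]
  [IsProbabilityMeasure ν] {g : α → ℝ}

theorem klDiv_tilted_right (h : klDiv Q ν ≠ ⊤) (hQ : Integrable g Q)
    (hν : Integrable (fun x => Real.exp (g x)) ν) :
    klDiv Q (ν.tilted g) ≠ ⊤ ∧ (klDiv Q (ν.tilted g)).toReal =
      (klDiv Q ν).toReal - (∫ x, g x ∂Q) + Real.log (∫ x, Real.exp (g x) ∂ν) := by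
  have := isProbabilityMeasure_tilted hν
  obtain ⟨h1, h2⟩ := klDiv_ne_top_iff.1 h
  have h3 : Q ≪ ν.tilted g := h1.trans (absolutelyContinuous_tilted hν)
  refine ⟨klDiv_ne_top h3 (integrable_llr_tilted_right h1 hQ h2 hν), ?_⟩
  rw [toReal_klDiv_of_measure_eq h3 (by simp), toReal_klDiv_of_measure_eq h1 (by simp),
    integral_llr_tilted_right h1 hQ hν h2]

/-- The Donsker–Varadhan inequality. -/
theorem integral_sub_log_le_klDiv (h : klDiv Q ν ≠ ⊤) (hQ : Integrable g Q)
    (hν : Integrable (fun x => Real.exp (g x)) ν) :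
    (∫ x, g x ∂Q) - Real.log (∫ x, Real.exp (g x) ∂ν) ≤ (klDiv Q ν).toReal := by
  have h1 := (klDiv_tilted_right h hQ hν).2
  have h2 : 0 ≤ (klDiv Q (ν.tilted g)).toReal := ENNReal.toReal_nonneg
  linarith

/-- Tilting by `-g` undoes the tilt by `g`, so finiteness of the divergence passes back. -/
theorem klDiv_ne_top_of_tilted (h : klDiv Q (ν.tilted g) ≠ ⊤) (hQ : Integrable g Q)
    (hν : Integrable (fun x => Real.exp (g x)) ν) : klDiv Q ν ≠ ⊤ := by
  have := isProbabilityMeasure_tilted hν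
  have h1 := (klDiv_tilted_right (g := -g) h hQ.neg (by
    rw [integrable_tilted_iff hν]
    refine (integrable_const (1 : ℝ)).congr (ae_of_all _ fun x => ?_)
    simp [← Real.exp_add])).1
  rwa [tilted_neg_same hν] at h1

end KL

variable {ι : Type*} [Fintype ι] {M η : ℝ} {J : Matrix ι ι ℝ}

theorem integral_centered_mul {q : ι → Measure ℝ} [∀ i, IsProbabilityMeasure (q i)]
    (hq : ∀ i, ∀ᵐ b ∂q i, |b| ≤ M) (m : ι → ℝ) {i j : ι} (hij : i ≠ j) :
    ∫ β, (β i - m i) * (β j - m j) ∂Measure.pi q =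
      ((∫ b, b ∂q i) - m i) * ((∫ b, b ∂q j) - m j) := by
  have hind : iIndepFun (fun i (β : ι → ℝ) => β i - m i) (Measure.pi q) :=
    iIndepFun_pi (X := fun i b => b - m i) (μ := q) fun i => by fun_prop
  rw [(hind.indepFun hij).integral_fun_mul_eq_mul_integral
    (Continuous.aestronglyMeasurable (by fun_prop))
    (Continuous.aestronglyMeasurable (by fun_prop))]
  have h1 : ∀ k, ∫ β : ι → ℝ, (β k - m k) ∂Measure.pi q = (∫ b, b ∂q k) - m k := fun k => by
    rw [integral_comp_eval (μ := q) (i := k) (f := fun b => b - m k) (by fun_prop),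
      integral_sub (integrable_of_ae_interval (hq k) continuous_id') (integrable_const _)]
    simp
  rw [h1, h1]

/-- Independence factorizes every off-diagonal term, and there are no diagonal terms. Thus on
product measures the interaction energy depends on the means alone. -/
theorem integral_centered_quadratic {q : ι → Measure ℝ} [∀ i, IsProbabilityMeasure (q i)]
    (hq : ∀ i, ∀ᵐ b ∂q i, |b| ≤ M) (hd : ∀ i, J i i = 0) (m : ι → ℝ) :
    ∫ β, (β - m) ⬝ᵥ (J *ᵥ (β - m)) ∂Measure.pi q =
      ((fun i => ∫ b, b ∂q i) - m) ⬝ᵥ (J *ᵥ ((fun i => ∫ b, b ∂q i) - m)) := by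
  have hi : ∀ {g : (ι → ℝ) → ℝ}, Continuous g → Integrable g (Measure.pi q) := fun hg =>
    integrable_of_ae_box (ae_pi_box hq) hg
  simp only [Matrix.mulVec, dotProduct, Finset.mul_sum, Pi.sub_apply]
  rw [integral_finsetSum _ fun k _ => hi (by fun_prop)]
  refine Finset.sum_congr rfl fun i _ => ?_
  rw [integral_finsetSum _ fun k _ => hi (by fun_prop)]
  refine Finset.sum_congr rfl fun j _ => ?_
  by_cases hij : i = j
  · subst hij; simp [hd]
  · have e : ∀ β : ι → ℝ, (β i - m i) * (J i j * (β j - m j)) =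
        J i j * ((β i - m i) * (β j - m j)) := fun β => by ring
    simp_rw [e]
    rw [integral_const_mul, integral_centered_mul hq m hij]
    ring

/-- Transport-entropy inequality for the means of a measure relative to a product measure of bounded
coordinates. -/
theorem sum_sq_mean_sub_le_klDiv {q : ι → Measure ℝ} [∀ i, IsProbabilityMeasure (q i)]
    (hM : 0 < M) (hq : ∀ i, ∀ᵐ b ∂q i, |b| ≤ M) {Q : Measure (ι → ℝ)} [IsProbabilityMeasure Q]
    (hQ : ∀ᵐ β ∂Q, ∀ i, |β i| ≤ M) (h : klDiv Q (Measure.pi q) ≠ ⊤) :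
    ∑ i, ((∫ β, β i ∂Q) - ∫ b, b ∂q i) ^ 2 ≤ 2 * M ^ 2 * (klDiv Q (Measure.pi q)).toReal := by
  set d : ι → ℝ := fun i => (∫ β, β i ∂Q) - ∫ b, b ∂q i with hd
  have hQi : ∀ {g : (ι → ℝ) → ℝ}, Continuous g → Integrable g Q := fun hg =>
    integrable_of_ae_box hQ hg
  -- Donsker–Varadhan with a linear test function; the slopes `d i / M ^ 2` maximize `d i * t - M ^
  -- 2 * t ^ 2 / 2`, the bound left by Hoeffding's lemma.
  have h1 := integral_sub_log_le_klDiv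
    (g := fun β => ∑ i, d i / M ^ 2 * (β i - ∫ b, b ∂q i)) h (hQi (by fun_prop))
    (integrable_of_ae_box (ae_pi_box hq) (by fun_prop))
  have h2 : ∫ β, ∑ i, d i / M ^ 2 * (β i - ∫ b, b ∂q i) ∂Q = (∑ i, d i ^ 2) / M ^ 2 := by
    rw [integral_finsetSum _ fun k _ => hQi (by fun_prop), Finset.sum_div]
    refine Finset.sum_congr rfl fun i _ => ?_
    rw [integral_const_mul, integral_sub (hQi (by fun_prop)) (integrable_const _)]
    simp only [integral_const, probReal_univ, one_smul]
    change d i / M ^ 2 * d i = _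
    ring
  have h3 : ∫ β, Real.exp (∑ i, d i / M ^ 2 * (β i - ∫ b, b ∂q i)) ∂Measure.pi q ≤
      Real.exp ((∑ i, d i ^ 2) / (2 * M ^ 2)) := by
    simp_rw [Real.exp_sum]
    rw [integral_fintype_prod_eq_prod
      (f := fun i b => Real.exp (d i / M ^ 2 * (b - ∫ b, b ∂q i))), Finset.sum_div, Real.exp_sum]
    refine Finset.prod_le_prod (fun i _ => integral_nonneg fun b => (Real.exp_pos _).le)
      fun i _ => ?_
    refine (integral_exp_mul_sub_mean_le hM.le (hq i) _).trans (le_of_eq ?_)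
    congr 1; field_simp
  have h4 : Real.log (∫ β, Real.exp (∑ i, d i / M ^ 2 * (β i - ∫ b, b ∂q i)) ∂Measure.pi q) ≤
      (∑ i, d i ^ 2) / (2 * M ^ 2) := by
    rw [← Real.log_exp ((∑ i, d i ^ 2) / (2 * M ^ 2))]
    refine Real.log_le_log ?_ h3
    exact integral_exp_pos (integrable_of_ae_box (ae_pi_box hq) (by fun_prop))
  rw [h2] at h1
  have h5 : (∑ i, d i ^ 2) / (2 * M ^ 2) ≤ (klDiv Q (Measure.pi q)).toReal := by
    have : (∑ i, d i ^ 2) / M ^ 2 = 2 * ((∑ i, d i ^ 2) / (2 * M ^ 2)) := by field_simp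
    linarith
  rw [div_le_iff₀ (by positivity)] at h5
  linarith

variable {μ : ι → Measure ℝ} [∀ i, IsProbabilityMeasure (μ i)]

/-- Banach's fixed point theorem. The one-site map has Lipschitz constant `4 M²` and `4 M² η ≤ 1 /
2`; the Euclidean norm is used because `J` is small as an `ℓ²` operator. -/
theorem exists_isMeanFieldSolution (hM : 0 < M) (hμ : ∀ i, ∀ᵐ b ∂μ i, |b| ≤ M)
    (hη2 : 64 * M ^ 4 * η ^ 2 ≤ 1)
    (hη : ∀ v : ι → ℝ, ∑ i, (J *ᵥ v) i ^ 2 ≤ η ^ 2 * ∑ i, v i ^ 2) :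
    ∃ m, IsMeanFieldSolution μ J m := by
  set T : EuclideanSpace ℝ ι → EuclideanSpace ℝ ι := fun x =>
    WithLp.toLp 2 fun i => ∫ b, b ∂(μ i).tilted fun b => -(J *ᵥ x.ofLp) i * b with hT
  have hc : ContractingWith (1 / 2) T := by
    refine ⟨by norm_num, LipschitzWith.of_dist_le_mul fun x y => ?_⟩
    have hco : ∀ i, (T x i - T y i) ^ 2 ≤ 16 * M ^ 4 * (J *ᵥ (x.ofLp - y.ofLp)) i ^ 2 := fun i => by
      have := abs_integral_tilted_mul_sub_le (hμ i) measurable_id' (F := M) (fun b hb => hb)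
        (-(J *ᵥ x.ofLp) i) (-(J *ᵥ y.ofLp) i)
      have h1 : |T x i - T y i| ≤ 4 * M ^ 2 * |(J *ᵥ (x.ofLp - y.ofLp)) i| := by
        refine this.trans (le_of_eq ?_)
        rw [Matrix.mulVec_sub, Pi.sub_apply, ← abs_neg ((J *ᵥ x.ofLp) i - _)]
        ring_nf
      calc _ = |T x i - T y i| ^ 2 := (sq_abs _).symm
        _ ≤ (4 * M ^ 2 * |(J *ᵥ (x.ofLp - y.ofLp)) i|) ^ 2 := by gcongr
        _ = _ := by rw [mul_pow, sq_abs]; ring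
    refine le_of_sq_le_sq ?_ (by positivity)
    rw [dist_eq_norm, dist_eq_norm, mul_pow, EuclideanSpace.real_norm_sq_eq,
      EuclideanSpace.real_norm_sq_eq]
    calc _ ≤ ∑ i, 16 * M ^ 4 * (J *ᵥ (x.ofLp - y.ofLp)) i ^ 2 :=
          Finset.sum_le_sum fun i _ => hco i
      _ ≤ 16 * M ^ 4 * (η ^ 2 * ∑ i, (x.ofLp - y.ofLp) i ^ 2) := by
        rw [← Finset.mul_sum]; gcongr; exact hη _
      _ = (64 * M ^ 4 * η ^ 2) * ((1 / 4) * ∑ i, (x.ofLp - y.ofLp) i ^ 2) := by ring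
      _ ≤ 1 * ((1 / 4) * ∑ i, (x.ofLp - y.ofLp) i ^ 2) := by gcongr
      _ = _ := by norm_num
  refine ⟨(hc.fixedPoint T).ofLp, fun i => ?_⟩
  have h := hc.fixedPoint_isFixedPt
  exact (congrArg (fun z : EuclideanSpace ℝ ι => z i) h).symm

/-- Expand the quadratic form about `m`: the cross terms are the one-site tilts by the mean field,
and the constant disappears in the normalization. For a mean-field solution the remaining
interaction has no first-order effect at the product measure. -/
theorem gibbs_eq_tilted_meanField (hμ : ∀ i, ∀ᵐ b ∂μ i, |b| ≤ M) (hJ : J.IsSymm)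
    {P : Measure (ι → ℝ)}
    (hP : P = (Measure.pi μ).tilted fun β => -(β ⬝ᵥ (J *ᵥ β)) / 2) (m : ι → ℝ) :
    P = (Measure.pi fun i => (μ i).tilted fun b => -(J *ᵥ m) i * b).tilted
      fun β => -((β - m) ⬝ᵥ (J *ᵥ (β - m))) / 2 := by
  rw [pi_tilted μ _ fun i => integrable_exp_mul_of_ae_interval (hμ i) _, tilted_tilted
    (integrable_of_ae_box (ae_pi_box hμ) (by fun_prop)), hP,
    ← tilted_add_const _ _ (integrable_of_ae_box (ae_pi_box hμ) (by fun_prop))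
      (-(m ⬝ᵥ (J *ᵥ m)) / 2)]
  congr 1
  ext β
  have h1 : m ⬝ᵥ (J *ᵥ β) = β ⬝ᵥ (J *ᵥ m) := by
    rw [Matrix.dotProduct_mulVec, ← Matrix.mulVec_transpose, hJ.eq, dotProduct_comm]
  have h2 : ∑ i, -(J *ᵥ m) i * β i = -(β ⬝ᵥ (J *ᵥ m)) := by
    rw [dotProduct, ← Finset.sum_neg_distrib]
    exact Finset.sum_congr rfl fun i _ => by ring
  rw [Pi.add_apply, h2, Matrix.mulVec_sub, sub_dotProduct, dotProduct_sub, dotProduct_sub, h1]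
  ring

/-- The mean-field solution is the unique minimizer of the Kullback–Leibler divergence to the Gibbs
measure among product measures. -/
theorem meanField_isMinimizer (hM : 0 < M) (hμ : ∀ i, ∀ᵐ b ∂μ i, |b| ≤ M)
    (hJ : J.IsSymm) (hd : ∀ i, J i i = 0) (hη0 : 0 ≤ η) (hη1 : 4 * M ^ 2 * η ≤ 1)
    (hη : ∀ v : ι → ℝ, ∑ i, (J *ᵥ v) i ^ 2 ≤ η ^ 2 * ∑ i, v i ^ 2)
    {P : Measure (ι → ℝ)}
    (hP : P = (Measure.pi μ).tilted fun β => -(β ⬝ᵥ (J *ᵥ β)) / 2) {m : ι → ℝ}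
    (hm : IsMeanFieldSolution μ J m) {Q : ι → Measure ℝ} [∀ i, IsProbabilityMeasure (Q i)]
    (hQ : ∀ i, ∀ᵐ b ∂Q i, |b| ≤ M) :
    klDiv (Measure.pi fun i => (μ i).tilted fun b => -(J *ᵥ m) i * b) P ≤
        klDiv (Measure.pi Q) P ∧
      (klDiv (Measure.pi Q) P ≤
          klDiv (Measure.pi fun i => (μ i).tilted fun b => -(J *ᵥ m) i * b) P →
        Measure.pi Q = Measure.pi fun i => (μ i).tilted fun b => -(J *ᵥ m) i * b) := by
  have hqp : ∀ i, IsProbabilityMeasure ((μ i).tilted fun b => -(J *ᵥ m) i * b) := fun i =>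
    isProbabilityMeasure_tilted_mul (hμ i) _
  have hqb : ∀ i, ∀ᵐ b ∂(μ i).tilted fun b => -(J *ᵥ m) i * b, |b| ≤ M := fun i =>
    ae_tilted (hμ i)
  have hPeq := gibbs_eq_tilted_meanField hμ hJ hP m
  set q : ι → Measure ℝ := fun i => (μ i).tilted fun b => -(J *ᵥ m) i * b with hq
  set ν := Measure.pi q with hν
  set g : (ι → ℝ) → ℝ := fun β => -((β - m) ⬝ᵥ (J *ᵥ (β - m))) / 2 with hg
  have hgc : Continuous g := by fun_prop
  have hgν : Integrable g ν := integrable_of_ae_box (ae_pi_box hqb) hgc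
  have hge : Integrable (fun β => Real.exp (g β)) ν :=
    integrable_of_ae_box (ae_pi_box hqb) (by fun_prop)
  have hgQ : Integrable g (Measure.pi Q) := integrable_of_ae_box (ae_pi_box hQ) hgc
  obtain ⟨h1, h2⟩ := klDiv_tilted_right (Q := ν) (by rw [klDiv_self]; simp) hgν hge
  rw [← hPeq] at h1 h2
  have hgint : ∀ (ρ : ι → Measure ℝ) [∀ i, IsProbabilityMeasure (ρ i)]
      (_ : ∀ i, ∀ᵐ b ∂ρ i, |b| ≤ M), ∫ β, g β ∂Measure.pi ρ =
        -(((fun i => ∫ b, b ∂ρ i) - m) ⬝ᵥ (J *ᵥ ((fun i => ∫ b, b ∂ρ i) - m))) / 2 := by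
    intro ρ _ hρ
    simp only [hg]
    rw [integral_div, integral_neg, integral_centered_quadratic hρ hd]
  have hzero : ∫ β, g β ∂ν = 0 := by
    rw [hgint q hqb]
    have : (fun i => ∫ b, b ∂q i) - m = 0 := by
      ext i; rw [Pi.sub_apply, hm i]; simp [hq]
    rw [this]; simp
  rw [klDiv_self, hzero] at h2
  rcases eq_or_ne (klDiv (Measure.pi Q) P) ⊤ with htop | htop
  · rw [htop]
    exact ⟨le_top, fun h => absurd (top_le_iff.1 h) h1⟩
  have h3 : klDiv (Measure.pi Q) ν ≠ ⊤ :=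
    klDiv_ne_top_of_tilted (by rwa [← hPeq]) hgQ hge
  obtain ⟨-, h4⟩ := klDiv_tilted_right h3 hgQ hge
  rw [← hPeq, hgint Q hQ] at h4
  have h5 := sum_sq_mean_sub_le_klDiv hM hqb (ae_pi_box hQ) h3
  have h6 : ∀ i, ∫ β : ι → ℝ, β i ∂Measure.pi Q = ∫ b, b ∂Q i := fun i =>
    integral_comp_eval (μ := Q) (i := i) (f := fun b => b) (by fun_prop)
  set d : ι → ℝ := (fun i => ∫ b, b ∂Q i) - m with hdd
  set k := (klDiv (Measure.pi Q) ν).toReal with hk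
  have hk0 : 0 ≤ k := ENNReal.toReal_nonneg
  replace h5 : ∑ i, d i ^ 2 ≤ 2 * M ^ 2 * k := by
    refine le_trans (le_of_eq (Finset.sum_congr rfl fun i _ => ?_)) h5
    rw [h6 i]
    change ((∫ b, b ∂Q i) - m i) ^ 2 = _
    rw [hm i]
  -- The transport-entropy bound `‖d‖² ≤ 2 M² k` makes the possibly negative interaction energy
  -- smaller than the relative entropy `k`. The remaining multiple of `k` gives minimality, and
  -- uniqueness because `k` must vanish at another minimizer.
  have h8 : |d ⬝ᵥ (J *ᵥ d)| ≤ k / 2 := by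
    calc _ ≤ η * ∑ i, d i ^ 2 := abs_dotProduct_mulVec_le hη0 hη d
      _ ≤ η * (2 * M ^ 2 * k) := by gcongr
      _ = (4 * M ^ 2 * η) * (k / 2) := by ring
      _ ≤ 1 * (k / 2) := by gcongr
      _ = _ := one_mul _
  have h9 : (klDiv ν P).toReal + k / 2 ≤ (klDiv (Measure.pi Q) P).toReal := by
    rw [h2, h4]
    simp only [ENNReal.toReal_zero]
    linarith [neg_abs_le (d ⬝ᵥ (J *ᵥ d))]
  refine ⟨(ENNReal.toReal_le_toReal h1 htop).1 (by linarith), fun hle => ?_⟩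
  have h10 := ENNReal.toReal_mono h1 hle
  have h11 : k = 0 := by linarith
  rcases (ENNReal.toReal_eq_zero_iff _).1 h11 with h12 | h12
  · exact klDiv_eq_zero_iff.1 h12
  · exact absurd h12 h3

end VEB

namespace VEB

/-! ### Uniform bounds for random quadratic forms -/

section Averaging

variable {Ω E : Type*} [MeasurableSpace Ω] [NormedAddCommGroup E] [InnerProductSpace ℝ E]
  [FiniteDimensional ℝ E] [MeasurableSpace E] [BorelSpace E]

open Metric in
/-- If a quadratic form is larger than `(16 / 15) s ‖u‖²` somewhere, then it is larger than `s` on a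
large part of the ball of radius `5 / 4`. -/
theorem volume_ball_le_of_quadratic {w : E → ℝ} (hc : Continuous w)
    (hs : ∀ (c : ℝ) u, w (c • u) = c ^ 2 * w u)
    (hp : ∀ x y, w (x + y) + w (x - y) = 2 * w x + 2 * w y) {s : ℝ}
    {u₀ : E} (hu₀ : 16 / 15 * s * ‖u₀‖ ^ 2 < |w u₀|) :
    volume (ball (0 : E) (1 / 4)) ≤ 2 * volume {u : E | u ∈ ball 0 (5 / 4) ∧ s ≤ |w u|} := by
  have hw0 : w 0 = 0 := by have := hs 0 0; simpa using this
  have hu0 : u₀ ≠ 0 := by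
    rintro rfl
    simp [hw0] at hu₀
  have hne : (sphere (0 : E) 1).Nonempty :=
    ⟨‖u₀‖⁻¹ • u₀, by simp [norm_smul, hu0]⟩
  obtain ⟨v, hv, hmax⟩ := (isCompact_sphere (0 : E) 1).exists_isMaxOn hne hc.abs.continuousOn
  have hv1 : ‖v‖ = 1 := by simpa using hv
  have hN : ∀ h : E, |w h| ≤ |w v| * ‖h‖ ^ 2 := fun h => by
    rcases eq_or_ne h 0 with rfl | hh
    · simp [hw0]
    · have h1 : |w (‖h‖⁻¹ • h)| ≤ |w v| := hmax (by simp [norm_smul, hh])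
      have h2 : 0 < ‖h‖ := norm_pos_iff.2 hh
      rw [hs, abs_mul, abs_of_nonneg (sq_nonneg _), inv_pow, inv_mul_le_iff₀ (by positivity)] at h1
      linarith
  have hbig : 16 / 15 * s < |w v| := by
    have h1 := hu₀.trans_le (hN u₀)
    exact lt_of_mul_lt_mul_right h1 (sq_nonneg _)
  set G := {u : E | u ∈ ball 0 (5 / 4) ∧ s ≤ |w u|} with hG
  have hGm : MeasurableSet G :=
    measurableSet_ball.inter (measurableSet_le measurable_const hc.abs.measurable)
  -- For `‖h‖ < 1/4` the parallelogram law at the maximizer `v` gives `|w (v + h)| + |w (v - h)| ≥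
  -- (15/8) |w v| > 2 s`. So of each pair of points symmetric about `v`, at least one lies in `G`.
  have hsub : ball v (1 / 4) ⊆ G ∪ (fun u => (2 : ℝ) • v - u) ⁻¹' G := by
    intro u hu
    set h := u - v with hh
    have hhn : ‖h‖ < 1 / 4 := by simpa [dist_eq_norm] using hu
    have e1 : u = v + h := by rw [hh]; abel
    have e2 : (2 : ℝ) • v - u = v - h := by rw [hh, two_smul]; abel
    have n1 : ‖v + h‖ < 5 / 4 := by linarith [norm_add_le v h]
    have n2 : ‖v - h‖ < 5 / 4 := by linarith [norm_sub_le v h]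
    have hh2 : |w h| ≤ |w v| * (1 / 16) := by
      refine (hN h).trans ?_
      gcongr
      nlinarith [norm_nonneg h]
    have h3 : 2 * |w v| - 2 * |w h| ≤ |w (v + h)| + |w (v - h)| := by
      have h4 := hp v h
      have h5 : |w (v + h) + w (v - h)| ≤ _ := abs_add_le _ _
      have h6 : |2 * w v| ≤ |2 * w v + 2 * w h| + |2 * w h| := by
        calc |2 * w v| = |(2 * w v + 2 * w h) - 2 * w h| := by ring_nf
          _ ≤ _ := abs_sub _ _
      rw [abs_mul, abs_mul, abs_of_pos (by norm_num : (0 : ℝ) < 2), ← h4] at h6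
      linarith
    by_cases h7 : s ≤ |w (v + h)|
    · left
      rw [e1]
      exact ⟨by simpa using n1, h7⟩
    · right
      simp only [Set.mem_preimage]
      rw [e2]
      exact ⟨by simpa using n2, by push Not at h7; linarith⟩
  calc volume (ball (0 : E) (1 / 4)) = volume (ball v (1 / 4)) :=
        (Measure.addHaar_ball_center volume v _).symm
    _ ≤ volume G + volume ((fun u => (2 : ℝ) • v - u) ⁻¹' G) :=
      (measure_mono hsub).trans (measure_union_le _ _)
    _ = 2 * volume G := by
      have hmp : MeasurePreserving (fun u : E => (2 : ℝ) • v - u) volume volume :=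
        Measure.measurePreserving_sub_left volume ((2 : ℝ) • v)
      rw [hmp.measure_preimage hGm.nullMeasurableSet, two_mul]

open Metric in
/-- A uniform bound for a random quadratic form from tail bounds in each direction. -/
theorem measure_exists_quadratic_gt_le {P : Measure Ω} [IsProbabilityMeasure P] {w : Ω → E → ℝ}
    (hm : Measurable (Function.uncurry w)) (hc : ∀ ω, Continuous (w ω))
    (hs : ∀ ω (c : ℝ) u, w ω (c • u) = c ^ 2 * w ω u)
    (hp : ∀ ω x y, w ω (x + y) + w ω (x - y) = 2 * w ω x + 2 * w ω y) {s : ℝ}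
    {q : ℝ≥0∞} (hq : ∀ u : E, ‖u‖ ≤ 5 / 4 → P {ω | s ≤ |w ω u|} ≤ q) :
    P {ω | ∃ u, 16 / 15 * s * ‖u‖ ^ 2 < |w ω u|} ≤
      2 * 5 ^ Module.finrank ℝ E * q := by
  -- Fubini bounds the expected volume of the bad directions by the directional tail, and Markov's
  -- inequality bounds the chance of a large volume. The ratio of the radii `5/4` and `1/4` produces
  -- the factor `5 ^ finrank`.
  set A : Set (Ω × E) := {z | z.2 ∈ ball 0 (5 / 4) ∧ s ≤ |w z.1 z.2|} with hA
  have hAm : MeasurableSet A :=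
    (measurableSet_ball.preimage measurable_snd).inter
      (measurableSet_le measurable_const hm.abs)
  set L : Ω → ℝ≥0∞ := fun ω => volume (Prod.mk ω ⁻¹' A) with hL
  have hLm : Measurable L := measurable_measure_prodMk_left hAm
  set V := volume (ball (0 : E) (1 / 4)) with hV
  have hV0 : V ≠ 0 := (measure_ball_pos _ _ (by norm_num)).ne'
  have hVt : V ≠ ⊤ := measure_ball_lt_top.ne
  have h1 : P {ω | ∃ u, 16 / 15 * s * ‖u‖ ^ 2 < |w ω u|} ≤ P {ω | V ≤ 2 * L ω} := by
    refine measure_mono fun ω hω => ?_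
    obtain ⟨u, hu⟩ := hω
    exact volume_ball_le_of_quadratic (hc ω) (hs ω) (hp ω) hu
  have h2 : V * P {ω | V ≤ 2 * L ω} ≤ ∫⁻ ω, 2 * L ω ∂P :=
    mul_meas_ge_le_lintegral (hLm.const_mul 2) V
  have h3 : ∫⁻ ω, L ω ∂P ≤ volume (ball (0 : E) (5 / 4)) * q := by
    have e1 : ∫⁻ ω, L ω ∂P = (P.prod volume) A := (Measure.prod_apply hAm).symm
    rw [e1, Measure.prod_apply_symm hAm]
    calc _ ≤ ∫⁻ u, (ball (0 : E) (5 / 4)).indicator (fun _ => q) u := by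
          refine lintegral_mono fun u => ?_
          by_cases hu : u ∈ ball (0 : E) (5 / 4)
          · rw [Set.indicator_of_mem hu]
            refine le_trans (measure_mono fun ω hω => hω.2) (hq u ?_)
            exact (by simpa using hu : ‖u‖ < 5 / 4).le
          · rw [Set.indicator_of_notMem hu]
            refine le_of_eq ?_
            have : (fun x : Ω => (x, u)) ⁻¹' A = ∅ := by
              ext ω
              simp only [Set.mem_preimage, Set.mem_empty_iff_false, iff_false]
              exact fun h => hu h.1
            simp [this]
      _ = q * volume (ball (0 : E) (5 / 4)) := by
        rw [lintegral_indicator measurableSet_ball, setLIntegral_const]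
      _ = _ := mul_comm _ _
  have h4 : volume (ball (0 : E) (5 / 4)) = 5 ^ Module.finrank ℝ E * V := by
    have := Measure.addHaar_ball_mul_of_pos (volume : Measure E) 0 (r := 5) (by norm_num) (1 / 4)
    rw [show (5 : ℝ) * (1 / 4) = 5 / 4 by norm_num] at this
    rw [this, ENNReal.ofReal_pow (by norm_num)]
    norm_num
    rfl
  rw [lintegral_const_mul _ hLm] at h2
  have h5 : V * P {ω | V ≤ 2 * L ω} ≤ V * (2 * 5 ^ Module.finrank ℝ E * q) := by
    refine h2.trans ?_
    calc _ ≤ 2 * (volume (ball (0 : E) (5 / 4)) * q) := by gcongr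
      _ = _ := by rw [h4]; ring
  exact h1.trans ((ENNReal.mul_le_mul_iff_right hV0 hVt).1 h5)

end Averaging

/-! ### Squares of sub-Gaussian variables -/

theorem integrable_exp_gaussian_linear (x : ℝ) :
    Integrable fun z : ℝ => Real.exp (-z ^ 2 / 2 + z * x) := by
  by_contra h
  have h1 := integral_undef h
  rw [integral_exp_gaussian_linear] at h1
  have : 0 < Real.sqrt (2 * Real.pi) * Real.exp (x ^ 2 / 2) :=
    mul_pos (Real.sqrt_pos.2 (by positivity)) (Real.exp_pos _)
  linarith

section SubExponential

variable {Ω : Type*} [MeasurableSpace Ω] {ρ : Measure Ω} [IsProbabilityMeasure ρ] {Y : Ω → ℝ}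
  {κ : ℝ}

/-- Gaussian linearization writes `exp (Y² / (4κ))` as an average of `exp (z r Y)` with `r² = 1 /
(2κ)`. The sub-Gaussian bound consumes only half of the Gaussian weight in `z`. -/
theorem lintegral_exp_sq_le (hY : Measurable Y) (hκ : 0 < κ)
    (hi : ∀ s, Integrable (fun ω => Real.exp (s * Y ω)) ρ)
    (hs : ∀ s, ∫ ω, Real.exp (s * Y ω) ∂ρ ≤ Real.exp (κ * s ^ 2 / 2)) :
    ∫⁻ ω, ENNReal.ofReal (Real.exp (1 / (4 * κ) * Y ω ^ 2)) ∂ρ ≤ 2 := by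
  set r := Real.sqrt (1 / (2 * κ)) with hr
  have hr2 : r ^ 2 = 1 / (2 * κ) := Real.sq_sqrt (by positivity)
  have hp : 0 < Real.sqrt (2 * Real.pi) := Real.sqrt_pos.2 (by positivity)
  have h1 : ∀ ω, ENNReal.ofReal (Real.sqrt (2 * Real.pi)) *
      ENNReal.ofReal (Real.exp (1 / (4 * κ) * Y ω ^ 2)) =
      ∫⁻ z : ℝ, ENNReal.ofReal (Real.exp (-z ^ 2 / 2 + z * (r * Y ω))) := fun ω => by
    rw [← ofReal_integral_eq_lintegral_ofReal (integrable_exp_gaussian_linear _)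
      (ae_of_all _ fun z => (Real.exp_pos _).le), integral_exp_gaussian_linear,
      ENNReal.ofReal_mul hp.le, mul_pow, hr2]
    congr 3
    field_simp
    ring
  have h2 : ∀ z : ℝ, ∫⁻ ω, ENNReal.ofReal (Real.exp (-z ^ 2 / 2 + z * (r * Y ω))) ∂ρ ≤
      ENNReal.ofReal (Real.exp (-(1 / 4) * z ^ 2)) := fun z => by
    have e : ∀ ω, Real.exp (-z ^ 2 / 2 + z * (r * Y ω)) =
        Real.exp (-z ^ 2 / 2) * Real.exp ((z * r) * Y ω) := fun ω => by
      rw [← Real.exp_add]; ring_nf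
    simp_rw [e]
    rw [← ofReal_integral_eq_lintegral_ofReal ((hi _).const_mul _)
      (ae_of_all _ fun z => by positivity), integral_const_mul]
    refine ENNReal.ofReal_le_ofReal ?_
    calc _ ≤ Real.exp (-z ^ 2 / 2) * Real.exp (κ * (z * r) ^ 2 / 2) := by gcongr; exact hs _
      _ = _ := by
        rw [← Real.exp_add, mul_pow, hr2]
        congr 1
        field_simp
        norm_num
  have h3 : ENNReal.ofReal (Real.sqrt (2 * Real.pi)) *
      ∫⁻ ω, ENNReal.ofReal (Real.exp (1 / (4 * κ) * Y ω ^ 2)) ∂ρ ≤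
      ENNReal.ofReal (Real.sqrt (2 * Real.pi)) * 2 := by
    rw [← lintegral_const_mul _ (by fun_prop)]
    simp_rw [h1]
    rw [lintegral_lintegral_swap (by fun_prop)]
    calc _ ≤ ∫⁻ z : ℝ, ENNReal.ofReal (Real.exp (-(1 / 4) * z ^ 2)) := lintegral_mono h2
      _ = ENNReal.ofReal (Real.sqrt (Real.pi / (1 / 4))) := by
        rw [← ofReal_integral_eq_lintegral_ofReal (integrable_exp_neg_mul_sq (by norm_num))
          (ae_of_all _ fun z => (Real.exp_pos _).le), integral_gaussian]
      _ ≤ ENNReal.ofReal (Real.sqrt (2 * Real.pi) * 2) := by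
        refine ENNReal.ofReal_le_ofReal ?_
        rw [Real.sqrt_le_left (by positivity), mul_pow, Real.sq_sqrt (by positivity)]
        linarith [Real.pi_pos]
      _ = _ := by rw [ENNReal.ofReal_mul hp.le]; norm_num
  exact (ENNReal.mul_le_mul_iff_right (by simpa using hp) ENNReal.ofReal_ne_top).1 h3

theorem integrable_exp_sq (hY : Measurable Y) (hκ : 0 < κ)
    (hi : ∀ s, Integrable (fun ω => Real.exp (s * Y ω)) ρ)
    (hs : ∀ s, ∫ ω, Real.exp (s * Y ω) ∂ρ ≤ Real.exp (κ * s ^ 2 / 2)) :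
    Integrable (fun ω => Real.exp (1 / (4 * κ) * Y ω ^ 2)) ρ ∧
      ∫ ω, Real.exp (1 / (4 * κ) * Y ω ^ 2) ∂ρ ≤ 2 := by
  have h := lintegral_exp_sq_le hY hκ hi hs
  have hm : Measurable fun ω => Real.exp (1 / (4 * κ) * Y ω ^ 2) := by fun_prop
  have hint : Integrable (fun ω => Real.exp (1 / (4 * κ) * Y ω ^ 2)) ρ := by
    refine ⟨hm.aestronglyMeasurable, ?_⟩
    rw [hasFiniteIntegral_iff_ofReal (ae_of_all _ fun ω => (Real.exp_pos _).le)]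
    exact h.trans_lt (by norm_num)
  refine ⟨hint, ?_⟩
  rw [← ofReal_integral_eq_lintegral_ofReal hint (ae_of_all _ fun ω => (Real.exp_pos _).le)] at h
  exact (ENNReal.ofReal_le_ofReal_iff (by norm_num)).1 (h.trans (by norm_num))

theorem exp_le_one_add_add_sq_mul_exp (x : ℝ) :
    Real.exp x ≤ 1 + x + x ^ 2 * Real.exp |x| := by
  have h0 : 1 ≤ Real.exp |x| := Real.one_le_exp (abs_nonneg x)
  rcases le_or_gt |x| 1 with h | h
  · have := (abs_le.1 (Real.abs_exp_sub_one_sub_id_le h)).2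
    nlinarith [sq_nonneg x]
  · rcases lt_abs.1 h with h1 | h1
    · rw [abs_of_pos (by linarith)]
      have := mul_le_mul_of_nonneg_right (one_le_pow₀ h1.le : 1 ≤ x ^ 2) (Real.exp_pos x).le
      linarith
    · have h2 : Real.exp x ≤ 1 := Real.exp_le_one_iff.2 (by linarith)
      nlinarith [sq_nonneg x]

/-- The square of a sub-Gaussian random variable is sub-exponential. -/
theorem exists_exp_sq_sub_le (hκ : 0 < κ) : ∃ lam₀ C : ℝ, 0 < lam₀ ∧ 0 < C ∧
    ∀ (Ω : Type) [MeasurableSpace Ω] (ρ : Measure Ω) [IsProbabilityMeasure ρ] (Y : Ω → ℝ) (v : ℝ),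
      Measurable Y → (∀ s, Integrable (fun ω => Real.exp (s * Y ω)) ρ) →
      (∀ s, ∫ ω, Real.exp (s * Y ω) ∂ρ ≤ Real.exp (κ * s ^ 2 / 2)) →
      Integrable (fun ω => Y ω ^ 2) ρ → ∫ ω, Y ω ^ 2 ∂ρ = v → |v| ≤ 2 →
      ∀ lam : ℝ, |lam| ≤ lam₀ → Integrable (fun ω => Real.exp (lam * (Y ω ^ 2 - v))) ρ ∧
        ∫ ω, Real.exp (lam * (Y ω ^ 2 - v)) ∂ρ ≤ Real.exp (C * lam ^ 2) := by
  set c := 1 / (4 * κ) with hc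
  have hc0 : 0 < c := by positivity
  -- With `|lam| ≤ c / 2`, the quadratic prefactor and `exp |lam * (y - v)|` each cost at most a
  -- multiple of `exp (c / 2 * (y + 2))`; their product is a multiple of the integrable `exp (c *
  -- y)`.
  refine ⟨c / 2, 8 / c ^ 2 * Real.exp (2 * c) * 2, by positivity, by positivity, ?_⟩
  intro Ω _ ρ _ Y v hY hi hs hY2 hv hv2 lam hlam
  obtain ⟨hint, hle⟩ := integrable_exp_sq hY hκ hi hs
  rw [← hc] at hint hle
  have hpt : ∀ ω, Real.exp (lam * (Y ω ^ 2 - v)) ≤ 1 + lam * (Y ω ^ 2 - v) +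
      lam ^ 2 * (8 / c ^ 2 * Real.exp (2 * c)) * Real.exp (c * Y ω ^ 2) := fun ω => by
    set y := Y ω ^ 2 with hy
    have hy0 : 0 ≤ y := sq_nonneg _
    have h1 : |y - v| ≤ y + 2 := by
      have := abs_sub y v
      rw [abs_of_nonneg hy0] at this
      linarith
    have h2 : |lam * (y - v)| ≤ c / 2 * (y + 2) := by
      rw [abs_mul]; gcongr
    have h3 : (lam * (y - v)) ^ 2 ≤ lam ^ 2 * (y + 2) ^ 2 := by
      rw [mul_pow, ← sq_abs (y - v)]; gcongr
    have h4 : (c / 2 * (y + 2)) ^ 2 ≤ 2 * Real.exp (c / 2 * (y + 2)) := by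
      have := Real.quadratic_le_exp_of_nonneg (x := c / 2 * (y + 2)) (by positivity)
      have h5 : 0 ≤ c / 2 * (y + 2) := by positivity
      linarith
    have h6 : (y + 2) ^ 2 ≤ 8 / c ^ 2 * Real.exp (c / 2 * (y + 2)) := by
      rw [div_mul_eq_mul_div, le_div_iff₀ (by positivity)]
      nlinarith
    refine (exp_le_one_add_add_sq_mul_exp _).trans ?_
    gcongr 1 + lam * (y - v) + ?_
    calc _ ≤ (lam ^ 2 * (8 / c ^ 2 * Real.exp (c / 2 * (y + 2)))) *
          Real.exp (c / 2 * (y + 2)) := by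
          gcongr
          exact h3.trans (by gcongr)
      _ = lam ^ 2 * (8 / c ^ 2) * (Real.exp (c / 2 * (y + 2)) * Real.exp (c / 2 * (y + 2))) := by
        ring
      _ = lam ^ 2 * (8 / c ^ 2) * (Real.exp (2 * c) * Real.exp (c * y)) := by
        rw [← Real.exp_add, ← Real.exp_add]; ring_nf
      _ = _ := by ring
  have hD : Integrable (fun ω => Y ω ^ 2 - v) ρ := hY2.sub (integrable_const _)
  have hA : Integrable (fun ω => 1 + lam * (Y ω ^ 2 - v)) ρ :=
    (integrable_const _).add (hD.const_mul _)
  have hB : Integrable (fun ω => lam ^ 2 * (8 / c ^ 2 * Real.exp (2 * c)) *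
      Real.exp (c * Y ω ^ 2)) ρ := hint.const_mul _
  have hI : Integrable (fun ω => Real.exp (lam * (Y ω ^ 2 - v))) ρ := by
    refine (hA.add hB).mono' (Measurable.aestronglyMeasurable (by fun_prop))
      (ae_of_all _ fun ω => ?_)
    rw [Real.norm_eq_abs, abs_of_pos (Real.exp_pos _)]
    exact hpt ω
  refine ⟨hI, ?_⟩
  have h1 := integral_mono hI (hA.add hB) hpt
  simp only [Pi.add_apply] at h1
  rw [integral_add hA hB, integral_add (integrable_const _) (hD.const_mul _), integral_const_mul, integral_const_mul,
    integral_sub hY2 (integrable_const _), hv] at h1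
  simp only [integral_const, probReal_univ, one_smul, sub_self, mul_zero, add_zero] at h1
  have h2 : lam ^ 2 * (8 / c ^ 2 * Real.exp (2 * c)) * ∫ ω, Real.exp (c * Y ω ^ 2) ∂ρ ≤
      lam ^ 2 * (8 / c ^ 2 * Real.exp (2 * c)) * 2 := by gcongr
  calc _ ≤ _ := h1
    _ ≤ 8 / c ^ 2 * Real.exp (2 * c) * 2 * lam ^ 2 + 1 := by linarith
    _ ≤ _ := Real.add_one_le_exp _

end SubExponential

/-! ### Gram matrix of the random design -/

section Design

variable {P : Measure ℝ} [IsProbabilityMeasure P] {K : ℝ≥0}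

theorem designLaw_eq_map (n p : ℕ) :
    designLaw P n p = (Measure.pi fun _ : Fin n => Measure.pi fun _ : Fin p => P).map
      fun Z a j => Z a j / Real.sqrt n := by
  have h1 : ∀ i : Fin p, IsProbabilityMeasure (P.map fun z => z / Real.sqrt n) := fun _ =>
    Measure.isProbabilityMeasure_map (by fun_prop)
  have e : (Measure.pi fun _ : Fin p => P).map (fun x j => x j / Real.sqrt n) =
      Measure.pi fun _ : Fin p => P.map fun z => z / Real.sqrt n :=
    Measure.pi_map_pi (μ := fun _ : Fin p => P) (f := fun _ z => z / Real.sqrt n)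
      fun _ => by fun_prop
  have hmeas : Measurable fun (x : Fin p → ℝ) j => x j / Real.sqrt n :=
    measurable_pi_iff.2 fun j => by fun_prop
  have h2 : ∀ i : Fin n, IsProbabilityMeasure
      ((Measure.pi fun _ : Fin p => P).map (fun x j => x j / Real.sqrt n)) := fun _ =>
    Measure.isProbabilityMeasure_map hmeas.aemeasurable
  have e2 := Measure.pi_map_pi (μ := fun _ : Fin n => Measure.pi fun _ : Fin p => P)
    (f := fun _ x j => x j / Real.sqrt n) fun _ => hmeas.aemeasurable
  rw [designLaw, ← e]
  exact e2.symm

theorem integrable_exp_row (hP_sub : HasSubgaussianMGF (fun z => z) (K ^ 2) P) {p : ℕ}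
    (u : Fin p → ℝ) (s : ℝ) :
    Integrable (fun x : Fin p → ℝ => Real.exp (s * ∑ j, x j * u j))
      (Measure.pi fun _ : Fin p => P) := by
  have h := Integrable.fintype_prod (μ := fun _ : Fin p => P)
    (f := fun j z => Real.exp ((s * u j) * z)) fun j => hP_sub.integrable_exp_mul (s * u j)
  refine h.congr (ae_of_all _ fun x => ?_)
  simp only [← Real.exp_sum, Finset.mul_sum]
  congr 1
  exact Finset.sum_congr rfl fun j _ => by ring

theorem integral_exp_row_le (hP_sub : HasSubgaussianMGF (fun z => z) (K ^ 2) P) {p : ℕ}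
    (u : Fin p → ℝ) (s : ℝ) :
    ∫ x : Fin p → ℝ, Real.exp (s * ∑ j, x j * u j) ∂(Measure.pi fun _ : Fin p => P) ≤
      Real.exp (K ^ 2 * (∑ j, u j ^ 2) * s ^ 2 / 2) := by
  have e : ∀ x : Fin p → ℝ, Real.exp (s * ∑ j, x j * u j) =
      ∏ j, Real.exp ((s * u j) * x j) := fun x => by
    rw [← Real.exp_sum, Finset.mul_sum]
    congr 1
    exact Finset.sum_congr rfl fun j _ => by ring
  simp_rw [e]
  rw [integral_fintype_prod_eq_prod (f := fun j z => Real.exp ((s * u j) * z))]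
  have e2 : K ^ 2 * (∑ j, u j ^ 2) * s ^ 2 / 2 = ∑ j, (K : ℝ) ^ 2 * (s * u j) ^ 2 / 2 := by
    rw [Finset.mul_sum, Finset.sum_mul, Finset.sum_div]
    exact Finset.sum_congr rfl fun j _ => by ring
  rw [e2, Real.exp_sum]
  refine Finset.prod_le_prod (fun j _ => integral_nonneg fun z => (Real.exp_pos _).le) fun j _ => ?_
  have := hP_sub.mgf_le (s * u j)
  simpa [mgf] using this

theorem memLp_row (hP_sub : HasSubgaussianMGF (fun z => z) (K ^ 2) P) {p : ℕ} (u : Fin p → ℝ) :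
    MemLp (fun x : Fin p → ℝ => ∑ j, x j * u j) 2 (Measure.pi fun _ : Fin p => P) := by
  refine memLp_finsetSum _ fun j _ => ?_
  have h : MemLp (fun z : ℝ => z) 2 P := by simpa using hP_sub.memLp 2
  exact (h.mul_const (u j)).comp_measurePreserving (measurePreserving_eval _ j)

theorem integral_row_sq (hP_mean : ∫ z, z ∂P = 0) (hP_var : Var[fun z => z; P] = 1)
    (hP_sub : HasSubgaussianMGF (fun z => z) (K ^ 2) P) {p : ℕ} (u : Fin p → ℝ) :
    ∫ x : Fin p → ℝ, (∑ j, x j * u j) ^ 2 ∂(Measure.pi fun _ : Fin p => P) = ∑ j, u j ^ 2 := by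
  have h2 : MemLp (fun z : ℝ => z) 2 P := by simpa using hP_sub.memLp 2
  have h1 : Integrable (fun z : ℝ => z) P := h2.integrable (by norm_num)
  have hm : ∫ x : Fin p → ℝ, (∑ j, x j * u j) ∂(Measure.pi fun _ : Fin p => P) = 0 := by
    rw [integral_finsetSum]
    · refine Finset.sum_eq_zero fun j _ => ?_
      rw [integral_comp_eval (μ := fun _ : Fin p => P) (i := j) (f := fun z => z * u j)
        (by fun_prop), integral_mul_const, hP_mean, zero_mul]
    · intro j _
      exact integrable_comp_eval (μ := fun _ : Fin p => P) (i := j) (h1.mul_const (u j))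
  have hv := variance_eq_sub (memLp_row hP_sub u)
  rw [hm] at hv
  have hv2 := variance_sum_pi (μ := fun _ : Fin p => P) (X := fun j z => z * u j)
    fun j => h2.mul_const (u j)
  have e : (∑ j, fun ω : Fin p → ℝ => ω j * u j) = fun x : Fin p → ℝ => ∑ j, x j * u j := by
    ext x; simp
  rw [e, hv] at hv2
  simp only [Pi.pow_apply] at hv2
  have e3 : ∀ j, Var[fun z => z * u j; P] = u j ^ 2 := fun j => by
    rw [variance_mul_const, hP_var, one_mul]
  simp_rw [e3] at hv2
  simpa using hv2

/-- The centred quadratic form `u ↦ ‖Z u‖² - n ‖u‖²` of a matrix with `n` rows. -/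
noncomputable def centredForm {n p : ℕ} (Z : Fin n → Fin p → ℝ) (u : EuclideanSpace ℝ (Fin p)) : ℝ :=
  ∑ a, ((∑ j, Z a j * u j) ^ 2 - ∑ j, u j ^ 2)

theorem measurable_centredForm {n p : ℕ} :
    Measurable (Function.uncurry (centredForm : (Fin n → Fin p → ℝ) → _ → ℝ)) := by
  have : Continuous (Function.uncurry (centredForm : (Fin n → Fin p → ℝ) → _ → ℝ)) := by
    unfold centredForm Function.uncurry
    fun_prop
  exact this.measurable

theorem integral_prod_rows {α : Type*} [MeasurableSpace α] {ρ : Measure α} [SigmaFinite ρ] (n : ℕ)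
    {f : α → ℝ} (hf : Integrable f ρ) :
    Integrable (fun Z : Fin n → α => ∏ a, f (Z a)) (Measure.pi fun _ : Fin n => ρ) ∧
      ∫ Z : Fin n → α, ∏ a, f (Z a) ∂(Measure.pi fun _ : Fin n => ρ) = (∫ x, f x ∂ρ) ^ n := by
  refine ⟨Integrable.fintype_prod (μ := fun _ : Fin n => ρ) (f := fun _ => f) fun _ => hf, ?_⟩
  rw [integral_fintype_prod_eq_prod (μ := fun _ : Fin n => ρ) (f := fun _ => f)]
  simp

/-- Chernoff bound for a sum of independent centred squares of sub-Gaussian row projections. The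
constants depend on neither `n`, `p` nor `u`, because `exists_exp_sq_sub_le` is uniform over
probability spaces. -/
theorem centredForm_tail (hP_mean : ∫ z, z ∂P = 0) (hP_var : Var[fun z => z; P] = 1)
    (hP_sub : HasSubgaussianMGF (fun z => z) (K ^ 2) P) :
    ∃ lam₀ C : ℝ, 0 < lam₀ ∧ 0 < C ∧ ∀ (n p : ℕ) (u : EuclideanSpace ℝ (Fin p)), ‖u‖ ≤ 5 / 4 →
      ∀ s lam : ℝ, 0 ≤ lam → lam ≤ lam₀ →
        (Measure.pi fun _ : Fin n => Measure.pi fun _ : Fin p => P)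
          {Z | s ≤ |centredForm Z u|} ≤
          ENNReal.ofReal (2 * Real.exp (C * n * lam ^ 2 - lam * s)) := by
  -- The radius `5/4` gives `‖u‖² ≤ 2`, hence the proxy `2 K²`; adding one keeps it positive without
  -- a condition on `K`.
  obtain ⟨lam₀, C, hl, hC, h⟩ := exists_exp_sq_sub_le (κ := 2 * (K : ℝ) ^ 2 + 1) (by positivity)
  refine ⟨lam₀, C, hl, hC, fun n p u hu s lam hlam0 hlam => ?_⟩
  have hv : ∑ j, u j ^ 2 ≤ 2 := by
    rw [← EuclideanSpace.real_norm_sq_eq]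
    calc _ ≤ (5 / 4 : ℝ) ^ 2 := by gcongr
      _ ≤ 2 := by norm_num
  have hv0 : 0 ≤ ∑ j, u j ^ 2 := Finset.sum_nonneg fun _ _ => sq_nonneg _
  set ρ := Measure.pi fun _ : Fin p => P with hρ
  set v := ∑ j, u j ^ 2 with hvd
  have hrow := h (Fin p → ℝ) ρ (fun x => ∑ j, x j * u j) v (by fun_prop)
    (integrable_exp_row hP_sub u.ofLp) (fun t => (integral_exp_row_le hP_sub u.ofLp t).trans (by
      refine Real.exp_le_exp.2 ?_
      have h1 : (K : ℝ) ^ 2 * v ≤ 2 * (K : ℝ) ^ 2 + 1 := by nlinarith [sq_nonneg (K : ℝ)]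
      change (K : ℝ) ^ 2 * v * t ^ 2 / 2 ≤ _
      gcongr))
    (memLp_row hP_sub u.ofLp).integrable_sq (integral_row_sq hP_mean hP_var hP_sub u.ofLp)
    (by rwa [abs_of_nonneg hv0])
  have hone : ∀ θ : ℝ, |θ| ≤ lam₀ →
      Integrable (fun Z : Fin n → Fin p → ℝ => Real.exp (θ * centredForm Z u))
        (Measure.pi fun _ : Fin n => ρ) ∧
      ∫ Z : Fin n → Fin p → ℝ, Real.exp (θ * centredForm Z u) ∂(Measure.pi fun _ : Fin n => ρ) ≤
        Real.exp (C * n * θ ^ 2) := by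
    intro θ hθ
    obtain ⟨i1, i2⟩ := hrow θ hθ
    obtain ⟨f, hf⟩ : ∃ f : (Fin p → ℝ) → ℝ,
        f = fun x => Real.exp (θ * ((∑ j, x j * u j) ^ 2 - v)) := ⟨_, rfl⟩
    have e : (fun Z : Fin n → Fin p → ℝ => Real.exp (θ * centredForm Z u)) =
        fun Z => ∏ a, f (Z a) := by
      ext Z
      rw [hf, ← Real.exp_sum, centredForm, Finset.mul_sum]
    rw [← hf] at i1 i2
    obtain ⟨j1, j2⟩ := integral_prod_rows n i1
    rw [e, j2]
    refine ⟨j1, ?_⟩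
    calc _ ≤ Real.exp (C * θ ^ 2) ^ n := by
          refine pow_le_pow_left₀ (integral_nonneg fun x => ?_) i2 n
          rw [hf]; exact (Real.exp_pos _).le
      _ = _ := by rw [← Real.exp_nat_mul]; ring_nf
  have hup := hone lam (by rwa [abs_of_nonneg hlam0])
  have hdn := hone (-lam) (by rwa [abs_neg, abs_of_nonneg hlam0])
  have hpr : IsProbabilityMeasure (Measure.pi fun _ : Fin n => ρ) := inferInstance
  have c1 := measure_ge_le_exp_mul_mgf (μ := Measure.pi fun _ : Fin n => ρ)
    (X := fun Z => centredForm Z u) s hlam0 hup.1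
  have c2 := measure_ge_le_exp_mul_mgf (μ := Measure.pi fun _ : Fin n => ρ)
    (X := fun Z => -centredForm Z u) s hlam0 (by simpa using hdn.1)
  have b1 : (Measure.pi fun _ : Fin n => ρ).real {Z | s ≤ centredForm Z u} ≤
      Real.exp (C * n * lam ^ 2 - lam * s) := by
    refine c1.trans ?_
    calc _ ≤ Real.exp (-lam * s) * Real.exp (C * n * lam ^ 2) := by
          gcongr; exact hup.2
      _ = _ := by rw [← Real.exp_add]; ring_nf
  have b2 : (Measure.pi fun _ : Fin n => ρ).real {Z | s ≤ -centredForm Z u} ≤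
      Real.exp (C * n * lam ^ 2 - lam * s) := by
    refine c2.trans ?_
    calc _ ≤ Real.exp (-lam * s) * Real.exp (C * n * (-lam) ^ 2) := by
          gcongr
          refine le_trans (le_of_eq ?_) hdn.2
          simp [mgf]
      _ = _ := by rw [← Real.exp_add]; ring_nf
  have hsub : {Z : Fin n → Fin p → ℝ | s ≤ |centredForm Z u|} ⊆
      {Z | s ≤ centredForm Z u} ∪ {Z | s ≤ -centredForm Z u} := fun Z hZ => by
    simp only [Set.mem_union, Set.mem_ofPred_eq] at hZ ⊢
    exact le_abs.1 hZ
  rw [← ENNReal.ofReal_toReal (measure_ne_top _ {Z | s ≤ |centredForm Z u|})]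
  refine ENNReal.ofReal_le_ofReal ?_
  change (Measure.pi fun _ : Fin n => ρ).real _ ≤ _
  calc _ ≤ _ := measureReal_mono hsub
    _ ≤ _ := measureReal_union_le _ _
    _ ≤ _ := by linarith

/-- Concentration of the Gram matrix of a sub-Gaussian design in operator norm, at rate
`√(p / n)`. -/
theorem designLaw_gram_concentration (hP_mean : ∫ z, z ∂P = 0) (hP_var : Var[fun z => z; P] = 1)
    (hP_sub : HasSubgaussianMGF (fun z => z) (K ^ 2) P) :
    ∃ T : ℝ, 0 < T ∧ ∀ n p : ℕ, 0 < n → p ≤ n →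
      designLaw P n p {X | ∃ u : Fin p → ℝ, T * Real.sqrt (p / n) * ∑ j, u j ^ 2 <
        |(∑ a, (∑ j, X a j * u j) ^ 2) - ∑ j, u j ^ 2|} ≤
        ENNReal.ofReal (4 * (1 / 2) ^ p) := by
  obtain ⟨lam₀, C, hl, hC, h⟩ := centredForm_tail hP_mean hP_var hP_sub
  -- Chosen so that, with `lam = lam₀ * r` and `s = n * (T₁ * r)`, the Chernoff exponent is exactly
  -- `-3 p`. The condition `lam ≤ lam₀` is where `p ≤ n` enters.
  set T₁ := (C * lam₀ ^ 2 + 3) / lam₀ with hT₁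
  have hT₁0 : 0 < T₁ := by positivity
  refine ⟨16 / 15 * T₁, by positivity, fun n p hn hpn => ?_⟩
  have hn0 : (0 : ℝ) < n := by exact_mod_cast hn
  have hsn : Real.sqrt n ^ 2 = n := Real.sq_sqrt hn0.le
  set r := Real.sqrt (p / n) with hr
  have hr2 : r ^ 2 = p / n := Real.sq_sqrt (by positivity)
  have hr0 : 0 ≤ r := Real.sqrt_nonneg _
  have hr1 : r ≤ 1 := by
    rw [hr, Real.sqrt_le_left zero_le_one, one_pow, div_le_one hn0]
    exact_mod_cast hpn
  have key := measure_exists_quadratic_gt_le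
    (P := Measure.pi fun _ : Fin n => Measure.pi fun _ : Fin p => P)
    (w := centredForm) measurable_centredForm
    (fun Z => by unfold centredForm; fun_prop)
    (fun Z c u => by
      simp only [centredForm, PiLp.smul_apply, smul_eq_mul, Finset.mul_sum]
      refine Finset.sum_congr rfl fun a _ => ?_
      have e1 : ∑ j, Z a j * (c * u j) = c * ∑ j, Z a j * u j := by
        rw [Finset.mul_sum]; exact Finset.sum_congr rfl fun j _ => by ring
      have e2 : ∑ j, (c * u j) ^ 2 = c ^ 2 * ∑ j, u j ^ 2 := by
        rw [Finset.mul_sum]; exact Finset.sum_congr rfl fun j _ => by ring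
      rw [e1, e2]; ring)
    (fun Z x y => by
      simp only [centredForm, PiLp.add_apply, PiLp.sub_apply, Finset.mul_sum,
        ← Finset.sum_add_distrib]
      refine Finset.sum_congr rfl fun a _ => ?_
      have e1 : ∑ j, Z a j * (x j + y j) = (∑ j, Z a j * x j) + ∑ j, Z a j * y j := by
        rw [← Finset.sum_add_distrib]; exact Finset.sum_congr rfl fun j _ => by ring
      have e2 : ∑ j, Z a j * (x j - y j) = (∑ j, Z a j * x j) - ∑ j, Z a j * y j := by
        rw [← Finset.sum_sub_distrib]; exact Finset.sum_congr rfl fun j _ => by ring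
      have e3 : ∑ j, (x j + y j) ^ 2 + ∑ j, (x j - y j) ^ 2 =
          2 * ∑ j, x j ^ 2 + 2 * ∑ j, y j ^ 2 := by
        rw [Finset.mul_sum, Finset.mul_sum, ← Finset.sum_add_distrib, ← Finset.sum_add_distrib]
        exact Finset.sum_congr rfl fun j _ => by ring
      rw [e1, e2]
      linarith)
    (s := n * (T₁ * r)) (q := ENNReal.ofReal (2 * Real.exp (-(3 * p))))
    (fun u hu => by
      refine (h n p u hu (n * (T₁ * r)) (lam₀ * r) (by positivity)
        (by nlinarith)).trans ?_
      refine ENNReal.ofReal_le_ofReal ?_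
      gcongr
      have e1 : C * n * (lam₀ * r) ^ 2 = C * lam₀ ^ 2 * p := by
        rw [mul_pow, hr2]; field_simp
      have e2 : lam₀ * r * (n * (T₁ * r)) = (C * lam₀ ^ 2 + 3) * p := by
        calc _ = (lam₀ * T₁) * (n * r ^ 2) := by ring
          _ = _ := by rw [hr2, hT₁]; field_simp
      rw [e1, e2]
      linarith)
  have hsub : designLaw P n p {X | ∃ u : Fin p → ℝ, 16 / 15 * T₁ * r * ∑ j, u j ^ 2 <
        |(∑ a, (∑ j, X a j * u j) ^ 2) - ∑ j, u j ^ 2|} =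
      (Measure.pi fun _ : Fin n => Measure.pi fun _ : Fin p => P)
        {Z | ∃ u : EuclideanSpace ℝ (Fin p), 16 / 15 * (n * (T₁ * r)) * ‖u‖ ^ 2 <
          |centredForm Z u|} := by
    have hs0 : 0 < Real.sqrt n := Real.sqrt_pos.2 hn0
    -- As a measurable equivalence, the rescaling allows the pushforward to be evaluated on the
    -- event without proving the event measurable.
    let e : (Fin n → Fin p → ℝ) ≃ᵐ (Fin n → Fin p → ℝ) :=
      MeasurableEquiv.piCongrRight fun _ => MeasurableEquiv.piCongrRight fun _ =>
        (MeasurableEquiv.mulRight₀ (Real.sqrt n)⁻¹ (inv_ne_zero hs0.ne'))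
    have he : (fun (Z : Fin n → Fin p → ℝ) a j => Z a j / Real.sqrt n) = e := by
      ext Z a j
      simp only [div_eq_mul_inv]
      rfl
    rw [designLaw_eq_map, he, e.map_apply, ← he]
    congr 1
    ext Z
    simp only [Set.mem_preimage, Set.mem_ofPred_eq]
    have hform : ∀ u : EuclideanSpace ℝ (Fin p), centredForm Z u =
        n * ((∑ a, (∑ j, Z a j / Real.sqrt n * u j) ^ 2) - ∑ j, u j ^ 2) := fun u => by
      rw [centredForm, Finset.sum_sub_distrib, Finset.sum_const, Finset.card_univ,
        Fintype.card_fin, nsmul_eq_mul, mul_sub]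
      congr 1
      rw [Finset.mul_sum]
      refine Finset.sum_congr rfl fun a _ => ?_
      have : ∑ j, Z a j / Real.sqrt n * u j = (∑ j, Z a j * u j) / Real.sqrt n := by
        rw [Finset.sum_div]; exact Finset.sum_congr rfl fun j _ => by ring
      rw [this, div_pow, hsn]; field_simp
    have hiff : ∀ u : EuclideanSpace ℝ (Fin p),
        (16 / 15 * (n * (T₁ * r)) * ‖u‖ ^ 2 < |centredForm Z u| ↔
          16 / 15 * T₁ * r * ∑ j, u j ^ 2 <
            |(∑ a, (∑ j, Z a j / Real.sqrt n * u j) ^ 2) - ∑ j, u j ^ 2|) := fun u => by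
      rw [hform, abs_mul, abs_of_pos hn0, EuclideanSpace.real_norm_sq_eq,
        ← mul_lt_mul_iff_right₀ hn0 (b := 16 / 15 * T₁ * r * ∑ j, u j ^ 2)]
      have : 16 / 15 * (n * (T₁ * r)) * ∑ j, u j ^ 2 =
          n * (16 / 15 * T₁ * r * ∑ j, u j ^ 2) := by ring
      rw [this]
    constructor
    · rintro ⟨u, hu⟩
      exact ⟨WithLp.toLp 2 u, (hiff _).2 hu⟩
    · rintro ⟨u, hu⟩
      exact ⟨u.ofLp, (hiff u).1 hu⟩
  rw [hsub]
  refine key.trans ?_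
  rw [finrank_euclideanSpace, Fintype.card_fin]
  have e5 : (2 : ℝ≥0∞) * 5 ^ p = ENNReal.ofReal (2 * 5 ^ p) := by
    rw [ENNReal.ofReal_mul (by norm_num), ENNReal.ofReal_pow (by norm_num)]; norm_num
  rw [e5, ← ENNReal.ofReal_mul (by positivity)]
  refine ENNReal.ofReal_le_ofReal ?_
  -- Since `exp (-3) ≤ 1/10`, the tail beats the volume factor: `5 ^ p * exp (-3 p) ≤ (1/2) ^ p`.
  have h10 : Real.exp (-3) ≤ 1 / 10 := by
    rw [Real.exp_neg, inv_eq_one_div]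
    have h1 : (2.7182818283 : ℝ) < Real.exp 1 := Real.exp_one_gt_d9
    have h2 : Real.exp 3 = Real.exp 1 ^ 3 := by rw [← Real.exp_nat_mul]; norm_num
    have h3 : (10 : ℝ) ≤ Real.exp 3 := by
      rw [h2]
      calc (10 : ℝ) ≤ 2.7182818283 ^ 3 := by norm_num
        _ ≤ _ := by gcongr
    exact one_div_le_one_div_of_le (by norm_num) h3
  have h11 : Real.exp (-(3 * p)) ≤ (1 / 10) ^ p := by
    have : Real.exp (-(3 * p)) = Real.exp (-3) ^ p := by rw [← Real.exp_nat_mul]; ring_nf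
    rw [this]; gcongr
  calc 2 * 5 ^ p * (2 * Real.exp (-(3 * p))) ≤ 2 * 5 ^ p * (2 * (1 / 10) ^ p) := by gcongr
    _ = 4 * (5 * (1 / 10)) ^ p := by rw [mul_pow]; ring
    _ = _ := by norm_num

end Design

/-! ### From test functions to total variation, means and variances -/

/-- Two measures on a box whose integrals of bounded functions of a coordinate are close have close
marginals. -/
theorem marginalsClose_of_integral_close {p : ℕ} {P Q : Measure (Fin p → ℝ)}
    [IsProbabilityMeasure P] [IsProbabilityMeasure Q] {M R : ℝ} (hM : 1 ≤ M) (hR : 0 ≤ R)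
    (hP : ∀ᵐ β ∂P, ∀ i, |β i| ≤ M) (hQ : ∀ᵐ β ∂Q, ∀ i, |β i| ≤ M) (i : Fin p)
    (h : ∀ (f : ℝ → ℝ) (F : ℝ), Measurable f → 0 ≤ F → (∀ b, |b| ≤ M → |f b| ≤ F) →
      |(∫ β, f (β i) ∂P) - ∫ β, f (β i) ∂Q| ≤ F * R) {r : ℝ} (hr : 3 * M ^ 2 * R ≤ r) :
    MarginalsClose P Q i r := by
  have hM0 : 0 ≤ M := by linarith
  have hM2 : M ≤ M ^ 2 := by nlinarith
  have hMR : M * R ≤ M ^ 2 * R := by gcongr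
  have h1R : R ≤ M ^ 2 * R := by nlinarith
  have hmean := h (fun b => b) M measurable_id' hM0 fun b hb => hb
  refine ⟨?_, hmean.trans (by nlinarith), ?_⟩
  · refine Real.iSup_le (fun E => ?_) (by nlinarith)
    obtain ⟨E, hE⟩ := E
    have hm : ∀ (P' : Measure (Fin p → ℝ)) [IsProbabilityMeasure P'],
        (marginal P' i).real E = ∫ β, E.indicator 1 (β i) ∂P' := fun P' _ => by
      rw [marginal, measureReal_def, Measure.map_apply (measurable_pi_apply i) hE,
        ← measureReal_def, ← integral_indicator_one (measurable_pi_apply i hE)]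
      rfl
    simp only
    rw [hm, hm]
    refine (h (E.indicator 1) 1 (measurable_one.indicator hE) zero_le_one fun b _ => ?_).trans
      (by nlinarith)
    by_cases hb : b ∈ E <;> simp [hb]
  · have hL : ∀ (P' : Measure (Fin p → ℝ)) [IsProbabilityMeasure P']
        (_ : ∀ᵐ β ∂P', ∀ i, |β i| ≤ M), MemLp (fun β : Fin p → ℝ => β i) 2 P' :=
      fun P' _ hP' => MemLp.of_bound (measurable_pi_apply i).aestronglyMeasurable M
        (hP'.mono fun β hβ => hβ i)
    -- The second moment costs `M² R` and the squared mean `2 M² R`, whence the factor `3 M²`.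
    rw [variance_eq_sub (hL P hP), variance_eq_sub (hL Q hQ)]
    simp only [Pi.pow_apply]
    have hsq := h (fun b => b ^ 2) (M ^ 2) (by fun_prop) (by positivity) fun b hb => by
      rw [abs_pow]; gcongr
    have b1 : |∫ β, β i ∂P| ≤ M := abs_integral_le_of_ae (hP.mono fun β hβ => hβ i)
    have b2 : |∫ β, β i ∂Q| ≤ M := abs_integral_le_of_ae (hQ.mono fun β hβ => hβ i)
    set a := ∫ β, β i ∂P
    set b := ∫ β, β i ∂Q
    have h3 : |a ^ 2 - b ^ 2| ≤ 2 * (M ^ 2 * R) := by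
      have : a ^ 2 - b ^ 2 = (a - b) * (a + b) := by ring
      rw [this, abs_mul]
      have h4 : |a + b| ≤ 2 * M := (abs_add_le _ _).trans (by linarith)
      calc _ ≤ (M * R) * (2 * M) := by gcongr
        _ = _ := by ring
    set A := ∫ β, β i ^ 2 ∂P
    set B := ∫ β, β i ^ 2 ∂Q
    calc |A - a ^ 2 - (B - b ^ 2)| = |(A - B) - (a ^ 2 - b ^ 2)| := by ring_nf
      _ ≤ |A - B| + |a ^ 2 - b ^ 2| := abs_sub _ _
      _ ≤ _ := by linarith

/-! ### The posterior as a Gibbs measure -/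

section Model

variable {n p : ℕ} (σ : ℝ) (X : Fin n → Fin p → ℝ) (y : Fin n → ℝ)

/-- The off-diagonal part of the Gram matrix of the design, scaled by the noise level. -/
noncomputable def interaction : Matrix (Fin p) (Fin p) ℝ :=
  (σ ^ 2)⁻¹ • ((Matrix.of X)ᵀ * Matrix.of X -
    Matrix.diagonal fun i => ((Matrix.of X)ᵀ * Matrix.of X) i i)

/-- The one-site exponent of the posterior. -/
noncomputable def siteExponent (i : Fin p) (b : ℝ) : ℝ :=
  (σ ^ 2)⁻¹ * ((y ᵥ* Matrix.of X) i * b - ((Matrix.of X)ᵀ * Matrix.of X) i i * b ^ 2 / 2)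

theorem interaction_isSymm : (interaction σ X).IsSymm := by
  simp [Matrix.IsSymm, interaction, Matrix.transpose_smul, Matrix.transpose_sub,
    Matrix.transpose_mul]

theorem interaction_diag (i : Fin p) : interaction σ X i i = 0 := by
  simp [interaction]

theorem gram_quadratic (u : Fin p → ℝ) :
    u ⬝ᵥ (((Matrix.of X)ᵀ * Matrix.of X) *ᵥ u) = ∑ a, (∑ j, X a j * u j) ^ 2 := by
  rw [← Matrix.mulVec_mulVec, Matrix.dotProduct_mulVec, Matrix.vecMul_transpose]
  simp [dotProduct, Matrix.mulVec, sq]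

theorem interaction_quadratic (u : Fin p → ℝ) :
    u ⬝ᵥ (interaction σ X *ᵥ u) = (σ ^ 2)⁻¹ * ((∑ a, (∑ j, X a j * u j) ^ 2) -
      ∑ i, ((Matrix.of X)ᵀ * Matrix.of X) i i * u i ^ 2) := by
  rw [interaction, Matrix.smul_mulVec, dotProduct_smul, smul_eq_mul, Matrix.sub_mulVec,
    dotProduct_sub, gram_quadratic]
  congr 2
  rw [dotProduct]
  refine Finset.sum_congr rfl fun i _ => ?_
  rw [Matrix.mulVec_diagonal]
  ring

theorem gram_diag (i : Fin p) : ((Matrix.of X)ᵀ * Matrix.of X) i i = ∑ a, X a i ^ 2 := by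
  simp [Matrix.mul_apply, sq]

/-- Polarization with the choice `x = c⁻¹ • J v`, for which `x ⬝ᵥ J v` is already `c⁻¹ ‖J v‖²`. -/
theorem norm_mulVec_le_of_quadratic {ι : Type*} [Fintype ι] {J : Matrix ι ι ℝ} (hJ : J.IsSymm)
    {c : ℝ} (hc : 0 < c) (h : ∀ u : ι → ℝ, |u ⬝ᵥ (J *ᵥ u)| ≤ c * ∑ i, u i ^ 2) (v : ι → ℝ) :
    ∑ i, (J *ᵥ v) i ^ 2 ≤ c ^ 2 * ∑ i, v i ^ 2 := by
  set x : ι → ℝ := c⁻¹ • (J *ᵥ v) with hx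
  have h1 := (abs_le.1 (h (x + v))).2
  have h2 := (abs_le.1 (h (x - v))).1
  have hsym : v ⬝ᵥ (J *ᵥ x) = x ⬝ᵥ (J *ᵥ v) := by
    rw [Matrix.dotProduct_mulVec, ← Matrix.mulVec_transpose, hJ.eq, dotProduct_comm]
  have e1 : (x + v) ⬝ᵥ (J *ᵥ (x + v)) - (x - v) ⬝ᵥ (J *ᵥ (x - v)) = 4 * (x ⬝ᵥ (J *ᵥ v)) := by
    rw [Matrix.mulVec_add, Matrix.mulVec_sub, add_dotProduct, sub_dotProduct, dotProduct_add,
      dotProduct_add, dotProduct_sub, dotProduct_sub, hsym]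
    ring
  have e2 : ∑ i, (x + v) i ^ 2 + ∑ i, (x - v) i ^ 2 = 2 * ∑ i, x i ^ 2 + 2 * ∑ i, v i ^ 2 := by
    rw [Finset.mul_sum, Finset.mul_sum, ← Finset.sum_add_distrib, ← Finset.sum_add_distrib]
    exact Finset.sum_congr rfl fun j _ => by simp only [Pi.add_apply, Pi.sub_apply]; ring
  set S := ∑ i, (J *ᵥ v) i ^ 2 with hS
  have e3 : x ⬝ᵥ (J *ᵥ v) = c⁻¹ * S := by
    rw [hx, smul_dotProduct, smul_eq_mul, hS]; simp [dotProduct, sq]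
  have e4 : ∑ i, x i ^ 2 = (c⁻¹) ^ 2 * S := by
    rw [hS, Finset.mul_sum]
    exact Finset.sum_congr rfl fun i _ => by rw [hx, Pi.smul_apply, smul_eq_mul]; ring
  have h3 : 4 * (c⁻¹ * S) ≤ c * (2 * ((c⁻¹) ^ 2 * S) + 2 * ∑ i, v i ^ 2) := by
    rw [← e3, ← e4, ← e1, ← e2]; linarith
  have e5 : c * (c⁻¹ ^ 2 * S) = c⁻¹ * S := by field_simp
  have h4 : c⁻¹ * S ≤ c * ∑ i, v i ^ 2 := by linarith
  rw [inv_mul_le_iff₀ hc] at h4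
  linarith

/-- Coordinate vectors in `hX` show that the Gram diagonal is within `t` of one. Removing the
diagonal thus costs a second `t`, hence `2 * t`. -/
theorem interaction_norm_le (hσ : 0 < σ) {t : ℝ} (ht : 0 < t)
    (hX : ∀ u : Fin p → ℝ,
      |(∑ a, (∑ j, X a j * u j) ^ 2) - ∑ j, u j ^ 2| ≤ t * ∑ j, u j ^ 2) (v : Fin p → ℝ) :
    ∑ i, (interaction σ X *ᵥ v) i ^ 2 ≤ (2 * t / σ ^ 2) ^ 2 * ∑ i, v i ^ 2 := by
  refine norm_mulVec_le_of_quadratic (interaction_isSymm σ X) (by positivity) (fun u => ?_) v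
  have hdiag : ∀ i, |∑ a, X a i ^ 2 - 1| ≤ t := fun i => by
    have h := hX (Pi.single i 1)
    have e1 : ∑ j, (Pi.single i (1 : ℝ) : Fin p → ℝ) j ^ 2 = 1 := by
      rw [Finset.sum_eq_single i] <;> simp +contextual
    have e2 : ∀ a, ∑ j, X a j * (Pi.single i (1 : ℝ) : Fin p → ℝ) j = X a i := fun a => by
      rw [Finset.sum_eq_single i] <;> simp +contextual
    simp only [e1, e2, mul_one] at h
    exact h
  rw [interaction_quadratic, abs_mul, abs_of_pos (by positivity)]
  have e : (∑ a, (∑ j, X a j * u j) ^ 2) -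
      ∑ i, ((Matrix.of X)ᵀ * Matrix.of X) i i * u i ^ 2 =
      ((∑ a, (∑ j, X a j * u j) ^ 2) - ∑ j, u j ^ 2) - ∑ i, (∑ a, X a i ^ 2 - 1) * u i ^ 2 := by
    simp_rw [gram_diag, sub_mul, one_mul, Finset.sum_sub_distrib]
    ring
  have hd : |∑ i, (∑ a, X a i ^ 2 - 1) * u i ^ 2| ≤ t * ∑ i, u i ^ 2 := by
    refine (Finset.abs_sum_le_sum_abs _ _).trans ?_
    rw [Finset.mul_sum]
    refine Finset.sum_le_sum fun i _ => ?_
    rw [abs_mul, abs_of_nonneg (sq_nonneg (u i))]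
    gcongr
    exact hdiag i
  rw [e]
  calc _ ≤ (σ ^ 2)⁻¹ * (t * ∑ j, u j ^ 2 + t * ∑ j, u j ^ 2) := by
        gcongr
        exact (abs_sub _ _).trans (add_le_add (hX u) hd)
    _ = _ := by field_simp; ring

variable {m : Measure ℝ} [IsProbabilityMeasure m] {M : ℝ}

theorem isProbabilityMeasure_site (hm : ∀ᵐ b ∂m, |b| ≤ M) (i : Fin p) :
    IsProbabilityMeasure (m.tilted (siteExponent σ X y i)) :=
  isProbabilityMeasure_tilted (integrable_of_ae_interval hm (by unfold siteExponent; fun_prop))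

theorem posterior_eq_gibbs (hm : ∀ᵐ b ∂m, |b| ≤ M) :
    posterior σ m X y = (Measure.pi fun i => m.tilted (siteExponent σ X y i)).tilted
      fun β => -(β ⬝ᵥ (interaction σ X *ᵥ β)) / 2 := by
  have hc : ∀ i, Continuous (siteExponent σ X y i) := fun i => by unfold siteExponent; fun_prop
  have hb := ae_pi_box (μ := fun _ : Fin p => m) fun _ => hm
  rw [pi_tilted (fun _ : Fin p => m) _ fun i => integrable_of_ae_interval hm (by fun_prop),
    tilted_tilted (integrable_of_ae_box hb (by fun_prop)), posterior,
    ← tilted_add_const _ _ (integrable_of_ae_box hb (by fun_prop)) ((∑ a, y a ^ 2) / (2 * σ ^ 2))]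
  congr 1
  ext β
  rw [Pi.add_apply, interaction_quadratic]
  have e1 : ∑ a, (y a - (Matrix.of X *ᵥ β) a) ^ 2 =
      ∑ a, y a ^ 2 - 2 * ∑ i, (y ᵥ* Matrix.of X) i * β i + ∑ a, (∑ j, X a j * β j) ^ 2 := by
    have h1 : ∑ i, (y ᵥ* Matrix.of X) i * β i = ∑ a, y a * (Matrix.of X *ᵥ β) a :=
      (Matrix.dotProduct_mulVec y (Matrix.of X) β).symm
    rw [h1, Finset.mul_sum, ← Finset.sum_sub_distrib, ← Finset.sum_add_distrib]
    refine Finset.sum_congr rfl fun a _ => ?_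
    have h2 : (Matrix.of X *ᵥ β) a = ∑ j, X a j * β j := rfl
    rw [h2]; ring
  have e2 : ∑ i, siteExponent σ X y i (β i) = (σ ^ 2)⁻¹ * (∑ i, (y ᵥ* Matrix.of X) i * β i -
      (∑ i, ((Matrix.of X)ᵀ * Matrix.of X) i i * β i ^ 2) / 2) := by
    rw [Finset.sum_div, ← Finset.sum_sub_distrib, Finset.mul_sum]
    rfl
  rw [e1, e2]
  rcases eq_or_ne σ 0 with rfl | h0
  · simp
  · field_simp
    ring

/-- The mean-field product measure associated with a solution of the mean-field equations. -/
noncomputable def meanFieldMeasure (m : Measure ℝ) (s : Fin p → ℝ) : Measure (Fin p → ℝ) :=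
  Measure.pi fun i => (m.tilted (siteExponent σ X y i)).tilted
    fun b => -(interaction σ X *ᵥ s) i * b

theorem support_eq_of_ac {μ ν : Measure ℝ} (h1 : μ ≪ ν) (h2 : ν ≪ μ) : μ.support = ν.support :=
  (h1.support_mono).antisymm h2.support_mono

theorem ae_abs_le_of_support_eq {S : Set ℝ} (hSM : ∀ b ∈ S, |b| ≤ M) {q : Measure ℝ}
    (hq : q.support = S) : ∀ᵐ b ∂q, |b| ≤ M := by
  have : q.support ∈ ae q := Measure.support_mem_ae
  filter_upwards [this] with b hb
  exact hSM b (hq ▸ hb)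

/-- The support constraint enters twice: it confines every competitor to the box, and it admits the
mean-field measure, whose factors are mutually absolutely continuous with `m`. -/
theorem isVariationalPosterior_meanField (hM : 0 < M) {S : Set ℝ} (hmS : m.support = S)
    (hSM : ∀ b ∈ S, |b| ≤ M) {η : ℝ} (hη0 : 0 ≤ η) (hη1 : 4 * M ^ 2 * η ≤ 1)
    (hη : ∀ v : Fin p → ℝ, ∑ i, (interaction σ X *ᵥ v) i ^ 2 ≤ η ^ 2 * ∑ i, v i ^ 2)
    {s : Fin p → ℝ}
    (hs : IsMeanFieldSolution (fun i => m.tilted (siteExponent σ X y i)) (interaction σ X) s) :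
    IsVariationalPosterior σ m X y (meanFieldMeasure σ X y m s) ∧
      ∀ Q, IsVariationalPosterior σ m X y Q → Q = meanFieldMeasure σ X y m s := by
  have hm : ∀ᵐ b ∂m, |b| ≤ M := ae_abs_le_of_support_eq hSM hmS
  have hpr := isProbabilityMeasure_site σ X y hm
  have hsite : ∀ i, Integrable (fun b => Real.exp (siteExponent σ X y i b)) m := fun i =>
    integrable_of_ae_interval hm (by unfold siteExponent; fun_prop)
  have hmem : meanFieldMeasure σ X y m s ∈ productFamily m p := by
    refine ⟨_, fun i => isProbabilityMeasure_tilted_mul (ae_tilted hm) _, fun i => ?_, rfl⟩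
    exact support_eq_of_ac
      ((tilted_absolutelyContinuous _ _).trans (tilted_absolutelyContinuous _ _))
      ((absolutelyContinuous_tilted (hsite i)).trans (absolutelyContinuous_tilted
        (integrable_exp_mul_of_ae_interval (ae_tilted hm) _)))
  have key := fun (q : Fin p → Measure ℝ) (_ : ∀ i, IsProbabilityMeasure (q i))
      (hq : ∀ i, (q i).support = m.support) =>
    meanField_isMinimizer hM (fun i => ae_tilted hm) (interaction_isSymm σ X)
      (interaction_diag σ X) hη0 hη1 hη (posterior_eq_gibbs σ X y hm) hs (Q := q)
      fun i => ae_abs_le_of_support_eq hSM ((hq i).trans hmS)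
  refine ⟨⟨hmem, ?_⟩, ?_⟩
  · rintro _ ⟨q, hq1, hq2, rfl⟩
    exact (key q hq1 hq2).1
  · rintro _ ⟨⟨q, hq1, hq2, rfl⟩, hmin⟩
    exact (key q hq1 hq2).2 (hmin _ hmem)

end Model

/-! ### Dependence of the prior on the parameter -/

section Prior

variable {k : ℕ} {ν : Measure ℝ} {S : Set ℝ} {Θ : Set (EuclideanSpace ℝ (Fin k))}
  {θ₀ : EuclideanSpace ℝ (Fin k)} {ℓ : EuclideanSpace ℝ (Fin k) → ℝ → ℝ}

/-- `Θ` need not be convex, so the mean value inequality is used only on a ball about `θ₀` inside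
`Θ`. Farther away `‖θ - θ₀‖` is at least the radius, and boundedness of `ℓ` on the compact set
suffices. -/
theorem exists_lipschitz_logDensity (hS : IsCompact S) (hΘ : IsCompact Θ) (hθ₀ : θ₀ ∈ interior Θ)
    (hcont : ContinuousOn (Function.uncurry ℓ) (Θ ×ˢ S))
    (hgrad : ∃ L : ℝ, ∀ θ ∈ interior Θ, ∀ b ∈ S,
      DifferentiableAt ℝ (fun ϑ => ℓ ϑ b) θ ∧ ‖gradient (fun ϑ => ℓ ϑ b) θ‖ ≤ L) :
    ∃ L : ℝ, 0 ≤ L ∧ ∀ θ ∈ Θ, ∀ b ∈ S, |ℓ θ b - ℓ θ₀ b| ≤ L * ‖θ - θ₀‖ := by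
  obtain ⟨L, hL⟩ := hgrad
  obtain ⟨ρ, hρ, hball⟩ := Metric.isOpen_iff.1 isOpen_interior θ₀ hθ₀
  obtain ⟨B, hB⟩ := (hΘ.prod hS).exists_bound_of_continuousOn hcont
  refine ⟨max 0 (max L (2 * B / ρ)), le_max_left _ _, fun θ hθ b hb => ?_⟩
  rcases lt_or_ge ‖θ - θ₀‖ ρ with h | h
  · have h1 : ‖ℓ θ b - ℓ θ₀ b‖ ≤ L * ‖θ - θ₀‖ :=
      (convex_ball θ₀ ρ).norm_image_sub_le_of_norm_fderiv_le (f := fun ϑ => ℓ ϑ b) (𝕜 := ℝ)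
        (fun x hx => (hL x (hball hx) b hb).1) (fun x hx => by
          have := (hL x (hball hx) b hb).2
          rwa [gradient, LinearIsometryEquiv.norm_map] at this)
        (Metric.mem_ball_self hρ) (by simpa [dist_eq_norm] using h)
    rw [Real.norm_eq_abs] at h1
    refine h1.trans ?_
    gcongr
    exact (le_max_left _ _).trans (le_max_right _ _)
  · have h1 : |ℓ θ b| ≤ B := hB (θ, b) ⟨hθ, hb⟩
    have h2 : |ℓ θ₀ b| ≤ B := hB (θ₀, b) ⟨interior_subset hθ₀, hb⟩
    have hB0 : 0 ≤ B := (abs_nonneg _).trans h1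
    calc _ ≤ |ℓ θ b| + |ℓ θ₀ b| := abs_sub _ _
      _ ≤ 2 * B / ρ * ρ := by rw [div_mul_cancel₀ _ hρ.ne']; linarith
      _ ≤ 2 * B / ρ * ‖θ - θ₀‖ := by gcongr
      _ ≤ _ := by
        gcongr
        exact (le_max_right _ _).trans (le_max_right _ _)

theorem aemeasurable_logDensity (hS : MeasurableSet S)
    (hcont : ContinuousOn (Function.uncurry ℓ) (Θ ×ˢ S)) {θ : EuclideanSpace ℝ (Fin k)}
    (hθ : θ ∈ Θ) : AEMeasurable (ℓ θ) (ν.restrict S) := by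
  have : ContinuousOn (ℓ θ) S :=
    hcont.comp (f := fun b => (θ, b)) (by fun_prop) fun b hb => ⟨hθ, hb⟩
  exact this.aemeasurable hS

theorem prior_eq_tilted (hS : MeasurableSet S)
    (hcont : ContinuousOn (Function.uncurry ℓ) (Θ ×ˢ S)) {θ θ' : EuclideanSpace ℝ (Fin k)}
    (hθ : θ ∈ Θ) (hθ' : θ' ∈ Θ) [IsProbabilityMeasure (prior ν S ℓ θ)]
    [IsProbabilityMeasure (prior ν S ℓ θ')] :
    prior ν S ℓ θ' = (prior ν S ℓ θ).tilted (fun b => ℓ θ' b - ℓ θ b) ∧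
      Integrable (fun b => Real.exp (ℓ θ' b - ℓ θ b)) (prior ν S ℓ θ) := by
  have h1 : AEMeasurable (ℓ θ) (ν.restrict S) := aemeasurable_logDensity hS hcont hθ
  have h2 : AEMeasurable (ℓ θ') (ν.restrict S) := aemeasurable_logDensity hS hcont hθ'
  have hac : prior ν S ℓ θ ≪ ν.restrict S := withDensity_absolutelyContinuous _ _
  have hmu : AEMeasurable (fun b => ENNReal.ofReal (Real.exp (ℓ θ' b - ℓ θ b))) (ν.restrict S) :=
    (h2.sub h1).exp.ennreal_ofReal
  have e1 : prior ν S ℓ θ' =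
      (prior ν S ℓ θ).withDensity fun b => ENNReal.ofReal (Real.exp (ℓ θ' b - ℓ θ b)) := by
    rw [prior, prior, ← withDensity_mul₀ h1.exp.ennreal_ofReal hmu]
    congr 1
    ext b
    rw [Pi.mul_apply, ← ENNReal.ofReal_mul (Real.exp_pos _).le, ← Real.exp_add]
    ring_nf
  have e2 : ∫⁻ b, ENNReal.ofReal (Real.exp (ℓ θ' b - ℓ θ b)) ∂prior ν S ℓ θ = 1 := by
    rw [← setLIntegral_univ, ← withDensity_apply _ MeasurableSet.univ, ← e1, measure_univ]
  have hint : Integrable (fun b => Real.exp (ℓ θ' b - ℓ θ b)) (prior ν S ℓ θ) := by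
    refine ⟨((h2.sub h1).exp.mono_ac hac).aestronglyMeasurable, ?_⟩
    rw [hasFiniteIntegral_iff_ofReal (ae_of_all _ fun b => (Real.exp_pos _).le), e2]
    norm_num
  refine ⟨?_, hint⟩
  have e3 : ∫ b, Real.exp (ℓ θ' b - ℓ θ b) ∂prior ν S ℓ θ = 1 := by
    rw [integral_eq_lintegral_of_nonneg_ae (ae_of_all _ fun b => (Real.exp_pos _).le)
      hint.aestronglyMeasurable, e2]
    simp
  rw [Measure.tilted, e3]
  simpa using e1

end Prior

/-! ### Comparison estimates for the model -/

section Comparison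

variable {n p : ℕ} (σ : ℝ) (X : Fin n → Fin p → ℝ) (y : Fin n → ℝ)
  {m : Measure ℝ} [IsProbabilityMeasure m] {M η : ℝ}

theorem isProbabilityMeasure_posterior (hm : ∀ᵐ b ∂m, |b| ≤ M) :
    IsProbabilityMeasure (posterior σ m X y) := by
  have := isProbabilityMeasure_site σ X y hm
  exact isProbabilityMeasure_gibbs (fun _ => ae_tilted hm) (posterior_eq_gibbs σ X y hm)

theorem ae_abs_le_posterior (hm : ∀ᵐ b ∂m, |b| ≤ M) :
    ∀ᵐ β ∂posterior σ m X y, ∀ i, |β i| ≤ M :=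
  ae_tilted (ae_pi_box fun _ => hm)

theorem isProbabilityMeasure_meanField_site (hm : ∀ᵐ b ∂m, |b| ≤ M) (s : Fin p → ℝ) (i : Fin p) :
    IsProbabilityMeasure ((m.tilted (siteExponent σ X y i)).tilted
      fun b => -(interaction σ X *ᵥ s) i * b) := by
  have := isProbabilityMeasure_site σ X y hm
  exact isProbabilityMeasure_tilted_mul (ae_tilted hm) _

theorem isProbabilityMeasure_meanField (hm : ∀ᵐ b ∂m, |b| ≤ M) (s : Fin p → ℝ) :
    IsProbabilityMeasure (meanFieldMeasure σ X y m s) := by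
  have := isProbabilityMeasure_meanField_site σ X y hm s
  unfold meanFieldMeasure
  infer_instance

theorem ae_abs_le_meanField (hm : ∀ᵐ b ∂m, |b| ≤ M) (s : Fin p → ℝ) :
    ∀ᵐ β ∂meanFieldMeasure σ X y m s, ∀ i, |β i| ≤ M := by
  have := isProbabilityMeasure_meanField_site σ X y hm s
  exact ae_pi_box fun _ => ae_tilted (ae_tilted hm)

theorem integral_meanField (hm : ∀ᵐ b ∂m, |b| ≤ M) (s : Fin p → ℝ) (i : Fin p) {f : ℝ → ℝ}
    (hf : Measurable f) :
    ∫ β, f (β i) ∂meanFieldMeasure σ X y m s =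
      ∫ b, f b ∂(m.tilted (siteExponent σ X y i)).tilted
        fun b => -(interaction σ X *ᵥ s) i * b := by
  have := isProbabilityMeasure_meanField_site σ X y hm s
  exact integral_comp_eval (μ := fun j => (m.tilted (siteExponent σ X y j)).tilted
    fun b => -(interaction σ X *ᵥ s) j * b) (i := i) (f := f) hf.aestronglyMeasurable

theorem abs_integral_posterior_sub_meanField_le (hM : 0 < M) (hm : ∀ᵐ b ∂m, |b| ≤ M)
    (hη0 : 0 ≤ η) (hη1 : 4 * M ^ 2 * η ≤ 1) (hη2 : 64 * M ^ 4 * η ^ 2 ≤ 1)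
    (hη : ∀ v : Fin p → ℝ, ∑ i, (interaction σ X *ᵥ v) i ^ 2 ≤ η ^ 2 * ∑ i, v i ^ 2)
    {G : ℝ} (hG0 : 0 ≤ G) (hG : p * η ^ 4 ≤ G ^ 2) {s : Fin p → ℝ}
    (hs : IsMeanFieldSolution (fun i => m.tilted (siteExponent σ X y i)) (interaction σ X) s)
    (i : Fin p) {f : ℝ → ℝ} {F : ℝ} (hf : Measurable f) (hF : 0 ≤ F)
    (hfb : ∀ b, |b| ≤ M → |f b| ≤ F) :
    |(∫ β, f (β i) ∂posterior σ m X y) - ∫ β, f (β i) ∂meanFieldMeasure σ X y m s| ≤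
      4 * F * M * (2 * M + 128 * M ^ 5 * G) * η := by
  have := isProbabilityMeasure_site σ X y hm
  rw [integral_meanField σ X y hm s i hf]
  exact gibbs_meanField_close hM (fun _ => ae_tilted hm) (interaction_isSymm σ X)
    (interaction_diag σ X) hη0 hη1 hη2 hη hG0 (by simpa using hG) (posterior_eq_gibbs σ X y hm)
    hs i hf hF hfb

theorem abs_integral_meanField_sub_le (hM : 0 < M) (hm : ∀ᵐ b ∂m, |b| ≤ M)
    (hη0 : 0 ≤ η) (hη2 : 64 * M ^ 4 * η ^ 2 ≤ 1)
    (hη : ∀ v : Fin p → ℝ, ∑ i, (interaction σ X *ᵥ v) i ^ 2 ≤ η ^ 2 * ∑ i, v i ^ 2)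
    {u : ℝ → ℝ} {Δ : ℝ} (hΔ : 0 ≤ Δ) (hu : AEMeasurable u m) (hub : ∀ᵐ b ∂m, |u b| ≤ Δ)
    (hui : Integrable (fun b => Real.exp (u b)) m) {s s' : Fin p → ℝ}
    (hs : IsMeanFieldSolution (fun i => m.tilted (siteExponent σ X y i)) (interaction σ X) s)
    (hs' : IsMeanFieldSolution (fun i => (m.tilted u).tilted (siteExponent σ X y i))
      (interaction σ X) s')
    (i : Fin p) {f : ℝ → ℝ} {F : ℝ} (hf : Measurable f) (hF : 0 ≤ F)
    (hfb : ∀ b, |b| ≤ M → |f b| ≤ F) :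
    |(∫ β, f (β i) ∂meanFieldMeasure σ X y (m.tilted u) s') -
        ∫ β, f (β i) ∂meanFieldMeasure σ X y m s| ≤
      4 * F * (8 * M ^ 2 * η * Real.sqrt p + 1) * Δ := by
  have := isProbabilityMeasure_site σ X y hm
  have := isProbabilityMeasure_tilted hui
  rw [integral_meanField σ X y hm s i hf, integral_meanField σ X y (ae_tilted hm) s' i hf]
  have hsite : ∀ i, Integrable (fun b => Real.exp (siteExponent σ X y i b)) m := fun i =>
    integrable_of_ae_interval hm (by unfold siteExponent; fun_prop)
  have h := meanField_stability (μ := fun i => m.tilted (siteExponent σ X y i))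
    (μ' := fun i => (m.tilted u).tilted (siteExponent σ X y i)) hM (fun _ => ae_tilted hm) hη0 hη2
    hη hΔ (fun i => hu.mono_ac (tilted_absolutelyContinuous _ _)) (fun i => ae_tilted hub)
    (fun i => by rw [tilted_tilted hui, tilted_tilted (hsite i), add_comm]) hs hs' i hf hF hfb
  simpa using h

end Comparison

/-! ### Sample size and conclusion -/

theorem eventually_sampleSize {n : ℕ → ℕ}
    (hn : (fun p : ℕ => (p : ℝ)) =o[atTop] fun p : ℕ => (n p : ℝ) ^ (2 / 3 : ℝ))
    (κ : ℝ) :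
    ∀ᶠ p : ℕ in atTop, 0 < p ∧ 0 < n p ∧ p ≤ n p ∧ (p : ℝ) * (p / n p) ^ 2 ≤ 1 ∧
      κ * Real.sqrt (p / n p) ≤ 1 := by
  filter_upwards [hn.def one_pos, eventually_ge_atTop 1,
    tendsto_natCast_atTop_atTop.eventually_ge_atTop (κ ^ 4)] with p hp h1 hκ
  have h1' : (1 : ℝ) ≤ p := by exact_mod_cast h1
  rw [one_mul, Real.norm_of_nonneg (by positivity), Real.norm_of_nonneg (by positivity)] at hp
  have hn0 : 0 < n p := by
    rcases Nat.eq_zero_or_pos (n p) with h | h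
    · rw [h, Nat.cast_zero, Real.zero_rpow (by norm_num)] at hp
      linarith
    · exact h
  have hn0' : (0 : ℝ) < n p := by exact_mod_cast hn0
  have h3 : (p : ℝ) ^ 3 ≤ (n p : ℝ) ^ 2 := by
    calc (p : ℝ) ^ 3 ≤ ((n p : ℝ) ^ (2 / 3 : ℝ)) ^ 3 := by gcongr
      _ = (n p : ℝ) ^ 2 := by
        rw [← Real.rpow_natCast, ← Real.rpow_mul hn0'.le, ← Real.rpow_natCast]
        norm_num
  have hratio : (p : ℝ) * (p / n p) ^ 2 ≤ 1 := by
    rw [div_pow, ← mul_div_assoc, div_le_one (by positivity)]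
    linarith
  refine ⟨h1, hn0, ?_, hratio, ?_⟩
  · have : (p : ℝ) ^ 2 ≤ (n p : ℝ) ^ 2 := (pow_le_pow_right₀ h1' (by norm_num)).trans h3
    exact_mod_cast (pow_le_pow_iff_left₀ (by positivity) (by positivity) two_ne_zero).1 this
  -- The fourth power of the left side is `κ⁴ (p/n)²`, at most `p (p/n)² ≤ 1` once `p ≥ κ⁴`.
  · refine le_of_abs_le ?_
    rw [← pow_le_one_iff_of_nonneg (abs_nonneg _) (n := 4) (by norm_num),
      show (4 : ℕ) = 2 * 2 from rfl, pow_mul, sq_abs, mul_pow, Real.sq_sqrt (by positivity),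
      mul_pow, ← pow_mul]
    exact (mul_le_mul_of_nonneg_right hκ (by positivity)).trans hratio

end VEB

theorem mainTheorem4 {k : ℕ}
    -- the entry distribution of the design: mean zero, variance one, sub-Gaussian norm at most `K`
    (P : Measure ℝ) [IsProbabilityMeasure P] (K : ℝ≥0)
    (hP_mean : ∫ z, z ∂P = 0) (hP_var : Var[fun z => z; P] = 1)
    (hP_sub : HasSubgaussianMGF (fun z => z) (K ^ 2) P)
    -- the known noise level, and the sample size `n = n(p)` with `p = o(n ^ (2/3))`
    (σ : ℝ) (hσ : 0 < σ) (n : ℕ → ℕ)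
    (hn : (fun p : ℕ => (p : ℝ)) =o[atTop] fun p : ℕ => (n p : ℝ) ^ (2 / 3 : ℝ))
    -- the parametric family of priors with common bounded support `S`
    (ν : Measure ℝ) (S : Set ℝ) (hS : Bornology.IsBounded S)
    (Θ : Set (EuclideanSpace ℝ (Fin k))) (hΘ : IsCompact Θ)
    (θ₀ : EuclideanSpace ℝ (Fin k)) (hθ₀ : θ₀ ∈ interior Θ)
    (ℓ : EuclideanSpace ℝ (Fin k) → ℝ → ℝ)
    (hprob : ∀ θ ∈ Θ, IsProbabilityMeasure (VEB.prior ν S ℓ θ))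
    (hsupp : ∀ θ ∈ Θ, (VEB.prior ν S ℓ θ).support = S)
    (hcont : ContinuousOn (Function.uncurry ℓ) (Θ ×ˢ S))
    (hgrad : ∃ L : ℝ, ∀ θ ∈ interior Θ, ∀ b ∈ S,
      DifferentiableAt ℝ (fun ϑ => ℓ ϑ b) θ ∧ ‖gradient (fun ϑ => ℓ ϑ b) θ‖ ≤ L) :
    ∀ ε : ℝ, 0 < ε → ∃ C : ℝ, ∀ᶠ p : ℕ in atTop,
      ∀ θhat : (Fin (n p) → Fin p → ℝ) → (Fin (n p) → ℝ) → EuclideanSpace ℝ (Fin k),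
        (∀ X y, θhat X y ∈ Θ) →
        VEB.designLaw P (n p) p
          {X | ¬ ∀ y : Fin (n p) → ℝ, ∃ Q₀ Qhat : Measure (Fin p → ℝ),
            -- `Q₀`, `Qhat` are the variational oracle and the variational EB posterior
            (VEB.IsVariationalPosterior σ (VEB.prior ν S ℓ θ₀) X y Q₀ ∧
              ∀ Q, VEB.IsVariationalPosterior σ (VEB.prior ν S ℓ θ₀) X y Q → Q = Q₀) ∧
            (VEB.IsVariationalPosterior σ (VEB.prior ν S ℓ (θhat X y)) X y Qhat ∧
              ∀ Q, VEB.IsVariationalPosterior σ (VEB.prior ν S ℓ (θhat X y)) X y Q → Q = Qhat) ∧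
            ∀ i : Fin p,
              VEB.MarginalsClose (VEB.posterior σ (VEB.prior ν S ℓ θ₀) X y) Q₀ i
                (C * Real.sqrt (p / n p)) ∧
              VEB.MarginalsClose (VEB.posterior σ (VEB.prior ν S ℓ (θhat X y)) X y) Qhat i
                (C * Real.sqrt (p / n p)) ∧
              VEB.MarginalsClose (VEB.posterior σ (VEB.prior ν S ℓ θ₀) X y) Qhat i
                (C * (Real.sqrt (p / n p) +
                  (p / Real.sqrt (n p) + 1) * ‖θhat X y - θ₀‖))}
          ≤ ENNReal.ofReal ε := by
  open VEB in
  intro ε hε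
  have hθ₀' : θ₀ ∈ Θ := interior_subset hθ₀
  have hSc : IsCompact S := Metric.isCompact_of_isClosed_isBounded
    (hsupp θ₀ hθ₀' ▸ Measure.isClosed_support) hS
  obtain ⟨M₀, hM₀⟩ := hS.exists_norm_le
  obtain ⟨M, hM1, hSM⟩ : ∃ M : ℝ, 1 ≤ M ∧ ∀ b ∈ S, |b| ≤ M :=
    ⟨max 1 M₀, le_max_left _ _, fun b hb => (hM₀ b hb).trans (le_max_right _ _)⟩
  have hM : 0 < M := by linarith
  obtain ⟨T, hT, hconc⟩ := designLaw_gram_concentration hP_mean hP_var hP_sub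
  obtain ⟨L, hL, hlip⟩ := exists_lipschitz_logDensity hSc hΘ hθ₀ hcont hgrad
  set η₀ : ℝ := 2 * T / σ ^ 2 with hη₀
  have hη₀0 : 0 ≤ η₀ := by positivity
  set C₁ : ℝ := 4 * M * (2 * M + 128 * M ^ 5 * η₀ ^ 2) * η₀ with hC₁
  set C₂ : ℝ := 4 * (8 * M ^ 2 * η₀ + 1) * L with hC₂
  have hC₁0 : 0 ≤ C₁ := by positivity
  have hC₂0 : 0 ≤ C₂ := by positivity
  have hsmall : ∀ᶠ p : ℕ in atTop, 4 * (1 / 2 : ℝ) ^ p ≤ ε := by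
    have h := (tendsto_pow_atTop_nhds_zero_of_lt_one (r := (1 / 2 : ℝ)) (by norm_num)
      (by norm_num)).const_mul 4
    rw [mul_zero] at h
    exact (h.eventually (gt_mem_nhds hε)).mono fun _ h => h.le
  refine ⟨3 * M ^ 2 * (C₁ + C₂), ?_⟩
  filter_upwards [eventually_sampleSize hn (8 * M ^ 2 * η₀), hsmall] with p ⟨hp0, hn0, hpn, hratio, hκ⟩ hp
  intro θhat hθhat
  -- The concentration event involves neither `y` nor `θhat`, which gives uniformity in both.
  -- Monotonicity of the outer measure needs no measurability of the failure event or of the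
  -- estimator.
  refine le_trans (measure_mono ?_)
    ((hconc (n p) p hn0 hpn).trans (ENNReal.ofReal_le_ofReal hp))
  intro X hX
  by_contra hgood
  refine hX fun y => ?_
  have hgood' : ∀ u : Fin p → ℝ, |(∑ a, (∑ j, X a j * u j) ^ 2) - ∑ j, u j ^ 2| ≤
      T * Real.sqrt (p / n p) * ∑ j, u j ^ 2 := fun u => not_lt.1 fun h => hgood ⟨u, h⟩
  have hp0' : (0 : ℝ) < p := by exact_mod_cast hp0
  have hn0' : (0 : ℝ) < n p := by exact_mod_cast hn0
  set ρ : ℝ := Real.sqrt (p / n p) with hρ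
  have hρ0 : 0 < ρ := Real.sqrt_pos.2 (by positivity)
  set η : ℝ := η₀ * ρ with hη_def
  have hη0 : 0 ≤ η := by positivity
  have hκ' : 8 * M ^ 2 * η ≤ 1 := by rwa [hη_def, ← mul_assoc]
  have hη1 : 4 * M ^ 2 * η ≤ 1 := by
    have : 0 ≤ M ^ 2 * η := by positivity
    linarith
  have hη2 : 64 * M ^ 4 * η ^ 2 ≤ 1 := by
    calc 64 * M ^ 4 * η ^ 2 = (8 * M ^ 2 * η) ^ 2 := by ring
      _ ≤ 1 := pow_le_one₀ (by positivity) hκ'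
  have hη : ∀ v : Fin p → ℝ, ∑ i, (interaction σ X *ᵥ v) i ^ 2 ≤ η ^ 2 * ∑ i, v i ^ 2 := by
    have e : 2 * (T * ρ) / σ ^ 2 = η := by rw [hη_def, hη₀]; ring
    exact e ▸ interaction_norm_le σ X hσ (by positivity) hgood'
  have hρ2 : ρ ^ 2 = p / n p := Real.sq_sqrt (by positivity)
  -- The only place where the full strength `p³ ≤ n²` is needed: it bounds the accumulated `ℓ²`
  -- error of the mean-field approximation.
  have hG : p * η ^ 4 ≤ (η₀ ^ 2) ^ 2 := by
    calc p * η ^ 4 = η₀ ^ 4 * (p * (ρ ^ 2) ^ 2) := by rw [hη_def]; ring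
      _ ≤ η₀ ^ 4 * 1 := by rw [hρ2]; gcongr
      _ = _ := by ring
  -- This identity turns the stability factor `η √p` into the `p / √n` of part (b).
  have hηp : η * Real.sqrt p = η₀ * (p / Real.sqrt (n p)) := by
    rw [hη_def, mul_assoc]
    congr 1
    rw [hρ, Real.sqrt_div hp0'.le, div_mul_eq_mul_div, Real.mul_self_sqrt hp0'.le]
  have hbox : ∀ θ ∈ Θ, ∀ᵐ b ∂prior ν S ℓ θ, |b| ≤ M := fun θ hθ =>
    ae_abs_le_of_support_eq hSM (hsupp θ hθ)
  have hsol : ∀ θ ∈ Θ, ∃ s, IsMeanFieldSolution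
      (fun i => (prior ν S ℓ θ).tilted (siteExponent σ X y i)) (interaction σ X) s := fun θ hθ => by
    have := hprob θ hθ
    have := isProbabilityMeasure_site σ X y (hbox θ hθ)
    exact exists_isMeanFieldSolution hM (fun _ => ae_tilted (hbox θ hθ)) hη2 hη
  have hclose : ∀ θ ∈ Θ, ∀ s, IsMeanFieldSolution
      (fun i => (prior ν S ℓ θ).tilted (siteExponent σ X y i)) (interaction σ X) s →
      ∀ (i : Fin p) (f : ℝ → ℝ) (F : ℝ), Measurable f → 0 ≤ F → (∀ b, |b| ≤ M → |f b| ≤ F) →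
      |(∫ β, f (β i) ∂posterior σ (prior ν S ℓ θ) X y) -
        ∫ β, f (β i) ∂meanFieldMeasure σ X y (prior ν S ℓ θ) s| ≤ F * (C₁ * ρ) :=
    fun θ hθ s hs i f F hf hF hfb => by
      have := hprob θ hθ
      refine (abs_integral_posterior_sub_meanField_le σ X y hM (hbox θ hθ) hη0 hη1 hη2 hη
        (sq_nonneg η₀) hG hs i hf hF hfb).trans (le_of_eq ?_)
      rw [hC₁, hη_def]
      ring
  have hmarg : ∀ θ ∈ Θ, ∀ θ' ∈ Θ, ∀ s (i : Fin p) (R r : ℝ), 0 ≤ R → 3 * M ^ 2 * R ≤ r →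
      (∀ (f : ℝ → ℝ) (F : ℝ), Measurable f → 0 ≤ F → (∀ b, |b| ≤ M → |f b| ≤ F) →
        |(∫ β, f (β i) ∂posterior σ (prior ν S ℓ θ) X y) -
          ∫ β, f (β i) ∂meanFieldMeasure σ X y (prior ν S ℓ θ') s| ≤ F * R) →
      MarginalsClose (posterior σ (prior ν S ℓ θ) X y)
        (meanFieldMeasure σ X y (prior ν S ℓ θ') s) i r :=
    fun θ hθ θ' hθ' s i R r hR hr h => by
      have := hprob θ hθ
      have := hprob θ' hθ'
      have := isProbabilityMeasure_posterior σ X y (hbox θ hθ)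
      have := isProbabilityMeasure_meanField σ X y (hbox θ' hθ') s
      exact marginalsClose_of_integral_close hM1 hR (ae_abs_le_posterior σ X y (hbox θ hθ))
        (ae_abs_le_meanField σ X y (hbox θ' hθ') s) i h hr
  have hsame : ∀ θ ∈ Θ, ∀ s, IsMeanFieldSolution
      (fun i => (prior ν S ℓ θ).tilted (siteExponent σ X y i)) (interaction σ X) s →
      ∀ i : Fin p, MarginalsClose (posterior σ (prior ν S ℓ θ) X y)
        (meanFieldMeasure σ X y (prior ν S ℓ θ) s) i (3 * M ^ 2 * (C₁ + C₂) * ρ) :=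
    fun θ hθ s hs i => hmarg θ hθ θ hθ s i (C₁ * ρ) _ (by positivity)
      (by rw [mul_assoc (3 * M ^ 2)]; gcongr; linarith) (hclose θ hθ s hs i)
  have hθ := hθhat X y
  set θ := θhat X y
  have hpr₀ := hprob θ₀ hθ₀'
  have hpr := hprob θ hθ
  obtain ⟨s, hs⟩ := hsol θ₀ hθ₀'
  obtain ⟨t, ht⟩ := hsol θ hθ
  refine ⟨meanFieldMeasure σ X y (prior ν S ℓ θ₀) s, meanFieldMeasure σ X y (prior ν S ℓ θ) t,
    isVariationalPosterior_meanField σ X y hM (hsupp θ₀ hθ₀') hSM hη0 hη1 hη hs,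
    isVariationalPosterior_meanField σ X y hM (hsupp θ hθ) hSM hη0 hη1 hη ht,
    fun i => ⟨hsame θ₀ hθ₀' s hs i, hsame θ hθ t ht i, ?_⟩⟩
  set w : ℝ := (p / Real.sqrt (n p) + 1) * ‖θ - θ₀‖ with hw
  have hw0 : 0 ≤ w := by positivity
  -- Triangle inequality through the oracle variational posterior: `C₁ * ρ` is the mean-field error
  -- at `θ₀`, and `C₂ * w` the effect of replacing `θ₀` by the estimate.
  refine hmarg θ₀ hθ₀' θ hθ t i (C₁ * ρ + C₂ * w) _ (by positivity) ?_
    fun f F hf hF hfb => ?_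
  · rw [mul_assoc (3 * M ^ 2)]
    gcongr
    have h1 : 0 ≤ C₁ * w := by positivity
    have h2 : 0 ≤ C₂ * ρ := by positivity
    linarith
  obtain ⟨htilt, hint⟩ := prior_eq_tilted (ν := ν) hSc.measurableSet hcont hθ₀' hθ
  have hac : prior ν S ℓ θ₀ ≪ ν.restrict S := withDensity_absolutelyContinuous _ _
  have hstab : |(∫ β, f (β i) ∂meanFieldMeasure σ X y (prior ν S ℓ θ) t) -
      ∫ β, f (β i) ∂meanFieldMeasure σ X y (prior ν S ℓ θ₀) s| ≤
      4 * F * (8 * M ^ 2 * η * Real.sqrt p + 1) * (L * ‖θ - θ₀‖) := by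
    rw [htilt] at ht ⊢
    refine abs_integral_meanField_sub_le σ X y hM (hbox θ₀ hθ₀') hη0 hη2 hη (by positivity)
      (((aemeasurable_logDensity hSc.measurableSet hcont hθ).sub
        (aemeasurable_logDensity hSc.measurableSet hcont hθ₀')).mono_ac hac) ?_ hint hs ht i hf hF
      hfb
    filter_upwards [hac.ae_le (ae_restrict_mem hSc.measurableSet)] with b hb
    exact hlip θ hθ b hb
  have hstab' : 4 * F * (8 * M ^ 2 * η * Real.sqrt p + 1) * (L * ‖θ - θ₀‖) ≤ F * (C₂ * w) := by
    rw [mul_assoc (8 * M ^ 2), hηp, hC₂, hw]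
    have h1 : 8 * M ^ 2 * (η₀ * (p / Real.sqrt (n p))) + 1 ≤
        (8 * M ^ 2 * η₀ + 1) * (p / Real.sqrt (n p) + 1) := by
      have h2 : 0 ≤ 8 * M ^ 2 * η₀ := by positivity
      have h3 : 0 ≤ p / Real.sqrt (n p) := by positivity
      linarith
    calc _ ≤ 4 * F * ((8 * M ^ 2 * η₀ + 1) * (p / Real.sqrt (n p) + 1)) * (L * ‖θ - θ₀‖) := by
          gcongr
      _ = _ := by ring
  have h1 := hclose θ₀ hθ₀' s hs i f F hf hF hfb
  rw [abs_sub_comm] at hstab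
  refine (abs_sub_le _ (∫ β, f (β i) ∂meanFieldMeasure σ X y (prior ν S ℓ θ₀) s) _).trans ?_
  linarith
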